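/- **Setting.** Let $n\in\mathbb N$, $h>0$, $I\in\mathbb N$, $I\ge 1$, $\vartheta=Ih$. A function $x$ on $[a,b)$ or $[a,b]$ is piecewise Lipschitz if there are points $a=\xi_1<\dots<\xi_k=b$ such that $x$ is Lipschitz on each $[\xi_i,\xi_{i+1})$. Let $\mathrm{PLip}$ and $\mathrm{Lip}$ be the spaces of piecewise Lipschitz and of Lipschitz functions $w:[-h,0)\to\mathbb R^n$, let $\mathrm C^1\subset\mathrm{Lip}$ be the continuously differentiable functions in $\mathrm{Lip}$, and let $\mathrm{PLip}_*$ be the set of $w\in\mathrm{PLip}$ that are continuously differentiable on $[-h,-h+\delta_w]$ for some $\delta_w\in(0,h)$. Put $\|w\|_1=\int_{-h}^0\|w(\xi)\|\,d\xi$, $\|w\|_\infty=\sup_{[-h,0)}\|w\|$, $w(-0)=\lim_{\xi\uparrow0}w(\xi)$, $P(\alpha)=\{(z,w)\in\mathbb R^n\times\mathrm{PLip}:\|z\|\le\alpha,\ \|w\|_\infty\le\alpha\}$, $\mathbb G=[0,\vartheta]\times\mathbb R^n\times\mathrm{PLip}$ and $\mathbb G_*=\bigcup_{i=0}^{I-1}(ih,(i+1)h)\times\mathbb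 R^n\times\mathrm{PLip}_*$. Let $g:[0,\vartheta]\times\mathbb R^n\to\mathbb R^n$ be continuously differentiable; let $H:[0,\vartheta]\times\mathbb R^n\times\mathbb R^n\times\mathbb R^n\to\mathbb R$ be continuous; let $c_H>0$ be such that $|H(\tau,z,r,s)-H(\tau,z,r,s')|\le c_H(1+\|z\|+\|r\|)\|s-s'\|$ always; suppose that for every $\alpha>0$ there is $\lambda_H>0$ with $|H(\tau,z,r,s)-H(\tau,z',r',s)|\le\lambda_H(\|z-z'\|+\|r-r'\|)(1+\|s\|)$ whenever $\|z\|,\|r\|,\|z'\|,\|r'\|\le\alpha$; and let $\sigma:\mathbb R^n\times\mathrm{PLip}\to\mathbb R$ be such that for every $\alpha>0$ there is $\lambda_\sigma>0$ with $|\sigma(z,w)-\sigma(z',w')|\le\lambda_\sigma(\|z-z'\|+\|w-w'\|_1)$ for all $(z,w),(z',w')\in P(\alpha)$. For $(\tau,w)$ with $(\tau,z,w)\in\mathbb G_*$ write $\partial g(\tau,w)=\frac{\partial g}{\partial\tau}(\tau,w(-h))+\nabla_xg(\tau,w(-h))\,\frac{d^+w}{d\xi}(-h)$ (the coinvariant derivative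 of $(\tau,z,w)\mapsto g(\tau,w(-h))$). For $(\tau,z,w)\in\mathbb G$ let $\Lambda(\tau,z,w)$ be the set of piecewise Lipschitz $x:[\tau-h,\vartheta]\to\mathbb R^n$ with $x(\tau)=z$ and $x(t)=w(t-\tau)$ on $[\tau-h,\tau)$; let $\kappa$ denote its element that equals $z$ on $[\tau,\vartheta]$; and let $x_t(\xi)=x(t+\xi)$, $\xi\in[-h,0)$. For a functional $\varphi:\mathbb G\to\mathbb R$ consider the conditions * $(\varphi_1)$ for all $\tau\in[0,\vartheta]$ and $w\in\mathrm{Lip}$, the function $t\mapsto\varphi(t,w(-0),w)$ is continuous on $[\tau,\vartheta]$; * $(\varphi_2)$ for every $\alpha>0$ there is $\lambda_\varphi>0$ with $|\varphi(\tau,z,w)-\varphi(\tau,z',w')|\le\lambda_\varphi\big(\|z-z'\|+\|w-w'\|_1+\|(w-w')(-h)\|+\|(w-w')(ih-\tau)\|\big)$ for all $\tau\in[0,\vartheta]$ and $(z,w),(z',w')\in P(\alpha)$, where $i$ is the integer with $\tau\in(ih,(i+1)h]$; * (T) $\varphi(\vartheta,z,w)=\sigma(z,w)$ for all $(z,w)\in\mathbb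 R^n\times\mathrm{PLip}$. For $\eta\in[0,1]$ let $F^\eta(x,y)=\{l\in\mathbb R^n:\|l\|\le c_H(1+\|x\|+\|y\|)+\eta\}$, and let $X^\eta(\tau,z,w)$ be the set of $x\in\Lambda(\tau,z,w)$ such that $y(t)=x(t)-g(t,x(t-h))$ is Lipschitz on $[\tau,\vartheta]$ and $\dot y(t)\in F^\eta(x(t),x(t-h))$ for a.e. $t\in[\tau,\vartheta]$. Put $\omega(\tau,t,x,s)=\int_\tau^tH(\xi,x(\xi),x(\xi-h),s)\,d\xi-\langle y(t)-y(\tau),s\rangle$. The minimax inequalities with parameters $(\eta,\tau,z,w,t,s)$ are $$\inf_{x\in X^\eta(\tau,z,w)}\big(\varphi(t,x(t),x_t)+\omega(\tau,t,x,s)\big)\le\varphi(\tau,z,w)\le\sup_{x\in X^\eta(\tau,z,w)}\big(\varphi(t,x(t),x_t)+\omega(\tau,t,x,s)\big).$$ For $\tau<\vartheta$ let $\partial^-_{1,l}\varphi(\tau,z,w)$ and $\partial^+_{1,l}\varphi(\tau,z,w)$, in $[-\infty,\infty]$, be the lower and upper limits, as $\delta\downarrow0$, of $\delta^{-1}\big(\varphi(\tau+\delta,z+l\delta,\kappa_{\tau+\delta})-\varphi(\tau,z,w)\big)$.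 Let $O^+_\delta(\tau,z)=\{(t,x):t\in[\tau,\tau+\delta]\cap[0,\vartheta],\ \|x-z\|\le\delta\}$. Let $D^-\varphi(\tau,z,w)$ be the set of $(p_0,p)\in\mathbb R\times\mathbb R^n$ with $$\lim_{\delta\downarrow0}\ \inf_{(t,x)\in O^+_\delta(\tau,z)\setminus\{(\tau,z)\}}\frac{\varphi(t,x,\kappa_t)-\varphi(\tau,z,w)-(t-\tau)p_0-\langle x-z,p\rangle}{|t-\tau|+\|x-z\|}\ge0,$$ and let $D^+\varphi(\tau,z,w)$ be the set of $(q_0,q)$ satisfying the same condition with $\sup$ and $\le0$ in place of $\inf$ and $\ge0$. **Theorem.** For every functional $\varphi:\mathbb G\to\mathbb R$ the following statements are equivalent. (a) ($\varphi$ is a minimax solution.) $\varphi$ satisfies $(\varphi_1)$, $(\varphi_2)$, (T), and the minimax inequalities hold with $\eta=0$ for all $(\tau,z,w)\in\mathbb G$ with $\tau<\vartheta$, all $t\in(\tau,\vartheta]$ and all $s\in\mathbb R^n$. (b) ($\varphi$ is a $\mathrm C^1$-minimax solution.) $\varphi$ satisfies $(\varphi_1)$, $(\varphi_2)$; $\varphi(\vartheta,w(-0),w)=\sigma(w(-0),w)$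 for all $w\in\mathrm C^1$; and the minimax inequalities with $z=w(-0)$ hold for all $i\in\{0,\dots,I-1\}$, $\tau\in[ih,(i+1)h)$, $w\in\mathrm C^1$, $t\in(\tau,(i+1)h]$, $s\in\mathbb R^n$ and $\eta\in(0,1]$. (c) $\varphi$ satisfies $(\varphi_1)$, $(\varphi_2)$, (T), and for all $(\tau,z,w)\in\mathbb G_*$ and $s\in\mathbb R^n$, with $L=F^0(z,w(-h))+\partial g(\tau,w)$, $$\inf_{l\in L}\big(\partial^-_{1,l}\varphi(\tau,z,w)+\langle\partial g(\tau,w),s\rangle+H(\tau,z,w(-h),s)-\langle l,s\rangle\big)\le0,$$ $$\sup_{l\in L}\big(\partial^+_{1,l}\varphi(\tau,z,w)+\langle\partial g(\tau,w),s\rangle+H(\tau,z,w(-h),s)-\langle l,s\rangle\big)\ge0.$$ (d) $\varphi$ satisfies $(\varphi_1)$, $(\varphi_2)$, (T), and for every $(\tau,z,w)\in\mathbb G_*$: $p_0+\langle\partial g(\tau,w),p\rangle+H(\tau,z,w(-h),p)\le0$ for all $(p_0,p)\in D^-\varphi(\tau,z,w)$, and $q_0+\langle\partial g(\tau,w),q\rangle+H(\tau,z,w(-h),q)\ge0$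 for all $(q_0,q)\in D^+\varphi(\tau,z,w)$. (e) ($\varphi$ is a viscosity solution.) $\varphi$ satisfies $(\varphi_1)$, $(\varphi_2)$, (T), and for all $(\tau,z,w)\in\mathbb G_*$, all continuously differentiable $\psi:\mathbb R\times\mathbb R^n\to\mathbb R$ and all $\delta>0$: if $\varphi(\tau,z,w)-\psi(\tau,z)\le\varphi(t,x,\kappa_t)-\psi(t,x)$ for all $(t,x)\in O^+_\delta(\tau,z)$, then $$\frac{\partial\psi}{\partial\tau}(\tau,z)+\langle\partial g(\tau,w),\nabla_z\psi(\tau,z)\rangle+H(\tau,z,w(-h),\nabla_z\psi(\tau,z))\le0,$$ and if the first inequality holds with $\ge$ in place of $\le$ for all $(t,x)\in O^+_\delta(\tau,z)$, then the last expression is $\ge0$. -/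

import Mathlib

open Set Filter Topology MeasureTheory Asymptotics
open scoped NNReal

noncomputable section

namespace NeutralHJ

/-- The Euclidean space `ℝⁿ`. -/
abbrev Vec (n : ℕ) := EuclideanSpace ℝ (Fin n)

/-- Piecewise Lipschitz continuity on `[a, b)`: there are points `a = ξ₀ < ξ₁ < … < ξₖ = b` such
that the function is Lipschitz continuous on every `[ξᵢ, ξᵢ₊₁)`. For a function on the closed
interval `[a, b]` the condition is the same (the value at `b` is free). -/
def PiecewiseLip {n : ℕ} (x : ℝ → Vec n) (a b : ℝ) : Prop :=
  ∃ (k : ℕ) (ξ : ℕ → ℝ), ξ 0 = a ∧ ξ k = b ∧ (∀ i < k, ξ i < ξ (i + 1)) ∧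
    ∀ i < k, ∃ K : ℝ≥0, LipschitzOnWith K x (Ico (ξ i) (ξ (i + 1)))

/-- The data of the Cauchy problem: the delay `h`, the number `I` with `ϑ = I h`, the functions
`g` and `H`, the terminal functional `σ`, and the constant `cH`. Only the values of `g` and `H` at
times in `[0, ϑ]` and the values of `σ` at piecewise Lipschitz histories are ever used. -/
structure Problem (n : ℕ) where
  h : ℝ
  I : ℕ
  g : ℝ → Vec n → Vec n
  H : ℝ → Vec n → Vec n → Vec n → ℝ
  σ : Vec n → (ℝ → Vec n) → ℝ
  cH : ℝ

namespace Problem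

variable {n : ℕ} (D : Problem n)

/-- The terminal time `ϑ = I h`. -/
def ϑ : ℝ := D.I * D.h

/-! ### Spaces of histories -/

/-- The space `PLip` of piecewise Lipschitz functions on `[-h, 0)`. A function on `[-h, 0)` is
represented by its extension by zero to the real line, which makes the representation unique. -/
def PLip : Set (ℝ → Vec n) :=
  {w | PiecewiseLip w (-D.h) 0 ∧ ∀ ξ, ξ ∉ Ico (-D.h) 0 → w ξ = 0}

/-- The space `Lip` of Lipschitz continuous functions on `[-h, 0)`. -/
def Lip : Set (ℝ → Vec n) :=
  {w | w ∈ D.PLip ∧ ∃ K : ℝ≥0, LipschitzOnWith K w (Ico (-D.h) 0)}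

/-- The space `C¹` of continuously differentiable functions on `[-h, 0)`, as a subspace of
`Lip` (that is, with bounded derivative). -/
def C1 : Set (ℝ → Vec n) :=
  {w | w ∈ D.Lip ∧ ContDiffOn ℝ 1 w (Ico (-D.h) 0)}

/-- The space `PLip_*` of piecewise Lipschitz functions on `[-h, 0)` that are continuously
differentiable on some interval `[-h, -h + δ]`. -/
def PLipStar : Set (ℝ → Vec n) :=
  {w | w ∈ D.PLip ∧ ∃ δ, 0 < δ ∧ δ < D.h ∧ ContDiffOn ℝ 1 w (Icc (-D.h) (-D.h + δ))}

/-- The left limit `w(-0)` at `0`. -/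
def atZero (w : ℝ → Vec n) : Vec n := Function.leftLim w 0

/-- `(τ, z, w) ∈ 𝔾 = [0, ϑ] × ℝⁿ × PLip`. -/
def G : Set (ℝ × Vec n × (ℝ → Vec n)) :=
  {q | q.1 ∈ Icc 0 D.ϑ ∧ q.2.2 ∈ D.PLip}

/-- `(τ, z, w) ∈ 𝔾_*`, the union of `(i h, (i + 1) h) × ℝⁿ × PLip_*` over `i = 0, …, I - 1`. -/
def GStar : Set (ℝ × Vec n × (ℝ → Vec n)) :=
  {q | (∃ i : ℕ, i < D.I ∧ q.1 ∈ Ioo (i * D.h) ((i + 1) * D.h)) ∧ q.2.2 ∈ D.PLipStar}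

/-- `P(α)`: pairs `(z, w)` with `‖z‖ ≤ α` and `‖w‖_∞ ≤ α`. -/
def P (α : ℝ) : Set (Vec n × (ℝ → Vec n)) :=
  {q | q.2 ∈ D.PLip ∧ ‖q.1‖ ≤ α ∧ ∀ ξ ∈ Ico (-D.h) 0, ‖q.2 ξ‖ ≤ α}

/-- The norm `‖w‖₁`. -/
def norm1 (w : ℝ → Vec n) : ℝ := ∫ ξ in (-D.h)..0, ‖w ξ‖

/-! ### Standing assumptions on the data -/

/-- Conditions `(g)`, `(H₁)`, `(H₂)`, `(H₃)`, `(σ)` together with `h > 0` and `ϑ > 0`. -/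
structure Admissible : Prop where
  h_pos : 0 < D.h
  I_pos : 0 < D.I
  g_contDiff : ContDiffOn ℝ 1 (fun q : ℝ × Vec n => D.g q.1 q.2) (Icc 0 D.ϑ ×ˢ univ)
  H_cont : ContinuousOn
    (fun q : ℝ × Vec n × Vec n × Vec n => D.H q.1 q.2.1 q.2.2.1 q.2.2.2) (Icc 0 D.ϑ ×ˢ univ)
  cH_pos : 0 < D.cH
  H_growth : ∀ τ ∈ Icc 0 D.ϑ, ∀ z r s s' : Vec n,
    |D.H τ z r s - D.H τ z r s'| ≤ D.cH * (1 + ‖z‖ + ‖r‖) * ‖s - s'‖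
  H_lip : ∀ α > 0, ∃ lam > 0, ∀ τ ∈ Icc 0 D.ϑ, ∀ z r z' r' s : Vec n,
    ‖z‖ ≤ α → ‖r‖ ≤ α → ‖z'‖ ≤ α → ‖r'‖ ≤ α →
    |D.H τ z r s - D.H τ z' r' s| ≤ lam * (‖z - z'‖ + ‖r - r'‖) * (1 + ‖s‖)
  σ_lip : ∀ α > 0, ∃ lam > 0, ∀ z w z' w', (z, w) ∈ D.P α → (z', w') ∈ D.P α →
    |D.σ z w - D.σ z' w'| ≤ lam * (‖z - z'‖ + D.norm1 (w - w'))

/-! ### Extensions of histories -/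

/-- The segment `x_t(ξ) = x(t + ξ)`, `ξ ∈ [-h, 0)`. -/
def seg (x : ℝ → Vec n) (t : ℝ) : ℝ → Vec n :=
  (Ico (-D.h) 0).indicator fun ξ => x (t + ξ)

/-- `Λ(τ, z, w)`: piecewise Lipschitz functions `x` on `[τ - h, ϑ]` with `x(τ) = z` and
`x(t) = w(t - τ)` for `t ∈ [τ - h, τ)` (values outside `[τ - h, ϑ]` are irrelevant). -/
def Lam (τ : ℝ) (z : Vec n) (w : ℝ → Vec n) : Set (ℝ → Vec n) :=
  {x | PiecewiseLip x (τ - D.h) D.ϑ ∧ x τ = z ∧ ∀ t ∈ Ico (τ - D.h) τ, x t = w (t - τ)}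

/-- `Λ₀(τ, z, w)`: the elements of `Λ(τ, z, w)` that are equal to `z` on `[τ, ϑ]`. -/
def Lam0 (τ : ℝ) (z : Vec n) (w : ℝ → Vec n) : Set (ℝ → Vec n) :=
  {x | x ∈ D.Lam τ z w ∧ ∀ t ∈ Icc τ D.ϑ, x t = z}

/-- The element `κ` of `Λ₀(τ, z, w)`; it is unique as a function on `[τ - h, ϑ]`. -/
def kappa (τ : ℝ) (z : Vec n) (w : ℝ → Vec n) : ℝ → Vec n :=
  fun t => if t < τ then w (t - τ) else z

/-- `kappa τ z w` is an element of `Λ₀(τ, z, w)`. -/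
theorem kappa_mem_Lam0 {τ : ℝ} {z : Vec n} {w : ℝ → Vec n} (hτ : τ ≤ D.ϑ)
    (hw : w ∈ D.PLip) : kappa τ z w ∈ D.Lam0 τ z w := by
  refine ⟨⟨?_, by simp [kappa], fun t ht => by simp [kappa, ht.2]⟩,
    fun t ht => by simp [kappa, not_lt.2 ht.1]⟩
  obtain ⟨⟨k, ξ, h0, hk, hlt, hL⟩, -⟩ := hw
  have hle : ∀ j i, i + j ≤ k → ξ i ≤ ξ (i + j) := by
    intro j
    induction j with
    | zero => intro i _; exact le_rfl
    | succ j ih => intro i hi; exact (ih i (by omega)).trans (hlt (i + j) (by omega)).le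
  have hle0 : ∀ i, i ≤ k → ξ i ≤ 0 := by
    intro i hi
    have := hle (k - i) i (by omega)
    rwa [Nat.add_sub_cancel' hi, hk] at this
  have hLip : ∀ i < k, ∃ K : ℝ≥0,
      LipschitzOnWith K (kappa τ z w) (Ico (ξ i + τ) (ξ (i + 1) + τ)) := by
    intro i hi
    obtain ⟨K, hK⟩ := hL i hi
    refine ⟨K, fun t ht t' ht' => ?_⟩
    have h1 := hle0 (i + 1) hi
    have e1 : kappa τ z w t = w (t - τ) := by
      simp only [kappa]; rw [if_pos]; linarith [ht.2]
    have e2 : kappa τ z w t' = w (t' - τ) := by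
      simp only [kappa]; rw [if_pos]; linarith [ht'.2]
    rw [e1, e2]
    have := hK (x := t - τ) ⟨by linarith [ht.1], by linarith [ht.2]⟩
      (y := t' - τ) ⟨by linarith [ht'.1], by linarith [ht'.2]⟩
    simpa [edist_dist, Real.dist_eq] using this
  rcases hτ.eq_or_lt with he | hl
  · exact ⟨k, fun i => ξ i + τ, by simp [h0]; ring, by simp [hk, he],
      fun i hi => by simpa using hlt i hi, hLip⟩
  · refine ⟨k + 1, fun i => if i ≤ k then ξ i + τ else D.ϑ, by simp [h0]; ring, by simp, ?_, ?_⟩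
    · intro i hi
      rcases (Nat.lt_succ_iff.1 hi).eq_or_lt with rfl | h
      · simpa [hk] using hl
      · simpa [h.le, Nat.succ_le_of_lt h] using hlt i h
    · intro i hi
      rcases (Nat.lt_succ_iff.1 hi).eq_or_lt with rfl | h
      · refine ⟨0, fun t ht t' ht' => ?_⟩
        simp only [le_refl, if_true, hk, zero_add] at ht ht'
        simp [kappa, not_lt.2 ht.1, not_lt.2 ht'.1]
      · simpa [h.le, Nat.succ_le_of_lt h] using hLip i h

/-! ### Coinvariant derivatives -/

/-- The functional `f` is ci-differentiable at `(τ, z, w)`, with ci-derivative `d` with respect to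
`{τ, w}` and gradient `p` with respect to `z`. -/
def HasCiDerivAt (f : ℝ → Vec n → (ℝ → Vec n) → ℝ) (d : ℝ) (p : Vec n)
    (τ : ℝ) (z : Vec n) (w : ℝ → Vec n) : Prop :=
  ∀ x ∈ D.Lam τ z w,
    (fun q : ℝ × Vec n =>
      f q.1 q.2 (D.seg x q.1) - f τ z w - ((q.1 - τ) * d + inner ℝ (q.2 - z) p))
    =o[𝓝[Icc τ D.ϑ ×ˢ univ] (τ, z)] fun q => |q.1 - τ| + ‖q.2 - z‖

/-- The ci-derivative `∂ᶜⁱ g(τ, w)` of `(τ, z, w) ↦ g(τ, w(-h))` at points of `𝔾_*`: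
`∂g/∂τ (τ, w(-h)) + ∇ₓ g(τ, w(-h)) d⁺w(-h)/dξ`. -/
def dg (τ : ℝ) (w : ℝ → Vec n) : Vec n :=
  derivWithin (fun t => D.g t (w (-D.h))) (Icc 0 D.ϑ) τ +
    fderiv ℝ (D.g τ) (w (-D.h)) (derivWithin w (Ici (-D.h)) (-D.h))

/-- Under condition `(g)`, the mapping `(τ, z, w) ↦ g(τ, w(-h))` is ci-differentiable on `𝔾_*`;
its ci-derivative is `D.dg τ w` and its gradient with respect to `z` is zero. -/
theorem hasCiDerivAt_g (hh : 0 < D.h)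
    (hg : ContDiffOn ℝ 1 (fun q : ℝ × Vec n => D.g q.1 q.2) (Icc 0 D.ϑ ×ˢ univ))
    {τ : ℝ} {z : Vec n} {w : ℝ → Vec n} (hG : (τ, z, w) ∈ D.GStar) (j : Fin n) :
    D.HasCiDerivAt (fun t _ w => D.g t (w (-D.h)) j) (D.dg τ w j) 0 τ z w := by
  obtain ⟨⟨i, hi, hiτ⟩, hw, δ, hδ, hδh, hwδ⟩ := hG
  simp only at hiτ hw hwδ
  have h0τ : 0 < τ := lt_of_le_of_lt (by positivity) hiτ.1
  have hτϑ : τ < D.ϑ := by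
    refine lt_of_lt_of_le hiτ.2 ?_
    have : ((i : ℝ) + 1) ≤ D.I := by exact_mod_cast hi
    exact mul_le_mul_of_nonneg_right this hh.le
  have hgd : DifferentiableAt ℝ (fun q : ℝ × Vec n => D.g q.1 q.2) (τ, w (-D.h)) :=
    (hg.contDiffAt (prod_mem_nhds (Icc_mem_nhds h0τ hτϑ) univ_mem)).differentiableAt (by simp)
  have hgf := hgd.hasFDerivAt
  set L := fderiv ℝ (fun q : ℝ × Vec n => D.g q.1 q.2) (τ, w (-D.h)) with hLdef
  -- partial derivatives
  have hp1 : derivWithin (fun t => D.g t (w (-D.h))) (Icc 0 D.ϑ) τ = L (1, 0) := by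
    have := HasFDerivAt.comp_hasDerivAt (f := fun t : ℝ => (t, w (-D.h))) τ hgf
      ((hasDerivAt_id τ).prodMk (hasDerivAt_const τ _))
    rw [derivWithin_of_mem_nhds (Icc_mem_nhds h0τ hτϑ)]
    exact this.deriv
  have hp2 : ∀ v, fderiv ℝ (D.g τ) (w (-D.h)) v = L (0, v) := by
    intro v
    have := HasFDerivAt.comp (f := fun x : Vec n => (τ, x)) (w (-D.h)) hgf
      ((hasFDerivAt_const τ _).prodMk (hasFDerivAt_id (w (-D.h))))
    have h2 : HasFDerivAt (D.g τ) _ (w (-D.h)) := this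
    rw [h2.fderiv]
    simp
  -- the right derivative of the history
  have hwd : HasDerivWithinAt w (derivWithin w (Ici (-D.h)) (-D.h)) (Ici (-D.h)) (-D.h) := by
    have h1 : DifferentiableWithinAt ℝ w (Icc (-D.h) (-D.h + δ)) (-D.h) :=
      hwδ.differentiableOn (by simp) _ ⟨le_rfl, by linarith⟩
    exact (h1.mono_of_mem_nhdsWithin (Icc_mem_nhdsGE (by linarith))).hasDerivWithinAt
  have hws : HasDerivWithinAt (fun t => w (t - D.h - τ)) (derivWithin w (Ici (-D.h)) (-D.h))
      (Icc τ D.ϑ) τ := by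
    have hs : HasDerivWithinAt (fun t : ℝ => t - D.h - τ) 1 (Icc τ D.ϑ) τ :=
      ((hasDerivAt_id τ).sub_const _ |>.sub_const _).hasDerivWithinAt
    have := HasDerivWithinAt.scomp_of_eq τ hwd hs (fun t ht => by
      simp only [mem_Ici]; linarith [ht.1]) (by ring)
    simpa [Function.comp_def] using this
  have hcomp : HasDerivWithinAt (fun t => D.g t (w (t - D.h - τ))) (D.dg τ w) (Icc τ D.ϑ) τ := by
    have hc := ((hasDerivWithinAt_id τ (Icc τ D.ϑ)).prodMk hws)
    have e : τ - D.h - τ = -D.h := by ring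
    have := HasFDerivAt.comp_hasDerivWithinAt_of_eq (f := fun t => (t, w (t - D.h - τ))) τ hgf hc
      (by simp [e])
    have e3 : D.dg τ w = L (1, derivWithin w (Ici (-D.h)) (-D.h)) := by
      simp only [dg, hp1, hp2, ← map_add]
      simp
    rw [e3]
    exact this
  have hj : HasDerivWithinAt (fun t => D.g t (w (t - D.h - τ)) j) (D.dg τ w j) (Icc τ D.ϑ) τ :=
    (EuclideanSpace.proj (𝕜 := ℝ) j).hasFDerivAt.comp_hasDerivWithinAt τ hcomp
  have ho := hasDerivWithinAt_iff_isLittleO.1 hj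
  intro x hx
  have hfst : Tendsto (fun q : ℝ × Vec n => q.1) (𝓝[Icc τ D.ϑ ×ˢ univ] (τ, z))
      (𝓝[Icc τ D.ϑ] τ) := by
    refine tendsto_nhdsWithin_iff.2 ⟨(continuous_fst.tendsto (τ, z)).mono_left inf_le_left, ?_⟩
    filter_upwards [self_mem_nhdsWithin] with q hq using hq.1
  have ho2 := ho.comp_tendsto hfst
  have ho3 := ho2.trans_isBigO (k := fun q : ℝ × Vec n => |q.1 - τ| + ‖q.2 - z‖) (by
    refine IsBigO.of_bound 1 (Eventually.of_forall fun q => ?_)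
    simp only [Function.comp, Real.norm_eq_abs, one_mul]
    exact (le_add_of_nonneg_right (norm_nonneg _)).trans (le_abs_self _))
  refine ho3.congr' ?_ EventuallyEq.rfl
  have hlt : ∀ᶠ q : ℝ × Vec n in 𝓝[Icc τ D.ϑ ×ˢ univ] (τ, z), q.1 < τ + D.h :=
    (hfst.mono_right inf_le_left).eventually (Iio_mem_nhds (by linarith))
  filter_upwards [hlt, self_mem_nhdsWithin] with q hq1 hq2
  have e1 : D.seg x q.1 (-D.h) = w (q.1 - D.h - τ) := by
    rw [seg, indicator_of_mem (by constructor <;> linarith), ← sub_eq_add_neg]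
    exact hx.2.2 _ ⟨by linarith [hq2.1.1], by linarith⟩
  have e2 : τ - D.h - τ = -D.h := by ring
  simp [e1, e2]

/-! ### The class of functionals

A functional `φ : 𝔾 → ℝ` is represented by a function of `τ`, `z`, `w`, of which only the values
at points of `𝔾` are ever used. -/

/-- `υ(τ, z, w) = ‖z‖ + ‖w‖₁ + ‖w(-h)‖ + ‖w(i h - τ)‖`, where `τ ∈ (i h, (i + 1) h]`, that is,
`i = ⌈τ / h⌉ - 1`. -/
def upsilon (τ : ℝ) (z : Vec n) (w : ℝ → Vec n) : ℝ :=
  ‖z‖ + D.norm1 w + ‖w (-D.h)‖ + ‖w (((⌈τ / D.h⌉ - 1 : ℤ) : ℝ) * D.h - τ)‖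

/-- Condition `(φ₁)`. -/
def Phi1 (φ : ℝ → Vec n → (ℝ → Vec n) → ℝ) : Prop :=
  ∀ τ ∈ Icc 0 D.ϑ, ∀ w ∈ D.Lip, ContinuousOn (fun t => φ t (atZero w) w) (Icc τ D.ϑ)

/-- Condition `(φ₂)`. -/
def Phi2 (φ : ℝ → Vec n → (ℝ → Vec n) → ℝ) : Prop :=
  ∀ α > 0, ∃ lam > 0, ∀ τ ∈ Icc 0 D.ϑ, ∀ z w z' w', (z, w) ∈ D.P α → (z', w') ∈ D.P α →
    |φ τ z w - φ τ z' w'| ≤ lam * D.upsilon τ (z - z') (w - w')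

/-- The terminal condition. -/
def Terminal (φ : ℝ → Vec n → (ℝ → Vec n) → ℝ) : Prop :=
  ∀ z, ∀ w ∈ D.PLip, φ D.ϑ z w = D.σ z w

/-! ### Minimax solutions -/

/-- The ball `F^η(x, y)`. -/
def F (η : ℝ) (x y : Vec n) : Set (Vec n) :=
  {l | ‖l‖ ≤ D.cH * (1 + ‖x‖ + ‖y‖) + η}

/-- `y(t) = x(t) - g(t, x(t - h))`. -/
def yOf (x : ℝ → Vec n) (t : ℝ) : Vec n := x t - D.g t (x (t - D.h))

/-- The set `X^η(τ, z, w)` of solutions of the neutral-type differential inclusion. -/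
def X (η τ : ℝ) (z : Vec n) (w : ℝ → Vec n) : Set (ℝ → Vec n) :=
  {x | x ∈ D.Lam τ z w ∧
    (∃ K : ℝ≥0, LipschitzOnWith K (D.yOf x) (Icc τ D.ϑ)) ∧
    ∀ᵐ t ∂(volume.restrict (Icc τ D.ϑ)),
      ∃ l ∈ D.F η (x t) (x (t - D.h)), HasDerivAt (D.yOf x) l t}

/-- The functional `ω(τ, t, x, s)`. -/
def omega (τ t : ℝ) (x : ℝ → Vec n) (s : Vec n) : ℝ :=
  (∫ ξ in τ..t, D.H ξ (x ξ) (x (ξ - D.h)) s) - inner ℝ (D.yOf x t - D.yOf x τ) s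

/-- The upper minimax inequality (an infimum over `X^η`). -/
def UpperIneq (φ : ℝ → Vec n → (ℝ → Vec n) → ℝ) (η τ : ℝ) (z : Vec n) (w : ℝ → Vec n)
    (t : ℝ) (s : Vec n) : Prop :=
  (⨅ x ∈ D.X η τ z w, ((φ t (x t) (D.seg x t) + D.omega τ t x s : ℝ) : EReal))
    ≤ ((φ τ z w : ℝ) : EReal)

/-- The lower minimax inequality (a supremum over `X^η`). -/
def LowerIneq (φ : ℝ → Vec n → (ℝ → Vec n) → ℝ) (η τ : ℝ) (z : Vec n) (w : ℝ → Vec n)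
    (t : ℝ) (s : Vec n) : Prop :=
  ((φ τ z w : ℝ) : EReal)
    ≤ ⨆ x ∈ D.X η τ z w, ((φ t (x t) (D.seg x t) + D.omega τ t x s : ℝ) : EReal)

/-- Minimax solutions. -/
def IsMinimax (φ : ℝ → Vec n → (ℝ → Vec n) → ℝ) : Prop :=
  D.Phi1 φ ∧ D.Phi2 φ ∧ D.Terminal φ ∧
    ∀ τ z w, (τ, z, w) ∈ D.G → τ < D.ϑ → ∀ t ∈ Ioc τ D.ϑ, ∀ s : Vec n,
      D.UpperIneq φ 0 τ z w t s ∧ D.LowerIneq φ 0 τ z w t s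

/-- `C¹`-minimax solutions. -/
def IsC1Minimax (φ : ℝ → Vec n → (ℝ → Vec n) → ℝ) : Prop :=
  D.Phi1 φ ∧ D.Phi2 φ ∧ (∀ w ∈ D.C1, φ D.ϑ (atZero w) w = D.σ (atZero w) w) ∧
    ∀ i : ℕ, i < D.I → ∀ τ ∈ Ico (i * D.h) ((i + 1) * D.h), ∀ w ∈ D.C1,
      ∀ t ∈ Ioc τ ((i + 1) * D.h), ∀ s : Vec n, ∀ η ∈ Ioc (0 : ℝ) 1,
        D.UpperIneq φ η τ (atZero w) w t s ∧ D.LowerIneq φ η τ (atZero w) w t s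

/-! ### Directional derivatives -/

/-- The difference quotient of `φ` at `(τ, z, w)` in the direction `(l₀, l)`. -/
def quot (φ : ℝ → Vec n → (ℝ → Vec n) → ℝ) (l₀ : ℝ) (l : Vec n)
    (τ : ℝ) (z : Vec n) (w : ℝ → Vec n) (δ : ℝ) : ℝ :=
  (φ (τ + l₀ * δ) (z + δ • l) (D.seg (kappa τ z w) (τ + l₀ * δ)) - φ τ z w) / δ

/-- The lower right directional derivative, with values in the extended reals. -/
def lowerDir (φ : ℝ → Vec n → (ℝ → Vec n) → ℝ) (l₀ : ℝ) (l : Vec n)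
    (τ : ℝ) (z : Vec n) (w : ℝ → Vec n) : EReal :=
  liminf (fun δ : ℝ => ((D.quot φ l₀ l τ z w δ : ℝ) : EReal)) (𝓝[>] 0)

/-- The upper right directional derivative, with values in the extended reals. -/
def upperDir (φ : ℝ → Vec n → (ℝ → Vec n) → ℝ) (l₀ : ℝ) (l : Vec n)
    (τ : ℝ) (z : Vec n) (w : ℝ → Vec n) : EReal :=
  limsup (fun δ : ℝ => ((D.quot φ l₀ l τ z w δ : ℝ) : EReal)) (𝓝[>] 0)

/-- The set `F⁰(z, w(-h)) + ∂ᶜⁱ g(τ, w)` of directions. -/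
def dirs (τ : ℝ) (z : Vec n) (w : ℝ → Vec n) : Set (Vec n) :=
  (fun f => f + D.dg τ w) '' D.F 0 z (w (-D.h))

/-- The Dini-type inequalities on `𝔾_*`. -/
def IsDini (φ : ℝ → Vec n → (ℝ → Vec n) → ℝ) : Prop :=
  D.Phi1 φ ∧ D.Phi2 φ ∧ D.Terminal φ ∧
    ∀ τ z w, (τ, z, w) ∈ D.GStar → ∀ s : Vec n,
      (⨅ l ∈ D.dirs τ z w, (D.lowerDir φ 1 l τ z w +
        ((inner ℝ (D.dg τ w) s + D.H τ z (w (-D.h)) s - inner ℝ l s : ℝ) : EReal))) ≤ 0 ∧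
      0 ≤ ⨆ l ∈ D.dirs τ z w, (D.upperDir φ 1 l τ z w +
        ((inner ℝ (D.dg τ w) s + D.H τ z (w (-D.h)) s - inner ℝ l s : ℝ) : EReal))

/-! ### Sub- and superdifferentials -/

/-- The neighbourhood `O⁺_δ(τ, z)` of pairs `(t, x)` with `t ∈ [τ, τ + δ]` and `‖x - z‖ ≤ δ`,
restricted to the times `t ≤ ϑ` at which the functionals are defined. -/
def Oplus (δ τ : ℝ) (z : Vec n) : Set (ℝ × Vec n) :=
  {q | q.1 ∈ Icc τ (τ + δ) ∧ q.1 ≤ D.ϑ ∧ ‖q.2 - z‖ ≤ δ}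

/-- The quotient in the definition of sub- and superdifferentials. -/
def diffQuot (φ : ℝ → Vec n → (ℝ → Vec n) → ℝ) (p : ℝ × Vec n)
    (τ : ℝ) (z : Vec n) (w : ℝ → Vec n) (q : ℝ × Vec n) : ℝ :=
  (φ q.1 q.2 (D.seg (kappa τ z w) q.1) - φ τ z w - (q.1 - τ) * p.1 - inner ℝ (q.2 - z) p.2) /
    (|q.1 - τ| + ‖q.2 - z‖)

/-- The subdifferential `D⁻φ(τ, z, w)`. -/
def subdiff (φ : ℝ → Vec n → (ℝ → Vec n) → ℝ) (τ : ℝ) (z : Vec n) (w : ℝ → Vec n) :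
    Set (ℝ × Vec n) :=
  {p | ∃ L : EReal, Tendsto
    (fun δ : ℝ => ⨅ q ∈ D.Oplus δ τ z \ {(τ, z)}, ((D.diffQuot φ p τ z w q : ℝ) : EReal))
    (𝓝[>] 0) (𝓝 L) ∧ 0 ≤ L}

/-- The superdifferential `D⁺φ(τ, z, w)`. -/
def superdiff (φ : ℝ → Vec n → (ℝ → Vec n) → ℝ) (τ : ℝ) (z : Vec n) (w : ℝ → Vec n) :
    Set (ℝ × Vec n) :=
  {p | ∃ L : EReal, Tendsto
    (fun δ : ℝ => ⨆ q ∈ D.Oplus δ τ z \ {(τ, z)}, ((D.diffQuot φ p τ z w q : ℝ) : EReal))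
    (𝓝[>] 0) (𝓝 L) ∧ L ≤ 0}

/-- The Hamilton-Jacobi expression `p₀ + ⟨∂ᶜⁱ g(τ, w), p⟩ + H(τ, z, w(-h), p)`. -/
def hj (τ : ℝ) (z : Vec n) (w : ℝ → Vec n) (p₀ : ℝ) (p : Vec n) : ℝ :=
  p₀ + inner ℝ (D.dg τ w) p + D.H τ z (w (-D.h)) p

/-- The viscosity inequalities for sub- and superdifferentials on `𝔾_*`. -/
def IsDiffViscosity (φ : ℝ → Vec n → (ℝ → Vec n) → ℝ) : Prop :=
  D.Phi1 φ ∧ D.Phi2 φ ∧ D.Terminal φ ∧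
    ∀ τ z w, (τ, z, w) ∈ D.GStar →
      (∀ p₀ p, (p₀, p) ∈ D.subdiff φ τ z w → D.hj τ z w p₀ p ≤ 0) ∧
      (∀ q₀ q, (q₀, q) ∈ D.superdiff φ τ z w → 0 ≤ D.hj τ z w q₀ q)

/-! ### Viscosity solutions -/

/-- Viscosity solutions. -/
def IsViscosity (φ : ℝ → Vec n → (ℝ → Vec n) → ℝ) : Prop :=
  D.Phi1 φ ∧ D.Phi2 φ ∧ D.Terminal φ ∧
    (∀ τ z w, (τ, z, w) ∈ D.GStar → ∀ ψ : ℝ × Vec n → ℝ, ContDiff ℝ 1 ψ → ∀ δ > 0,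
      (∀ t x, (t, x) ∈ D.Oplus δ τ z →
        φ τ z w - ψ (τ, z) ≤ φ t x (D.seg (kappa τ z w) t) - ψ (t, x)) →
      D.hj τ z w (deriv (fun t => ψ (t, z)) τ) (gradient (fun x => ψ (τ, x)) z) ≤ 0) ∧
    (∀ τ z w, (τ, z, w) ∈ D.GStar → ∀ ψ : ℝ × Vec n → ℝ, ContDiff ℝ 1 ψ → ∀ δ > 0,
      (∀ t x, (t, x) ∈ D.Oplus δ τ z →
        φ t x (D.seg (kappa τ z w) t) - ψ (t, x) ≤ φ τ z w - ψ (τ, z)) →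
      0 ≤ D.hj τ z w (deriv (fun t => ψ (t, z)) τ) (gradient (fun x => ψ (τ, x)) z))

end Problem

end NeutralHJ

end

/-!
Replacing `φ`, `σ`, `H`, `s` by `-φ`, `-σ`, `-H`, `-s` exchanges the upper and the lower half of
every one of the five notions (`Problem.dual`, `isMinimax_iff_dual` and its companions), so only
implications between the upper halves are needed; each is then applied to `D` and to `D.dual`.
They close up through the condition on directional derivatives, which is reached from both the
minimax and the viscosity side.

*Trajectories.* The inclusion `ẏ ∈ F^η` is used in the integral form
`‖y t - y s‖ ≤ ∫ (c_H (1 + ‖x‖ + ‖x(· - h)‖) + η)` (`mem_X_iff`), which avoids almost everywhere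
differentiability. Given `y`, the trajectory `x = y + g(·, x(· - h))` is recovered by the method of
steps (`exists_mem_Lam_yOf_eq`), since `x(· - h)` is already known on an interval of length `h`.
With Arzelà-Ascoli this makes the sets of trajectories compact in the sense needed here, also along
convergent initial histories (`exists_limit_trajectory`): the `y` converge uniformly, and `x`
converges almost everywhere when the histories do.

*Minimax inequalities give directional derivatives* (`MinimaxUpper.diniUpper`): after division by
`δ = t - τ`, the increments `(x(τ + δ) - z) / δ` of the nearly optimal trajectories stay bounded and
accumulate at some `l ∈ F⁰ + ∂g`. By the Lipschitz condition on `φ`, the values along the trajectory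
and along `z + l δ` with the frozen history `κ` differ by `o(δ)`.

*Directional derivatives, subgradients, test functions.* A subgradient bounds the lower directional
derivatives from below (`DiniUpper.subdiffIneq`), and the gradient of a test function touching from
below is a subgradient (`mem_subdiff_of_touching`). Conversely (`TestBelowIneq.diniUpper`), suppose
the inequality for directional derivatives fails at `(τ, z, w)`. Then `φ` grows faster than an
affine function along the whole cone of directions `F⁰ + ∂g`. Let `ψ` be this affine function minus
a steep penalty for leaving the cone, smoothed (`exists_cone_test_function`). Then `φ - ψ` has near
the vertex a minimum `(t, x)` that lies neither at the final time nor on the lateral boundary. There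
the Hamilton-Jacobi expression of `ψ` is positive, because `H` is Lipschitz in `s` with exactly the
constant that determines the width of the cone. The minimum exists because `φ` is jointly continuous
along frozen histories (`continuousOn_state_along_history`), a consequence of `(φ₁)`, `(φ₂)` and
smooth approximation.

*Back to the minimax inequalities.* For a relaxation parameter `η > 0` a good direction at one point
can be followed by an actual trajectory for a short time with error at most `ε δ` (`exists_step`).
The set of times reachable with accumulated error `ε (t - τ)` is closed by compactness and can be
continued to the right, so it is the whole interval (`DiniUpper.c1MinimaxUpper`). Finally, general
histories are approximated by continuously differentiable ones, `η` tends to zero, and compactness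
yields an optimal trajectory on `[ih, (i+1)h]` (`C1MinimaxUpper.exists_trajectory`); gluing these
over successive intervals gives the inequality for all `t`.
-/

/-! ### Piecewise Lipschitz functions -/

namespace NeutralHJ

namespace PiecewiseLip

variable {n : ℕ} {x x' : ℝ → Vec n} {a b c d : ℝ}

theorem refl (x : ℝ → Vec n) (a : ℝ) : PiecewiseLip x a a :=
  ⟨0, fun _ => a, rfl, rfl, by simp, by simp⟩

theorem append (hx : PiecewiseLip x a b) (hbc : b < c) {K : ℝ≥0}
    (hK : LipschitzOnWith K x (Ico b c)) : PiecewiseLip x a c := by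
  obtain ⟨k, ξ, h0, hk, hlt, hL⟩ := hx
  refine ⟨k + 1, fun i => if i ≤ k then ξ i else c, by simp [h0], by simp, ?_, ?_⟩
  · intro i hi
    rcases (Nat.lt_succ_iff.1 hi).eq_or_lt with rfl | h
    · simpa [hk] using hbc
    · simpa [h.le, Nat.succ_le_of_lt h] using hlt i h
  · intro i hi
    rcases (Nat.lt_succ_iff.1 hi).eq_or_lt with rfl | h
    · exact ⟨K, by simpa [hk] using hK⟩
    · simpa [h.le, Nat.succ_le_of_lt h] using hL i h

/-- Induction along the partition of a piecewise Lipschitz function: a property of the right end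
point that survives the addition of one Lipschitz piece holds at `b`. -/
theorem induction_on (hx : PiecewiseLip x a b) {Q : ℝ → Prop} (h0 : Q a)
    (hs : ∀ c d, a ≤ c → c < d → d ≤ b → Q c → (∃ K, LipschitzOnWith K x (Ico c d)) → Q d) :
    Q b := by
  obtain ⟨k, ξ, rfl, rfl, hlt, hL⟩ := hx
  have hmono : ∀ j i, i + j ≤ k → ξ i ≤ ξ (i + j) := by
    intro j
    induction j with
    | zero => intro i _; exact le_rfl
    | succ j ih => intro i hi; exact (ih i (by omega)).trans (hlt (i + j) (by omega)).le
  have : ∀ i ≤ k, Q (ξ i) := by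
    intro i
    induction i with
    | zero => intro _; exact h0
    | succ i ih =>
      intro hi
      refine hs (ξ i) (ξ (i + 1)) ?_ (hlt i hi) ?_ (ih (by omega)) (hL i hi)
      · simpa using hmono i 0 (by omega)
      · have := hmono (k - (i + 1)) (i + 1) (by omega)
        rwa [Nat.add_sub_cancel' hi] at this
  exact this k le_rfl

theorem le (hx : PiecewiseLip x a b) : a ≤ b :=
  hx.induction_on (Q := fun t => a ≤ t) le_rfl fun _ _ _ h _ h' _ => h'.trans h.le

end PiecewiseLip

variable {n : ℕ} {x x' : ℝ → Vec n} {a b c d : ℝ}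

/-- Piecewise Lipschitz continuity is a local property: by compactness it suffices that the
function is Lipschitz on some `[t, c)` for every `t ∈ [a, b)` and on some `[c, t)` for every
`t ∈ (a, b]`. -/
theorem piecewiseLip_iff : PiecewiseLip x a b ↔ a ≤ b ∧
    (∀ t ∈ Ico a b, ∃ c > t, ∃ K, LipschitzOnWith K x (Ico t c)) ∧
    ∀ t ∈ Ioc a b, ∃ c < t, ∃ K, LipschitzOnWith K x (Ico c t) := by
  constructor
  · intro hx
    refine ⟨hx.le, ?_⟩
    refine hx.induction_on (Q := fun b => (∀ t ∈ Ico a b, ∃ c > t, ∃ K,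
      LipschitzOnWith K x (Ico t c)) ∧ ∀ t ∈ Ioc a b, ∃ c < t, ∃ K, LipschitzOnWith K x (Ico c t))
      (by simp) ?_
    rintro c d hac hcd - ⟨h1, h2⟩ ⟨K, hK⟩
    refine ⟨fun t ht => ?_, fun t ht => ?_⟩
    · by_cases h : t < c
      · exact h1 t ⟨ht.1, h⟩
      · exact ⟨d, ht.2, K, hK.mono (Ico_subset_Ico_left (not_lt.1 h))⟩
    · by_cases h : t ≤ c
      · exact h2 t ⟨ht.1, h⟩
      · exact ⟨c, not_le.1 h, K, hK.mono (Ico_subset_Ico_right ht.2)⟩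
  · rintro ⟨hab, hr, hl⟩
    let S : Set ℝ := {t | t ∈ Icc a b ∧ PiecewiseLip x a t}
    have haS : a ∈ S := ⟨⟨le_rfl, hab⟩, .refl x a⟩
    have hbdd : BddAbove S := ⟨b, fun t ht => ht.1.2⟩
    have hac : a ≤ sSup S := le_csSup hbdd haS
    have hcb : sSup S ≤ b := csSup_le ⟨a, haS⟩ fun t ht => ht.1.2
    have hcS : PiecewiseLip x a (sSup S) := by
      rcases hac.eq_or_lt with h | h
      · rw [← h]; exact .refl x a
      obtain ⟨c, hc, K, hK⟩ := hl (sSup S) ⟨h, hcb⟩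
      obtain ⟨s, hs, hcs⟩ := exists_lt_of_lt_csSup ⟨a, haS⟩ hc
      rcases (le_csSup hbdd hs).eq_or_lt with h' | h'
      · rw [← h']; exact hs.2
      · exact hs.2.append h' (hK.mono (Ico_subset_Ico_left hcs.le))
    rcases hcb.eq_or_lt with h | h
    · rwa [h] at hcS
    obtain ⟨c, hc, K, hK⟩ := hr (sSup S) ⟨hac, h⟩
    have h1 : sSup S < min b c := lt_min h hc
    have : min b c ∈ S := ⟨⟨hac.trans h1.le, min_le_left _ _⟩,
      hcS.append h1 (hK.mono (Ico_subset_Ico_right (min_le_right _ _)))⟩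
    exact absurd (le_csSup hbdd this) (not_le.2 h1)

namespace PiecewiseLip

theorem mono (hx : PiecewiseLip x a b) (hac : a ≤ c) (hcd : c ≤ d) (hdb : d ≤ b) :
    PiecewiseLip x c d := by
  rw [piecewiseLip_iff] at hx ⊢
  exact ⟨hcd, fun t ht => hx.2.1 t ⟨hac.trans ht.1, ht.2.trans_le hdb⟩,
    fun t ht => hx.2.2 t ⟨hac.trans_lt ht.1, ht.2.trans hdb⟩⟩

theorem trans (h1 : PiecewiseLip x a b) (h2 : PiecewiseLip x b c) : PiecewiseLip x a c :=
  h2.induction_on (Q := fun t => PiecewiseLip x a t) h1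
    fun _ _ _ h _ h' ⟨_, hK⟩ => h'.append h hK

theorem congr (hx : PiecewiseLip x a b) (h : EqOn x' x (Ico a b)) : PiecewiseLip x' a b := by
  have := hx.induction_on (Q := fun t => t ≤ b → PiecewiseLip x' a t) (fun _ => .refl _ _) ?_
  · exact this le_rfl
  · rintro c d hac hcd hdb hc ⟨K, hK⟩ -
    refine (hc (hcd.le.trans hdb)).append hcd (K := K) fun s hs t ht => ?_
    rw [h ⟨hac.trans hs.1, hs.2.trans_le hdb⟩, h ⟨hac.trans ht.1, ht.2.trans_le hdb⟩]
    exact hK hs ht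

theorem comp_add_const (hx : PiecewiseLip x a b) (r : ℝ) :
    PiecewiseLip (fun t => x (t + r)) (a - r) (b - r) := by
  have := hx.induction_on (Q := fun t => PiecewiseLip (fun t => x (t + r)) (a - r) (t - r))
    (.refl _ _) ?_
  · exact this
  · rintro c d hac hcd hdb hc ⟨K, hK⟩
    refine hc.append (by linarith) (K := K) fun s hs t ht => ?_
    have := hK (x := s + r) ⟨by linarith [hs.1], by linarith [hs.2]⟩ (y := t + r)
      ⟨by linarith [ht.1], by linarith [ht.2]⟩
    simpa [edist_dist, Real.dist_eq] using this

theorem add (hx : PiecewiseLip x a b) (hx' : PiecewiseLip x' a b) :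
    PiecewiseLip (fun t => x t + x' t) a b := by
  rw [piecewiseLip_iff] at hx hx' ⊢
  refine ⟨hx.1, fun t ht => ?_, fun t ht => ?_⟩
  · obtain ⟨c, hc, K, hK⟩ := hx.2.1 t ht
    obtain ⟨c', hc', K', hK'⟩ := hx'.2.1 t ht
    exact ⟨min c c', lt_min hc hc', K + K', (hK.mono (Ico_subset_Ico_right (min_le_left _ _))).add
      (hK'.mono (Ico_subset_Ico_right (min_le_right _ _)))⟩
  · obtain ⟨c, hc, K, hK⟩ := hx.2.2 t ht
    obtain ⟨c', hc', K', hK'⟩ := hx'.2.2 t ht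
    exact ⟨max c c', max_lt hc hc', K + K', (hK.mono (Ico_subset_Ico_left (le_max_left _ _))).add
      (hK'.mono (Ico_subset_Ico_left (le_max_right _ _)))⟩

theorem of_lipschitzOnWith {K : ℝ≥0} (hab : a ≤ b) (hK : LipschitzOnWith K x (Ico a b)) :
    PiecewiseLip x a b := by
  rcases hab.eq_or_lt with rfl | h
  · exact .refl _ _
  · exact (refl x a).append h hK

theorem neg (hx : PiecewiseLip x a b) : PiecewiseLip (fun t => -x t) a b := by
  refine hx.induction_on (Q := fun t => PiecewiseLip (fun t => -x t) a t) (.refl _ _) ?_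
  rintro c d hac hcd hdb hc ⟨K, hK⟩
  exact hc.append hcd (K := K) fun s hs t ht => by simpa using hK hs ht

theorem sub (hx : PiecewiseLip x a b) (hx' : PiecewiseLip x' a b) :
    PiecewiseLip (fun t => x t - x' t) a b := by
  simpa [sub_eq_add_neg] using hx.add hx'.neg

/-- A piecewise Lipschitz function is bounded. -/
theorem exists_bound (hx : PiecewiseLip x a b) : ∃ C, 0 ≤ C ∧ ∀ t ∈ Ico a b, ‖x t‖ ≤ C := by
  refine hx.induction_on (Q := fun b => ∃ C, 0 ≤ C ∧ ∀ t ∈ Ico a b, ‖x t‖ ≤ C)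
    ⟨0, le_rfl, by simp⟩ ?_
  rintro c d hac hcd - ⟨C, hC, h⟩ ⟨K, hK⟩
  refine ⟨max C (‖x c‖ + K * (d - c)), le_max_of_le_left hC, fun t ht => ?_⟩
  by_cases htc : t < c
  · exact (h t ⟨ht.1, htc⟩).trans (le_max_left _ _)
  · push Not at htc
    refine le_trans ?_ (le_max_right _ _)
    have h1 := hK.norm_sub_le ⟨htc, ht.2⟩ (⟨le_rfl, hcd⟩ : c ∈ Ico c d)
    have h2 : ‖t - c‖ ≤ d - c := by
      rw [Real.norm_eq_abs, abs_of_nonneg (by linarith)]; linarith [ht.2]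
    have h3 : ‖x t‖ ≤ ‖x c‖ + ‖x t - x c‖ := by
      simpa using norm_add_le (x c) (x t - x c)
    have h4 : (K : ℝ) * ‖t - c‖ ≤ K * (d - c) := by gcongr
    linarith

theorem aestronglyMeasurable (hx : PiecewiseLip x a b) :
    AEStronglyMeasurable x (volume.restrict (Icc a b)) := by
  have : AEStronglyMeasurable x (volume.restrict (Ico a b)) := by
    refine hx.induction_on (Q := fun b => AEStronglyMeasurable x (volume.restrict (Ico a b)))
      (by simp) ?_
    rintro c d hac hcd - hc ⟨K, hK⟩
    rw [← Ico_union_Ico_eq_Ico hac hcd.le, aestronglyMeasurable_union_iff]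
    exact ⟨hc, hK.continuousOn.aestronglyMeasurable measurableSet_Ico⟩
  rwa [Measure.restrict_congr_set Ico_ae_eq_Icc] at this

theorem continuousWithinAt_Ici (hx : PiecewiseLip x a b) {t : ℝ} (ht : t ∈ Ico a b) :
    ContinuousWithinAt x (Ici t) t := by
  obtain ⟨c, hc, K, hK⟩ := (piecewiseLip_iff.1 hx).2.1 t ht
  exact (hK.continuousOn t ⟨le_rfl, hc⟩).mono_of_mem_nhdsWithin (Ico_mem_nhdsGE hc)

end PiecewiseLip

/-! ### Increments and derivatives of Lipschitz functions -/

/-- The increment of a Lipschitz function is bounded by the integral of any almost everywhere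
bound for its derivative. -/
theorem norm_sub_le_integral_of_ae_hasDerivAt {y : ℝ → Vec n} {ρ : ℝ → ℝ} {K : ℝ≥0} (hab : a ≤ b)
    (hy : LipschitzOnWith K y (Icc a b)) (hρ : IntervalIntegrable ρ volume a b)
    (hd : ∀ᵐ t, t ∈ Icc a b → ∃ l, ‖l‖ ≤ ρ t ∧ HasDerivAt y l t) :
    ‖y b - y a‖ ≤ ∫ t in a..b, ρ t := by
  set v := y b - y a with hv
  -- pairing with the increment itself reduces the claim to a real-valued function
  let f : ℝ → ℝ := fun t => inner ℝ v (y t)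
  have hf : AbsolutelyContinuousOnInterval f a b := by
    have : LipschitzOnWith (‖innerSL ℝ v‖₊ * K) f (uIcc a b) := by
      rw [uIcc_of_le hab]
      exact (innerSL ℝ v).lipschitz.comp_lipschitzOnWith hy
    exact this.absolutelyContinuousOnInterval
  have h1 := hf.integral_deriv_eq_sub
  have h2 : f b - f a = ‖v‖ * ‖v‖ := by
    simp only [f]
    rw [← inner_sub_right, ← hv, real_inner_self_eq_norm_mul_norm]
  have h3 : ∫ t in a..b, deriv f t ≤ ∫ t in a..b, ‖v‖ * ρ t := by
    refine intervalIntegral.integral_mono_ae_restrict hab hf.intervalIntegrable_deriv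
      (hρ.const_mul _) ?_
    rw [EventuallyLE, ae_restrict_iff' measurableSet_Icc]
    filter_upwards [hd] with t ht hmem
    obtain ⟨l, hl, hyl⟩ := ht hmem
    have : HasDerivAt f (inner ℝ v l) t :=
      (innerSL ℝ v).hasFDerivAt.comp_hasDerivAt t hyl
    rw [this.deriv]
    exact (real_inner_le_norm _ _).trans (mul_le_mul_of_nonneg_left hl (norm_nonneg _))
  rw [intervalIntegral.integral_const_mul, h1, h2] at h3
  rcases (norm_nonneg v).eq_or_lt with h | h
  · rw [← h]
    refine intervalIntegral.integral_nonneg_of_ae_restrict hab ?_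
    rw [EventuallyLE, ae_restrict_iff' measurableSet_Icc]
    filter_upwards [hd] with t ht hmem
    obtain ⟨l, hl, -⟩ := ht hmem
    exact (norm_nonneg l).trans hl
  · exact le_of_mul_le_mul_left h3 h

/-- Conversely, if all increments of a Lipschitz function are bounded by the integrals of `ρ`, then
its derivative exists almost everywhere and is bounded by `ρ`. -/
theorem ae_hasDerivAt_of_norm_sub_le_integral {y : ℝ → Vec n} {ρ : ℝ → ℝ} {K : ℝ≥0} (hab : a ≤ b)
    (hy : LipschitzOnWith K y (Icc a b)) (hρ : IntervalIntegrable ρ volume a b)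
    (hi : ∀ c d, a ≤ c → c ≤ d → d ≤ b → ‖y d - y c‖ ≤ ∫ t in c..d, ρ t) :
    ∀ᵐ t, t ∈ Icc a b → ∃ l, ‖l‖ ≤ ρ t ∧ HasDerivAt y l t := by
  have h1 : ∀ᵐ t : ℝ, t ≠ a := by simp [ae_iff, measure_singleton]
  have h2 : ∀ᵐ t : ℝ, t ≠ b := by simp [ae_iff, measure_singleton]
  filter_upwards [h1, h2, hy.ae_differentiableWithinAt_of_mem_real,
    hρ.ae_hasDerivAt_integral] with t hta htb hd hint ht
  have hat : a < t := lt_of_le_of_ne ht.1 (Ne.symm hta)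
  have htb : t < b := lt_of_le_of_ne ht.2 htb
  have hyd := ((hd ht).differentiableAt (Icc_mem_nhds hat htb)).hasDerivAt
  refine ⟨_, ?_, hyd⟩
  have hr := hint (by rw [uIcc_of_le hab]; exact ht) a (by simp)
  have e1 := (hasDerivAt_iff_tendsto_slope.1 hyd).mono_left
    (nhdsGT_le_nhdsNE t)
  have e2 := (hasDerivAt_iff_tendsto_slope.1 hr).mono_left
    (nhdsGT_le_nhdsNE t)
  refine le_of_tendsto_of_tendsto e1.norm e2 ?_
  filter_upwards [Ioo_mem_nhdsGT htb] with s hs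
  have hst : 0 < s - t := by linarith [hs.1]
  have h3 := hi t s ht.1 hs.1.le hs.2.le
  have hI : ∀ u ∈ Icc a b, IntervalIntegrable ρ volume a u := fun u hu => hρ.mono_set (by
    rw [uIcc_of_le hab, uIcc_of_le hu.1]; exact Icc_subset_Icc_right hu.2)
  rw [← intervalIntegral.integral_interval_sub_left (hI s ⟨ht.1.trans hs.1.le, hs.2.le⟩)
    (hI t ht)] at h3
  simp only [slope, vsub_eq_sub, smul_eq_mul, norm_smul, norm_inv, Real.norm_eq_abs,
    abs_of_pos hst]
  gcongr

end NeutralHJ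

/-! ### Regularity of the data along piecewise Lipschitz functions -/

namespace NeutralHJ

variable {n : ℕ}

theorem PiecewiseLip.exists_bound_Icc {x : ℝ → Vec n} {a b : ℝ} (hx : PiecewiseLip x a b) :
    ∃ C, 0 ≤ C ∧ ∀ t ∈ Icc a b, ‖x t‖ ≤ C := by
  obtain ⟨C, hC, h⟩ := hx.exists_bound
  refine ⟨max C ‖x b‖, le_max_of_le_left hC, fun t ht => ?_⟩
  rcases ht.2.eq_or_lt with rfl | h'
  · exact le_max_right _ _
  · exact (h t ⟨ht.1, h'⟩).trans (le_max_left _ _)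

theorem intervalIntegrable_of_bound {E : Type*} [NormedAddCommGroup E] {f : ℝ → E} {a b C : ℝ}
    (hab : a ≤ b) (hf : AEStronglyMeasurable f (volume.restrict (Icc a b)))
    (hC : ∀ t ∈ Icc a b, ‖f t‖ ≤ C) : IntervalIntegrable f volume a b := by
  rw [intervalIntegrable_iff_integrableOn_Icc_of_le hab]
  refine Integrable.of_bound hf C ?_
  rw [ae_restrict_iff' measurableSet_Icc]
  exact Eventually.of_forall hC

namespace Problem

variable {D : Problem n}

namespace Admissible

variable (hD : D.Admissible)
include hD

theorem ϑ_pos : 0 < D.ϑ := mul_pos (by exact_mod_cast hD.I_pos) hD.h_pos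

theorem succ_mul_le {i : ℕ} (hi : i < D.I) : ((i : ℝ) + 1) * D.h ≤ D.ϑ :=
  mul_le_mul_of_nonneg_right (by exact_mod_cast hi) hD.h_pos.le

theorem exists_index {τ : ℝ} (h0 : 0 ≤ τ) (hτ : τ < D.ϑ) :
    ∃ i : ℕ, i < D.I ∧ τ ∈ Ico (i * D.h) ((i + 1) * D.h) := by
  have hh := hD.h_pos
  have h1 : 0 ≤ τ / D.h := by positivity
  refine ⟨⌊τ / D.h⌋₊, ?_, ?_, ?_⟩
  · rw [Nat.floor_lt h1, div_lt_iff₀ hh]; exact hτ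
  · rw [← le_div_iff₀ hh]; exact Nat.floor_le h1
  · rw [← div_lt_iff₀ hh]; exact Nat.lt_floor_add_one _

theorem exists_lipschitzOnWith_g (R : ℝ) : ∃ K, LipschitzOnWith K
    (fun q : ℝ × Vec n => D.g q.1 q.2) (Icc 0 D.ϑ ×ˢ Metric.closedBall 0 R) := by
  refine LocallyLipschitzOn.exists_lipschitzOnWith_of_compact
    (isCompact_Icc.prod (isCompact_closedBall _ _)) ?_
  exact ((hD.g_contDiff).mono (prod_mono_right (subset_univ _))).locallyLipschitzOn
    ((convex_Icc _ _).prod (convex_closedBall _ _))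

theorem piecewiseLip_g {u : ℝ → Vec n} {a b : ℝ} (hu : PiecewiseLip u a b) (ha : 0 ≤ a)
    (hb : b ≤ D.ϑ) : PiecewiseLip (fun t => D.g t (u t)) a b := by
  obtain ⟨R, -, hR⟩ := hu.exists_bound
  obtain ⟨Kg, hKg⟩ := hD.exists_lipschitzOnWith_g R
  have := hu.induction_on
    (Q := fun c => c ≤ b → PiecewiseLip (fun t => D.g t (u t)) a c) (fun _ => .refl _ _) ?_
  · exact this le_rfl
  · rintro c d hac hcd hdb hc ⟨K, hK⟩ -
    refine (hc (hcd.le.trans hdb)).append hcd (K := Kg * max 1 K) ?_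
    have h1 : LipschitzOnWith (max 1 K) (fun t => (t, u t)) (Ico c d) :=
      (LipschitzWith.id.lipschitzOnWith).prodMk hK
    have h2 : MapsTo (fun t => (t, u t)) (Ico c d)
        (Icc 0 D.ϑ ×ˢ Metric.closedBall (0 : Vec n) R) := fun t ht =>
      ⟨⟨by linarith [ht.1], by linarith [ht.2]⟩, by
        simpa using hR t ⟨hac.trans ht.1, ht.2.trans_le hdb⟩⟩
    have h3 := LipschitzOnWith.comp hKg h1 h2
    exact h3

/-- Boundedness of the Hamiltonian on bounded sets. -/
theorem exists_bound_H (R : ℝ) : ∃ C, ∀ ξ ∈ Icc 0 D.ϑ, ∀ z r s : Vec n, ‖z‖ ≤ R → ‖r‖ ≤ R →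
    ‖s‖ ≤ R → ‖D.H ξ z r s‖ ≤ C := by
  have hK : IsCompact (Icc 0 D.ϑ ×ˢ (Metric.closedBall (0 : Vec n) R ×ˢ
      (Metric.closedBall (0 : Vec n) R ×ˢ Metric.closedBall (0 : Vec n) R))) :=
    isCompact_Icc.prod ((isCompact_closedBall _ _).prod
      ((isCompact_closedBall _ _).prod (isCompact_closedBall _ _)))
  obtain ⟨C, hC⟩ := hK.exists_bound_of_continuousOn
    (hD.H_cont.mono (prod_mono_right (subset_univ _)))
  refine ⟨C, fun ξ hξ z r s hz hr hs => hC (ξ, z, r, s) ?_⟩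
  exact ⟨hξ, by simpa using hz, by simpa using hr, by simpa using hs⟩

omit hD in
/-- The Hamiltonian with time projected to `[0, ϑ]`, as a function on the whole space. -/
theorem eqOn_H_projIcc (h0 : 0 ≤ D.ϑ) {ξ : ℝ} (hξ : ξ ∈ Icc 0 D.ϑ) :
    D.H (projIcc 0 D.ϑ h0 ξ) = D.H ξ := by
  rw [projIcc_of_mem h0 hξ]

theorem continuous_H_projIcc : Continuous fun q : ℝ × Vec n × Vec n × Vec n =>
    D.H (projIcc 0 D.ϑ hD.ϑ_pos.le q.1) q.2.1 q.2.2.1 q.2.2.2 := by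
  have h1 : Continuous fun q : ℝ × Vec n × Vec n × Vec n =>
      (((projIcc 0 D.ϑ hD.ϑ_pos.le q.1 : Icc 0 D.ϑ) : ℝ), q.2) :=
    (continuous_subtype_val.comp (continuous_projIcc.comp continuous_fst)).prodMk continuous_snd
  exact hD.H_cont.comp_continuous h1 fun q => ⟨(projIcc 0 D.ϑ hD.ϑ_pos.le q.1).2, mem_univ _⟩

theorem tendsto_H {ι : Type*} {l : Filter ι} {t : ι → ℝ} {z r s : ι → Vec n} {t₀ : ℝ}
    {z₀ r₀ s₀ : Vec n} (ht : Tendsto t l (𝓝 t₀)) (hz : Tendsto z l (𝓝 z₀))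
    (hr : Tendsto r l (𝓝 r₀)) (hs : Tendsto s l (𝓝 s₀)) (ht' : ∀ᶠ i in l, t i ∈ Icc 0 D.ϑ)
    (ht₀ : t₀ ∈ Icc 0 D.ϑ) :
    Tendsto (fun i => D.H (t i) (z i) (r i) (s i)) l (𝓝 (D.H t₀ z₀ r₀ s₀)) := by
  have h1 := (hD.continuous_H_projIcc.tendsto (t₀, z₀, r₀, s₀)).comp
    (ht.prodMk_nhds (hz.prodMk_nhds (hr.prodMk_nhds hs)))
  simp only [eqOn_H_projIcc hD.ϑ_pos.le ht₀] at h1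
  refine h1.congr' ?_
  filter_upwards [ht'] with i hi
  simp only [Function.comp, eqOn_H_projIcc hD.ϑ_pos.le hi]

theorem tendsto_g {ι : Type*} {l : Filter ι} {t : ι → ℝ} {z : ι → Vec n} {t₀ : ℝ}
    {z₀ : Vec n} (ht : Tendsto t l (𝓝 t₀)) (hz : Tendsto z l (𝓝 z₀))
    (ht' : ∀ᶠ i in l, t i ∈ Icc 0 D.ϑ) (ht₀ : t₀ ∈ Icc 0 D.ϑ) :
    Tendsto (fun i => D.g (t i) (z i)) l (𝓝 (D.g t₀ z₀)) := by
  refine (hD.g_contDiff.continuousOn (t₀, z₀) ⟨ht₀, mem_univ _⟩).tendsto.comp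
    (tendsto_nhdsWithin_iff.2 ⟨ht.prodMk_nhds hz, ?_⟩)
  filter_upwards [ht'] with i hi using ⟨hi, mem_univ _⟩

theorem aestronglyMeasurable_H {u v : ℝ → Vec n} {a b : ℝ}
    (hu : AEStronglyMeasurable u (volume.restrict (Icc a b)))
    (hv : AEStronglyMeasurable v (volume.restrict (Icc a b))) (ha : 0 ≤ a) (hb : b ≤ D.ϑ)
    (s : Vec n) :
    AEStronglyMeasurable (fun ξ => D.H ξ (u ξ) (v ξ) s) (volume.restrict (Icc a b)) := by
  have h1 : AEStronglyMeasurable (fun ξ : ℝ => (ξ, u ξ, v ξ, s)) (volume.restrict (Icc a b)) :=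
    aestronglyMeasurable_id.prodMk (hu.prodMk (hv.prodMk aestronglyMeasurable_const))
  refine (hD.continuous_H_projIcc.comp_aestronglyMeasurable h1).congr ?_
  rw [EventuallyEq, ae_restrict_iff' measurableSet_Icc]
  refine Eventually.of_forall fun ξ hξ => ?_
  simp only [eqOn_H_projIcc hD.ϑ_pos.le (show ξ ∈ Icc 0 D.ϑ from ⟨ha.trans hξ.1, hξ.2.trans hb⟩)]

end Admissible

/-! ### The differential inclusion in integral form -/

/-- The radius `c_H (1 + ‖x(ξ)‖ + ‖x(ξ - h)‖) + η` of the ball `F^η` along a function `x`. -/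
noncomputable def radius (D : Problem n) (η : ℝ) (x : ℝ → Vec n) (ξ : ℝ) : ℝ :=
  D.cH * (1 + ‖x ξ‖ + ‖x (ξ - D.h)‖) + η

section Segments

variable {x : ℝ → Vec n} {τ T a b : ℝ}

theorem aestronglyMeasurable_of_piecewiseLip (hx : PiecewiseLip x (τ - D.h) T) (hh : 0 ≤ D.h)
    (ha : τ ≤ a) (hb : b ≤ T) : AEStronglyMeasurable x (volume.restrict (Icc a b)) :=
  hx.aestronglyMeasurable.mono_measure
    (Measure.restrict_mono (Icc_subset_Icc (by linarith) hb) le_rfl)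

theorem aestronglyMeasurable_delay (hx : PiecewiseLip x (τ - D.h) T) (hh : 0 ≤ D.h)
    (ha : τ ≤ a) (hb : b ≤ T) :
    AEStronglyMeasurable (fun ξ => x (ξ - D.h)) (volume.restrict (Icc a b)) := by
  have := (hx.comp_add_const (-D.h)).aestronglyMeasurable
  simp only [sub_neg_eq_add, sub_add_cancel, ← sub_eq_add_neg] at this
  exact this.mono_measure (Measure.restrict_mono (Icc_subset_Icc ha (by linarith)) le_rfl)

theorem intervalIntegrable_radius (hx : PiecewiseLip x (τ - D.h) T) (hh : 0 ≤ D.h) (η : ℝ)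
    (ha : τ ≤ a) (hab : a ≤ b) (hb : b ≤ T) :
    IntervalIntegrable (D.radius η x) volume a b := by
  obtain ⟨C, hC, hxC⟩ := hx.exists_bound_Icc
  refine intervalIntegrable_of_bound (C := |D.cH| * (1 + C + C) + |η|) hab ?_ ?_
  · exact ((((aestronglyMeasurable_of_piecewiseLip hx hh ha hb).norm.const_add 1).add
      (aestronglyMeasurable_delay hx hh ha hb).norm).const_mul D.cH).add_const η
  · intro t ht
    have h1 := hxC t ⟨by linarith [ht.1], by linarith [ht.2]⟩
    have h2 := hxC (t - D.h) ⟨by linarith [ht.1], by linarith [ht.2]⟩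
    rw [radius, Real.norm_eq_abs]
    refine (abs_add_le _ _).trans ?_
    rw [abs_mul, abs_of_nonneg (a := 1 + ‖x t‖ + ‖x (t - D.h)‖) (by positivity)]
    gcongr

theorem Admissible.intervalIntegrable_H (hD : D.Admissible) (hx : PiecewiseLip x (τ - D.h) T)
    (hτ : 0 ≤ τ) (hT : T ≤ D.ϑ) (s : Vec n) (ha : τ ≤ a) (hab : a ≤ b) (hb : b ≤ T) :
    IntervalIntegrable (fun ξ => D.H ξ (x ξ) (x (ξ - D.h)) s) volume a b := by
  obtain ⟨C, hC, hxC⟩ := hx.exists_bound_Icc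
  obtain ⟨C', hC'⟩ := hD.exists_bound_H (max C ‖s‖)
  have hh := hD.h_pos.le
  refine intervalIntegrable_of_bound (C := C') hab ?_ ?_
  · exact hD.aestronglyMeasurable_H (aestronglyMeasurable_of_piecewiseLip hx hh ha hb)
      (aestronglyMeasurable_delay hx hh ha hb) (hτ.trans ha) (hb.trans hT) s
  · intro t ht
    exact hC' t ⟨by linarith [ht.1], by linarith [ht.2]⟩ _ _ _
      ((hxC t ⟨by linarith [ht.1], by linarith [ht.2]⟩).trans (le_max_left _ _))
      ((hxC (t - D.h) ⟨by linarith [ht.1], by linarith [ht.2]⟩).trans (le_max_left _ _))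
      (le_max_right _ _)

end Segments

/-- Integral form of the differential inclusion: the increments of `y` are bounded by the integrals
of the radius of `F^η`. This form is stable under limits and under concatenation. -/
theorem mem_X_iff (hD : D.Admissible) {η τ : ℝ} {z : Vec n} {w x : ℝ → Vec n}
    (hτ : τ ≤ D.ϑ) : x ∈ D.X η τ z w ↔ x ∈ D.Lam τ z w ∧
      ∀ c d, τ ≤ c → c ≤ d → d ≤ D.ϑ →
        ‖D.yOf x d - D.yOf x c‖ ≤ ∫ ξ in c..d, D.radius η x ξ := by
  have hh := hD.h_pos.le
  constructor
  · rintro ⟨hL, ⟨K, hK⟩, hd⟩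
    refine ⟨hL, fun c d hc hcd hdϑ => ?_⟩
    refine norm_sub_le_integral_of_ae_hasDerivAt hcd (hK.mono (Icc_subset_Icc hc hdϑ))
      (intervalIntegrable_radius hL.1 hh η hc hcd hdϑ) ?_
    rw [ae_restrict_iff' measurableSet_Icc] at hd
    filter_upwards [hd] with t ht hmem
    exact ht ⟨hc.trans hmem.1, hmem.2.trans hdϑ⟩
  · rintro ⟨hL, hi⟩
    have hK : ∃ K : ℝ≥0, LipschitzOnWith K (D.yOf x) (Icc τ D.ϑ) := by
      obtain ⟨C, hC, hxC⟩ := hL.1.exists_bound_Icc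
      refine ⟨|D.cH * (1 + C + C) + η|.toNNReal, ?_⟩
      have key : ∀ c d, τ ≤ c → c ≤ d → d ≤ D.ϑ →
          ‖D.yOf x d - D.yOf x c‖ ≤ |D.cH * (1 + C + C) + η| * (d - c) := by
        intro c d hc hcd hd
        refine (hi c d hc hcd hd).trans ?_
        have := intervalIntegral.integral_mono_on hcd
          (intervalIntegrable_radius hL.1 hh η hc hcd hd)
          (intervalIntegrable_const (c := |D.cH * (1 + C + C) + η|)) (fun t ht => ?_)
        · simpa [mul_comm] using this
        · have h1 := hxC t ⟨by linarith [ht.1], by linarith [ht.2]⟩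
          have h2 := hxC (t - D.h) ⟨by linarith [ht.1], by linarith [ht.2]⟩
          refine le_trans ?_ (le_abs_self _)
          have := hD.cH_pos
          rw [radius]
          gcongr
      refine LipschitzOnWith.of_dist_le_mul fun c hc d hd => ?_
      rw [dist_eq_norm, Real.dist_eq, Real.coe_toNNReal _ (abs_nonneg _)]
      rcases le_total c d with h | h
      · rw [norm_sub_rev, abs_sub_comm, abs_of_nonneg (sub_nonneg.2 h)]
        exact key c d hc.1 h hd.2
      · rw [abs_of_nonneg (sub_nonneg.2 h)]
        exact key d c hd.1 h hc.2
    obtain ⟨K, hK⟩ := hK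
    refine ⟨hL, ⟨K, hK⟩, ?_⟩
    rw [ae_restrict_iff' measurableSet_Icc]
    exact ae_hasDerivAt_of_norm_sub_le_integral hτ hK
      (intervalIntegrable_radius hL.1 hh η le_rfl hτ le_rfl) hi

/-! ### The method of steps -/

/-- On a segment of delayed arguments the neutral equation `x(t) = y(t) + g(t, x(t - h))` can be
solved step by step, for every Lipschitz continuous `y` with the matching initial value. -/
theorem exists_mem_Lam_yOf_eq (hD : D.Admissible) {τ : ℝ} {z : Vec n} {w y : ℝ → Vec n}
    {K : ℝ≥0} (hτ : τ ∈ Icc 0 D.ϑ) (hw : w ∈ D.PLip) (hK : LipschitzOnWith K y (Icc τ D.ϑ))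
    (hy : y τ = z - D.g τ (w (-D.h))) :
    ∃ x ∈ D.Lam τ z w, ∀ t ∈ Icc τ D.ϑ, D.yOf x t = y t := by
  have hh := hD.h_pos
  let step : (ℝ → Vec n) → ℝ → Vec n := fun x t =>
    if t < τ then w (t - τ) else y t + D.g t (x (t - D.h))
  let X : ℕ → ℝ → Vec n := fun k => step^[k] (kappa τ z w)
  have hX : ∀ k, X (k + 1) = step (X k) := fun k => Function.iterate_succ_apply' _ _ _
  have hw' : PiecewiseLip (fun t => w (t - τ)) (τ - D.h) τ := by
    have := hw.1.comp_add_const (-τ)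
    simp only [sub_neg_eq_add, zero_add, ← sub_eq_add_neg] at this
    rwa [show -D.h + τ = τ - D.h by ring] at this
  have hPL : ∀ k, PiecewiseLip (X k) (τ - D.h) D.ϑ := by
    intro k
    induction k with
    | zero => exact (D.kappa_mem_Lam0 hτ.2 hw).1.1
    | succ k ih =>
      rw [hX]
      refine (hw'.congr fun t ht => by simp [step, ht.2]).trans ?_
      have h1 := ih.comp_add_const (-D.h)
      simp only [sub_neg_eq_add, sub_add_cancel, ← sub_eq_add_neg] at h1
      have h2 := hD.piecewiseLip_g (h1.mono le_rfl hτ.2 (by linarith)) hτ.1 le_rfl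
      have h3 : PiecewiseLip y τ D.ϑ := .of_lipschitzOnWith hτ.2 (hK.mono Ico_subset_Icc_self)
      exact (h3.add h2).congr fun t ht => by simp [step, not_lt.2 ht.1]
  have hstab : ∀ k : ℕ, ∀ t < τ + k * D.h, X (k + 1) t = X k t := by
    intro k
    induction k with
    | zero =>
      intro t ht
      have ht : t < τ := by simpa using ht
      rw [hX]; simp [step, X, kappa, ht]
    | succ k ih =>
      intro t ht
      rw [hX, hX]
      by_cases h : t < τ
      · simp [step, h]
      · simp only [step, h, if_false]
        have : t - D.h < τ + k * D.h := by push_cast at ht; linarith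
        rw [← ih _ this, hX]
  obtain ⟨N, hN⟩ := exists_nat_gt (D.ϑ / D.h)
  rw [div_lt_iff₀ hh] at hN
  have hfix : ∀ t ≤ D.ϑ, X N t = step (X N) t := fun t ht => by
    rw [← hX, hstab N t (by linarith [hτ.1])]
  have hbefore : ∀ t ∈ Ico (τ - D.h) τ, X N t = w (t - τ) := fun t ht => by
    rw [hfix t (by linarith [ht.2, hτ.2])]; simp [step, ht.2]
  refine ⟨X N, ⟨hPL N, ?_, hbefore⟩, fun t ht => ?_⟩
  · rw [hfix τ hτ.2]
    simp only [step, lt_irrefl, if_false]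
    rw [hbefore _ ⟨le_rfl, by linarith⟩, hy, show τ - D.h - τ = -D.h by ring]
    abel
  · rw [yOf, hfix t ht.2]
    simp [step, not_lt.2 ht.1]

end Problem

end NeutralHJ

/-! ### Concatenation of trajectories -/

namespace NeutralHJ

variable {n : ℕ}

namespace Problem

variable {D : Problem n}

theorem seg_apply {x : ℝ → Vec n} {t ξ : ℝ} (hξ : ξ ∈ Ico (-D.h) 0) : D.seg x t ξ = x (t + ξ) :=
  indicator_of_mem hξ _

theorem seg_congr {x x' : ℝ → Vec n} {t : ℝ} (h : ∀ r ∈ Ico (t - D.h) t, x r = x' r) :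
    D.seg x t = D.seg x' t := by
  funext ξ
  by_cases hξ : ξ ∈ Ico (-D.h) 0
  · rw [seg_apply hξ, seg_apply hξ, h _ ⟨by linarith [hξ.1], by linarith [hξ.2]⟩]
  · rw [seg, seg, indicator_of_notMem hξ, indicator_of_notMem hξ]

theorem seg_mem_PLip {x : ℝ → Vec n} {a b t : ℝ} (hh : 0 ≤ D.h) (hx : PiecewiseLip x a b)
    (ha : a ≤ t - D.h) (hb : t ≤ b) : D.seg x t ∈ D.PLip := by
  refine ⟨?_, fun ξ hξ => indicator_of_notMem hξ _⟩
  have := (hx.mono ha (by linarith) hb).comp_add_const t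
  rw [show t - D.h - t = -D.h by ring, sub_self] at this
  exact this.congr fun ξ hξ => by rw [seg_apply hξ, add_comm]

theorem seg_eq_of_mem_Lam {τ : ℝ} {z : Vec n} {w x : ℝ → Vec n} (hw : w ∈ D.PLip)
    (hx : x ∈ D.Lam τ z w) : D.seg x τ = w := by
  funext ξ
  by_cases hξ : ξ ∈ Ico (-D.h) 0
  · rw [seg_apply hξ, hx.2.2 _ ⟨by linarith [hξ.1], by linarith [hξ.2]⟩]
    congr 1; ring
  · rw [seg, indicator_of_notMem hξ, hw.2 ξ hξ]

/-- Follow `x₁` before the time `r` and `x₂` from `r` on. -/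
noncomputable def glue (r : ℝ) (x₁ x₂ : ℝ → Vec n) (t : ℝ) : Vec n :=
  if t < r then x₁ t else x₂ t

section Glue

variable {τ r : ℝ} {z z' : Vec n} {w x₁ x₂ : ℝ → Vec n}

theorem glue_of_le (h : x₂ r = x₁ r) {t : ℝ} (ht : t ≤ r) : glue r x₁ x₂ t = x₁ t := by
  rcases ht.eq_or_lt with rfl | ht
  · simp [glue, h]
  · simp [glue, ht]

theorem glue_of_ge (h2 : x₂ ∈ D.Lam r z' (D.seg x₁ r)) {t : ℝ} (ht : r - D.h ≤ t) :
    glue r x₁ x₂ t = x₂ t := by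
  by_cases htr : t < r
  · rw [h2.2.2 t ⟨ht, htr⟩, seg_apply ⟨by linarith, by linarith⟩]
    simp [glue, htr]
  · simp [glue, htr]

theorem yOf_glue_of_le (hh : 0 ≤ D.h) (h : x₂ r = x₁ r) {t : ℝ} (ht : t ≤ r) :
    D.yOf (glue r x₁ x₂) t = D.yOf x₁ t := by
  rw [yOf, yOf, glue_of_le h ht, glue_of_le h (by linarith)]

theorem yOf_glue_of_ge (hh : 0 ≤ D.h) (h2 : x₂ ∈ D.Lam r z' (D.seg x₁ r)) {t : ℝ} (ht : r ≤ t) :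
    D.yOf (glue r x₁ x₂) t = D.yOf x₂ t := by
  rw [yOf, yOf, glue_of_ge h2 (by linarith), glue_of_ge h2 (by linarith)]

theorem glue_mem_Lam (hh : 0 ≤ D.h) (h1 : x₁ ∈ D.Lam τ z w) (hr : r ∈ Icc τ D.ϑ)
    (h2 : x₂ ∈ D.Lam r (x₁ r) (D.seg x₁ r)) : glue r x₁ x₂ ∈ D.Lam τ z w := by
  refine ⟨?_, ?_, fun t ht => ?_⟩
  · refine PiecewiseLip.trans (b := r)
      ((h1.1.mono le_rfl (by linarith [hr.1]) hr.2).congr fun t ht => ?_)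
      ((h2.1.mono (by linarith) hr.2 le_rfl).congr fun t ht => ?_)
    · exact glue_of_le h2.2.1 ht.2.le
    · exact glue_of_ge h2 (by linarith [ht.1])
  · rw [glue_of_le h2.2.1 hr.1, h1.2.1]
  · rw [glue_of_le h2.2.1 (ht.2.le.trans hr.1), h1.2.2 t ht]

theorem glue_mem_X (hD : D.Admissible) {η : ℝ} (h1 : x₁ ∈ D.X η τ z w) (hr : r ∈ Icc τ D.ϑ)
    (h2 : x₂ ∈ D.X η r (x₁ r) (D.seg x₁ r)) : glue r x₁ x₂ ∈ D.X η τ z w := by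
  have hh := hD.h_pos.le
  rw [mem_X_iff hD (hr.1.trans hr.2)] at h1 ⊢
  rw [mem_X_iff hD hr.2] at h2
  obtain ⟨hL1, hi1⟩ := h1
  obtain ⟨hL2, hi2⟩ := h2
  have hL := glue_mem_Lam hh hL1 hr hL2
  have e1 : ∀ c d, c ≤ d → d ≤ r → ∫ ξ in c..d, D.radius η (glue r x₁ x₂) ξ
      = ∫ ξ in c..d, D.radius η x₁ ξ := fun c d hcd hd => by
    refine intervalIntegral.integral_congr fun ξ hξ => ?_
    rw [uIcc_of_le hcd] at hξ
    have := hξ.2.trans hd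
    simp only [radius]
    rw [glue_of_le hL2.2.1 this, glue_of_le hL2.2.1 (by linarith)]
  have e2 : ∀ c d, c ≤ d → r ≤ c → ∫ ξ in c..d, D.radius η (glue r x₁ x₂) ξ
      = ∫ ξ in c..d, D.radius η x₂ ξ := fun c d hcd hd => by
    refine intervalIntegral.integral_congr fun ξ hξ => ?_
    rw [uIcc_of_le hcd] at hξ
    have := hd.trans hξ.1
    simp only [radius]
    rw [glue_of_ge hL2 (by linarith), glue_of_ge hL2 (by linarith)]
  have i1 : ∀ c d, τ ≤ c → c ≤ d → d ≤ r → ‖D.yOf (glue r x₁ x₂) d - D.yOf (glue r x₁ x₂) c‖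
      ≤ ∫ ξ in c..d, D.radius η (glue r x₁ x₂) ξ := fun c d hc hcd hd => by
    rw [e1 c d hcd hd, yOf_glue_of_le hh hL2.2.1 hd, yOf_glue_of_le hh hL2.2.1 (hcd.trans hd)]
    exact hi1 c d hc hcd (hd.trans hr.2)
  have i2 : ∀ c d, r ≤ c → c ≤ d → d ≤ D.ϑ → ‖D.yOf (glue r x₁ x₂) d - D.yOf (glue r x₁ x₂) c‖
      ≤ ∫ ξ in c..d, D.radius η (glue r x₁ x₂) ξ := fun c d hc hcd hd => by
    rw [e2 c d hcd hc, yOf_glue_of_ge hh hL2 hc, yOf_glue_of_ge hh hL2 (hc.trans hcd)]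
    exact hi2 c d hc hcd hd
  refine ⟨hL, fun c d hc hcd hd => ?_⟩
  rcases le_total d r with hdr | hdr
  · exact i1 c d hc hcd hdr
  rcases le_total r c with hrc | hrc
  · exact i2 c d hrc hcd hd
  rw [← intervalIntegral.integral_add_adjacent_intervals
    (intervalIntegrable_radius hL.1 hh η hc hrc hr.2)
    (intervalIntegrable_radius hL.1 hh η hr.1 hdr hd)]
  have := norm_sub_le_norm_sub_add_norm_sub (D.yOf (glue r x₁ x₂) d) (D.yOf (glue r x₁ x₂) r)
    (D.yOf (glue r x₁ x₂) c)
  linarith [i1 c r hc hrc le_rfl, i2 r d le_rfl hdr hd]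

theorem omega_glue (hD : D.Admissible) (h1 : x₁ ∈ D.Lam τ z w) (hτ : 0 ≤ τ) (hr : r ∈ Icc τ D.ϑ)
    (h2 : x₂ ∈ D.Lam r (x₁ r) (D.seg x₁ r)) {t : ℝ} (ht : t ∈ Icc r D.ϑ) (s : Vec n) :
    D.omega τ t (glue r x₁ x₂) s = D.omega τ r x₁ s + D.omega r t x₂ s := by
  have hh := hD.h_pos.le
  have hL := glue_mem_Lam hh h1 hr h2
  have e1 : ∫ ξ in τ..r, D.H ξ (glue r x₁ x₂ ξ) (glue r x₁ x₂ (ξ - D.h)) s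
      = ∫ ξ in τ..r, D.H ξ (x₁ ξ) (x₁ (ξ - D.h)) s := by
    refine intervalIntegral.integral_congr fun ξ hξ => ?_
    rw [uIcc_of_le hr.1] at hξ
    rw [glue_of_le h2.2.1 hξ.2, glue_of_le h2.2.1 (by linarith [hξ.2])]
  have e2 : ∫ ξ in r..t, D.H ξ (glue r x₁ x₂ ξ) (glue r x₁ x₂ (ξ - D.h)) s
      = ∫ ξ in r..t, D.H ξ (x₂ ξ) (x₂ (ξ - D.h)) s := by
    refine intervalIntegral.integral_congr fun ξ hξ => ?_
    rw [uIcc_of_le ht.1] at hξ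
    rw [glue_of_ge h2 (by linarith [hξ.1]), glue_of_ge h2 (by linarith [hξ.1])]
  rw [omega, omega, omega, ← e1, ← e2, ← intervalIntegral.integral_add_adjacent_intervals
    (hD.intervalIntegrable_H hL.1 hτ le_rfl s le_rfl hr.1 hr.2)
    (hD.intervalIntegrable_H hL.1 hτ le_rfl s hr.1 ht.1 ht.2),
    yOf_glue_of_ge hh h2 ht.1, yOf_glue_of_le hh h2.2.1 hr.1]
  have : D.yOf x₁ r = D.yOf x₂ r := by
    rw [← yOf_glue_of_le hh h2.2.1 le_rfl, yOf_glue_of_ge hh h2 le_rfl]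
  rw [this, inner_sub_left, inner_sub_left, inner_sub_left]
  ring

theorem seg_glue (h2 : x₂ ∈ D.Lam r z' (D.seg x₁ r)) {t : ℝ} (ht : r ≤ t) :
    D.seg (glue r x₁ x₂) t = D.seg x₂ t :=
  seg_congr fun _ hs => glue_of_ge h2 (by linarith [hs.1])

end Glue

theorem omega_self (D : Problem n) (τ : ℝ) (x : ℝ → Vec n) (s : Vec n) : D.omega τ τ x s = 0 := by
  simp [omega]

/-! ### Duality between the upper and the lower inequalities -/

/-- The problem satisfied by `-φ`: the Hamiltonian is `-H(τ, z, r, -s)` and the terminal functional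
is `-σ`. It exchanges the two halves of every notion of solution. -/
def dual (D : Problem n) : Problem n where
  h := D.h
  I := D.I
  g := D.g
  H := fun τ z r s => -D.H τ z r (-s)
  σ := fun z w => -D.σ z w
  cH := D.cH

theorem Admissible.dual (hD : D.Admissible) : D.dual.Admissible where
  h_pos := hD.h_pos
  I_pos := hD.I_pos
  g_contDiff := hD.g_contDiff
  H_cont := by
    refine (hD.H_cont.comp (f := fun q : ℝ × Vec n × Vec n × Vec n =>
      (q.1, q.2.1, q.2.2.1, -q.2.2.2)) (by fun_prop) ?_).neg
    exact fun q hq => ⟨hq.1, mem_univ _⟩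
  cH_pos := hD.cH_pos
  H_growth := fun τ hτ z r s s' => by
    have := hD.H_growth τ hτ z r (-s) (-s')
    simp only [Problem.dual]
    rw [neg_sub_neg, abs_sub_comm]
    convert this using 2
    rw [← norm_neg]; congr 1; abel
  H_lip := fun α hα => by
    obtain ⟨lam, hlam, h⟩ := hD.H_lip α hα
    refine ⟨lam, hlam, fun τ hτ z r z' r' s h1 h2 h3 h4 => ?_⟩
    have := h τ hτ z r z' r' (-s) h1 h2 h3 h4
    simp only [Problem.dual]
    rwa [neg_sub_neg, abs_sub_comm, ← norm_neg s]
  σ_lip := fun α hα => by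
    obtain ⟨lam, hlam, h⟩ := hD.σ_lip α hα
    refine ⟨lam, hlam, fun z w z' w' h1 h2 => ?_⟩
    have := h z w z' w' h1 h2
    simp only [Problem.dual]
    rwa [neg_sub_neg, abs_sub_comm]

variable {φ : ℝ → Vec n → (ℝ → Vec n) → ℝ}

theorem Phi1.neg (h : D.Phi1 φ) : D.dual.Phi1 (-φ) := fun τ hτ w hw => (h τ hτ w hw).neg

theorem Phi2.neg (h : D.Phi2 φ) : D.dual.Phi2 (-φ) := fun α hα => by
  obtain ⟨lam, hlam, h⟩ := h α hα
  refine ⟨lam, hlam, fun τ hτ z w z' w' h1 h2 => ?_⟩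
  have := h τ hτ z w z' w' h1 h2
  simp only [Pi.neg_apply]
  rwa [neg_sub_neg, abs_sub_comm]

theorem omega_dual (τ t : ℝ) (x : ℝ → Vec n) (s : Vec n) :
    D.dual.omega τ t x s = -D.omega τ t x (-s) := by
  simp only [omega, dual, intervalIntegral.integral_neg, inner_neg_right]
  have : D.dual.yOf x = D.yOf x := rfl
  rw [← dual, this]
  ring

theorem EReal_neg_iSup₂ {α : Type*} (S : Set α) (f : α → EReal) :
    -(⨆ x ∈ S, f x) = ⨅ x ∈ S, -f x := by
  have h : ∀ {ι : Sort _} (u : ι → EReal), -(⨆ i, u i) = ⨅ i, -u i :=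
    fun u => EReal.negOrderIso.map_iSup u
  rw [h]
  exact iInf_congr fun x => EReal.negOrderIso.map_iSup _

theorem lowerIneq_iff_dual {η τ : ℝ} {z : Vec n} {w : ℝ → Vec n} {t : ℝ} {s : Vec n} :
    D.LowerIneq φ η τ z w t s ↔ D.dual.UpperIneq (-φ) η τ z w t (-s) := by
  rw [LowerIneq, UpperIneq, ← EReal.neg_le_neg_iff, EReal_neg_iSup₂]
  have h1 : ∀ x, D.dual.omega τ t x (-s) = -D.omega τ t x s := fun x => by
    rw [omega_dual, neg_neg]
  have h2 : D.dual.X η τ z w = D.X η τ z w := rfl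
  have h3 : ∀ x t, D.dual.seg x t = D.seg x t := fun _ _ => rfl
  simp only [h1, h2, h3, Pi.neg_apply, EReal.coe_neg, EReal.coe_add]
  have h4 : ∀ a b : ℝ, -((a : EReal) + b) = -(a : EReal) + -b := fun a b => by
    rw [← EReal.coe_add, ← EReal.coe_neg, neg_add, EReal.coe_add, EReal.coe_neg, EReal.coe_neg]
  simp only [h4]

/-- The upper half of the minimax inequalities. -/
def MinimaxUpper (D : Problem n) (φ : ℝ → Vec n → (ℝ → Vec n) → ℝ) : Prop :=
  ∀ τ z w, (τ, z, w) ∈ D.G → τ < D.ϑ → ∀ t ∈ Ioc τ D.ϑ, ∀ s : Vec n, D.UpperIneq φ 0 τ z w t s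

/-- The upper half of the `C¹`-minimax inequalities. -/
def C1MinimaxUpper (D : Problem n) (φ : ℝ → Vec n → (ℝ → Vec n) → ℝ) : Prop :=
  ∀ i : ℕ, i < D.I → ∀ τ ∈ Ico (i * D.h) ((i + 1) * D.h), ∀ w ∈ D.C1,
    ∀ t ∈ Ioc τ ((i + 1) * D.h), ∀ s : Vec n, ∀ η ∈ Ioc (0 : ℝ) 1,
      D.UpperIneq φ η τ (atZero w) w t s

/-- The inequality for lower directional derivatives. -/
def DiniUpper (D : Problem n) (φ : ℝ → Vec n → (ℝ → Vec n) → ℝ) : Prop :=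
  ∀ τ z w, (τ, z, w) ∈ D.GStar → ∀ s : Vec n,
    (⨅ l ∈ D.dirs τ z w, (D.lowerDir φ 1 l τ z w +
      ((inner ℝ (D.dg τ w) s + D.H τ z (w (-D.h)) s - inner ℝ l s : ℝ) : EReal))) ≤ 0

/-- The inequality for subdifferentials. -/
def SubdiffIneq (D : Problem n) (φ : ℝ → Vec n → (ℝ → Vec n) → ℝ) : Prop :=
  ∀ τ z w, (τ, z, w) ∈ D.GStar → ∀ p₀ p, (p₀, p) ∈ D.subdiff φ τ z w → D.hj τ z w p₀ p ≤ 0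

/-- The inequality for test functions touching from below. -/
def TestBelowIneq (D : Problem n) (φ : ℝ → Vec n → (ℝ → Vec n) → ℝ) : Prop :=
  ∀ τ z w, (τ, z, w) ∈ D.GStar → ∀ ψ : ℝ × Vec n → ℝ, ContDiff ℝ 1 ψ → ∀ δ > 0,
    (∀ t x, (t, x) ∈ D.Oplus δ τ z →
      φ τ z w - ψ (τ, z) ≤ φ t x (D.seg (kappa τ z w) t) - ψ (t, x)) →
    D.hj τ z w (deriv (fun t => ψ (t, z)) τ) (gradient (fun x => ψ (τ, x)) z) ≤ 0

theorem isMinimax_iff_dual : D.IsMinimax φ ↔ D.Phi1 φ ∧ D.Phi2 φ ∧ D.Terminal φ ∧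
    D.MinimaxUpper φ ∧ D.dual.MinimaxUpper (-φ) := by
  refine and_congr_right fun _ => and_congr_right fun _ => and_congr_right fun _ => ⟨fun h =>
    ⟨fun τ z w hG hτ t ht s => (h τ z w hG hτ t ht s).1, fun τ z w hG hτ t ht s => ?_⟩,
    fun h τ z w hG hτ t ht s => ⟨h.1 τ z w hG hτ t ht s, ?_⟩⟩
  · simpa using lowerIneq_iff_dual.1 (h τ z w hG hτ t ht (-s)).2
  · exact lowerIneq_iff_dual.2 (h.2 τ z w hG hτ t ht (-s))

theorem isC1Minimax_iff_dual : D.IsC1Minimax φ ↔ D.Phi1 φ ∧ D.Phi2 φ ∧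
    (∀ w ∈ D.C1, φ D.ϑ (atZero w) w = D.σ (atZero w) w) ∧
    D.C1MinimaxUpper φ ∧ D.dual.C1MinimaxUpper (-φ) := by
  refine and_congr_right fun _ => and_congr_right fun _ => and_congr_right fun _ => ⟨fun h =>
    ⟨fun i hi τ hτ w hw t ht s η hη => (h i hi τ hτ w hw t ht s η hη).1,
      fun i hi τ hτ w hw t ht s η hη => ?_⟩,
    fun h i hi τ hτ w hw t ht s η hη => ⟨h.1 i hi τ hτ w hw t ht s η hη, ?_⟩⟩
  · simpa using lowerIneq_iff_dual.1 (h i hi τ hτ w hw t ht (-s) η hη).2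
  · exact lowerIneq_iff_dual.2 (h.2 i hi τ hτ w hw t ht (-s) η hη)

theorem quot_dual (l₀ : ℝ) (l : Vec n) (τ : ℝ) (z : Vec n) (w : ℝ → Vec n) (δ : ℝ) :
    D.dual.quot (-φ) l₀ l τ z w δ = -D.quot φ l₀ l τ z w δ := by
  have h3 : ∀ x t, D.dual.seg x t = D.seg x t := fun _ _ => rfl
  simp only [quot, h3, Pi.neg_apply]
  ring

theorem lowerDir_dual (l₀ : ℝ) (l : Vec n) (τ : ℝ) (z : Vec n) (w : ℝ → Vec n) :
    D.dual.lowerDir (-φ) l₀ l τ z w = -D.upperDir φ l₀ l τ z w := by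
  rw [lowerDir, upperDir, ← EReal.liminf_neg]
  simp only [quot_dual, EReal.coe_neg]
  rfl

theorem upper_dini_iff_dual {τ : ℝ} {z : Vec n} {w : ℝ → Vec n} {s : Vec n} :
    (0 ≤ ⨆ l ∈ D.dirs τ z w, (D.upperDir φ 1 l τ z w +
        ((inner ℝ (D.dg τ w) s + D.H τ z (w (-D.h)) s - inner ℝ l s : ℝ) : EReal))) ↔
    (⨅ l ∈ D.dual.dirs τ z w, (D.dual.lowerDir (-φ) 1 l τ z w +
        ((inner ℝ (D.dual.dg τ w) (-s) + D.dual.H τ z (w (-D.dual.h)) (-s)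
          - inner ℝ l (-s) : ℝ) : EReal))) ≤ 0 := by
  have h1 : D.dual.dirs τ z w = D.dirs τ z w := rfl
  have h2 : D.dual.dg τ w = D.dg τ w := rfl
  have h3 : D.dual.H τ z (w (-D.dual.h)) (-s) = -D.H τ z (w (-D.h)) s := by simp [dual]
  rw [h1, h2, h3, ← EReal.neg_le_neg_iff, EReal_neg_iSup₂, neg_zero]
  have h4 : ∀ (a : EReal) (b : ℝ), -(a + b) = -a + ((-b : ℝ) : EReal) := fun a b => by
    rw [EReal.neg_add (Or.inr (EReal.coe_ne_top b)) (Or.inr (EReal.coe_ne_bot b)), EReal.coe_neg,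
      sub_eq_add_neg]
  simp only [h4, lowerDir_dual, inner_neg_right]
  refine Iff.of_eq (congrArg (· ≤ (0 : EReal)) (iInf_congr fun l => iInf_congr fun _ => ?_))
  congr 2
  ring

theorem isDini_iff_dual : D.IsDini φ ↔ D.Phi1 φ ∧ D.Phi2 φ ∧ D.Terminal φ ∧
    D.DiniUpper φ ∧ D.dual.DiniUpper (-φ) := by
  refine and_congr_right fun _ => and_congr_right fun _ => and_congr_right fun _ => ⟨fun h =>
    ⟨fun τ z w hG s => (h τ z w hG s).1, fun τ z w hG s => ?_⟩,
    fun h τ z w hG s => ⟨h.1 τ z w hG s, ?_⟩⟩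
  · simpa using upper_dini_iff_dual.1 (h τ z w hG (-s)).2
  · exact upper_dini_iff_dual.2 (h.2 τ z w hG (-s))

theorem hj_dual (τ : ℝ) (z : Vec n) (w : ℝ → Vec n) (p₀ : ℝ) (p : Vec n) :
    D.dual.hj τ z w (-p₀) (-p) = -D.hj τ z w p₀ p := by
  have h2 : D.dual.dg τ w = D.dg τ w := rfl
  simp only [hj, h2, inner_neg_right]
  simp only [dual, neg_neg]
  ring

theorem mem_superdiff_iff_dual {τ : ℝ} {z : Vec n} {w : ℝ → Vec n} {p₀ : ℝ} {p : Vec n} :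
    (p₀, p) ∈ D.superdiff φ τ z w ↔ (-p₀, -p) ∈ D.dual.subdiff (-φ) τ z w := by
  have h1 : ∀ q, D.dual.diffQuot (-φ) (-p₀, -p) τ z w q = -D.diffQuot φ (p₀, p) τ z w q := by
    intro q
    have h3 : ∀ x t, D.dual.seg x t = D.seg x t := fun _ _ => rfl
    simp only [diffQuot, h3, Pi.neg_apply, inner_neg_right]
    ring
  have h2 : ∀ δ, D.dual.Oplus δ τ z = D.Oplus δ τ z := fun _ => rfl
  simp only [superdiff, subdiff, mem_ofPred_eq, h1, h2, EReal.coe_neg, ← EReal_neg_iSup₂]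
  constructor
  · rintro ⟨L, hL, h0⟩
    exact ⟨-L, (continuous_neg.tendsto L).comp hL, by simpa using EReal.neg_le_neg_iff.2 h0⟩
  · rintro ⟨L, hL, h0⟩
    refine ⟨-L, ?_, by simpa using EReal.neg_le_neg_iff.2 h0⟩
    have := (continuous_neg.tendsto L).comp hL
    simp only [Function.comp_def, neg_neg] at this
    exact this

theorem isDiffViscosity_iff_dual : D.IsDiffViscosity φ ↔ D.Phi1 φ ∧ D.Phi2 φ ∧ D.Terminal φ ∧
    D.SubdiffIneq φ ∧ D.dual.SubdiffIneq (-φ) := by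
  refine and_congr_right fun _ => and_congr_right fun _ => and_congr_right fun _ => ⟨fun h =>
    ⟨fun τ z w hG => (h τ z w hG).1, fun τ z w hG p₀ p hp => ?_⟩,
    fun h τ z w hG => ⟨h.1 τ z w hG, fun p₀ p hp => ?_⟩⟩
  · have := (h τ z w hG).2 (-p₀) (-p) (mem_superdiff_iff_dual.2 (by simpa using hp))
    have h2 := hj_dual (D := D) τ z w (-p₀) (-p)
    simp only [neg_neg] at h2
    linarith
  · have := h.2 τ z w hG (-p₀) (-p) (mem_superdiff_iff_dual.1 hp)
    rw [hj_dual] at this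
    linarith

theorem isViscosity_iff_dual : D.IsViscosity φ ↔ D.Phi1 φ ∧ D.Phi2 φ ∧ D.Terminal φ ∧
    D.TestBelowIneq φ ∧ D.dual.TestBelowIneq (-φ) := by
  refine and_congr_right fun _ => and_congr_right fun _ => and_congr_right fun _ =>
    and_congr_right fun _ => ?_
  have hseg : ∀ x t, D.dual.seg x t = D.seg x t := fun _ _ => rfl
  have hgrad : ∀ (f : Vec n → ℝ) z, gradient (fun x => -f x) z = -gradient f z := fun f z => by
    simp only [gradient]
    rw [fderiv_fun_neg, map_neg]
  have hder : ∀ (f : ℝ → ℝ) t, deriv (fun t => -f t) t = -deriv f t := fun f t => by simp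
  constructor
  · intro h τ z w hG ψ hψ δ hδ hmin
    have := h τ z w hG (fun q => -ψ q) hψ.neg δ hδ fun t x htx => by
      have := hmin t x htx
      simp only [Pi.neg_apply, hseg] at this
      linarith
    rw [hgrad, hder] at this
    have h2 := hj_dual (D := D) τ z w (-deriv (fun t => ψ (t, z)) τ)
      (-gradient (fun x => ψ (τ, x)) z)
    simp only [neg_neg] at h2
    linarith
  · intro h τ z w hG ψ hψ δ hδ hmax
    have := h τ z w hG (fun q => -ψ q) hψ.neg δ hδ fun t x htx => by
      have := hmax t x htx
      simp only [Pi.neg_apply, hseg]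
      linarith
    rw [hgrad, hder, hj_dual] at this
    linarith

end Problem

end NeutralHJ

/-! ### From directional derivatives to test functions -/

namespace NeutralHJ

variable {n : ℕ}

namespace Problem

variable {D : Problem n} {φ : ℝ → Vec n → (ℝ → Vec n) → ℝ}

theorem Admissible.mem_Ioo_of_GStar (hD : D.Admissible) {τ : ℝ} {z : Vec n} {w : ℝ → Vec n}
    (hG : (τ, z, w) ∈ D.GStar) : τ ∈ Ioo 0 D.ϑ := by
  obtain ⟨⟨i, hi, h1, h2⟩, -⟩ := hG
  have := hD.h_pos
  exact ⟨lt_of_le_of_lt (by positivity) h1, h2.trans_le (hD.succ_mul_le hi)⟩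

/-- A subgradient bounds the lower directional derivatives from below. -/
theorem le_lowerDir_of_mem_subdiff {τ : ℝ} {z : Vec n} {w : ℝ → Vec n} (hτ : τ < D.ϑ) {p₀ : ℝ}
    {p : Vec n} (hp : (p₀, p) ∈ D.subdiff φ τ z w) (l : Vec n) :
    ((p₀ + inner ℝ l p : ℝ) : EReal) ≤ D.lowerDir φ 1 l τ z w := by
  obtain ⟨L, hL, h0⟩ := hp
  set m := 1 + ‖l‖ with hm
  have hm1 : 0 < m := by positivity
  refine EReal.ge_of_forall_gt_iff_ge.1 fun b hb => ?_
  have hb : b < p₀ + inner ℝ l p := by exact_mod_cast hb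
  set ε := (p₀ + inner ℝ l p - b) / m with hε
  have hε0 : 0 < ε := div_pos (by linarith) hm1
  have h1 : ∀ᶠ δ in 𝓝[>] (0 : ℝ), ((-ε : ℝ) : EReal) <
      ⨅ q ∈ D.Oplus δ τ z \ {(τ, z)}, ((D.diffQuot φ (p₀, p) τ z w q : ℝ) : EReal) :=
    hL.eventually (lt_mem_nhds (lt_of_lt_of_le (by exact_mod_cast (neg_lt_zero.2 hε0)) h0))
  obtain ⟨δ₀, hδ₀, hδ₀pos⟩ := (h1.and self_mem_nhdsWithin).exists
  have hδ₀pos : 0 < δ₀ := hδ₀pos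
  rw [lowerDir]
  refine le_liminf_of_le (h := ?_)
  have hd : 0 < min (δ₀ / m) (D.ϑ - τ) := lt_min (div_pos hδ₀pos hm1) (by linarith)
  filter_upwards [Ioo_mem_nhdsGT hd] with δ hδ
  have hδ0 := hδ.1
  have hδm : δ * m < δ₀ := by
    rw [← lt_div_iff₀ hm1]; exact hδ.2.trans_le (min_le_left _ _)
  have hδϑ : δ < D.ϑ - τ := hδ.2.trans_le (min_le_right _ _)
  have hl : δ * ‖l‖ ≤ δ * m := by rw [hm]; nlinarith
  have hmem : (τ + 1 * δ, z + δ • l) ∈ D.Oplus δ₀ τ z \ {(τ, z)} := by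
    refine ⟨⟨⟨by simp [hδ0.le], ?_⟩, by linarith, ?_⟩, ?_⟩
    · have : δ * 1 ≤ δ * m := by gcongr; linarith [norm_nonneg l]
      linarith
    · simp only [add_sub_cancel_left, norm_smul, Real.norm_eq_abs, abs_of_pos hδ0]; linarith
    · simp only [mem_singleton_iff, Prod.mk.injEq, not_and]
      intro h; linarith
  have h2 := lt_of_lt_of_le hδ₀ (iInf₂_le _ hmem)
  have h2 : -ε < D.diffQuot φ (p₀, p) τ z w (τ + 1 * δ, z + δ • l) := by exact_mod_cast h2
  have hden : |τ + 1 * δ - τ| + ‖z + δ • l - z‖ = δ * m := by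
    simp only [one_mul, add_sub_cancel_left, norm_smul, Real.norm_eq_abs, abs_of_pos hδ0, hm]
    ring
  simp only [diffQuot, hden] at h2
  rw [lt_div_iff₀ (by positivity)] at h2
  simp only [add_sub_cancel_left, inner_smul_left, RCLike.conj_to_real, one_mul] at h2
  have : b ≤ D.quot φ 1 l τ z w δ := by
    rw [quot, le_div_iff₀ hδ0, one_mul]
    have e : ε * (δ * m) = (p₀ + inner ℝ l p - b) * δ := by rw [hε]; field_simp
    nlinarith
  exact_mod_cast this

/-- If `p` is a subgradient, then `p₀ + ⟨l, p⟩` bounds the lower derivative in the direction `l` from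
below, so that the inequality for directional derivatives with `s = p` does not depend on `l`. -/
theorem DiniUpper.subdiffIneq (hD : D.Admissible) (h : D.DiniUpper φ) : D.SubdiffIneq φ := by
  intro τ z w hG p₀ p hp
  have h1 := h τ z w hG p
  have h2 : ((D.hj τ z w p₀ p : ℝ) : EReal) ≤ 0 := by
    refine le_trans (le_iInf₂ fun l _ => ?_) h1
    calc ((D.hj τ z w p₀ p : ℝ) : EReal)
        = ((p₀ + inner ℝ l p : ℝ) : EReal) +
          ((inner ℝ (D.dg τ w) p + D.H τ z (w (-D.h)) p - inner ℝ l p : ℝ) : EReal) := by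
          rw [← EReal.coe_add, hj]
          congr 1
          ring
      _ ≤ _ := by
          gcongr
          exact le_lowerDir_of_mem_subdiff (hD.mem_Ioo_of_GStar hG).2 hp l
  exact_mod_cast h2

theorem deriv_fst_eq_fderiv {ψ : ℝ × Vec n → ℝ} {τ : ℝ} {z : Vec n}
    (hψ : DifferentiableAt ℝ ψ (τ, z)) :
    deriv (fun t => ψ (t, z)) τ = fderiv ℝ ψ (τ, z) (1, 0) := by
  have := HasFDerivAt.comp_hasDerivAt (f := fun t : ℝ => (t, z)) τ hψ.hasFDerivAt
    ((hasDerivAt_id τ).prodMk (hasDerivAt_const τ z))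
  exact this.deriv

theorem inner_gradient_snd_eq_fderiv {ψ : ℝ × Vec n → ℝ} {τ : ℝ} {z : Vec n}
    (hψ : DifferentiableAt ℝ ψ (τ, z)) (v : Vec n) :
    inner ℝ v (gradient (fun x => ψ (τ, x)) z) = fderiv ℝ ψ (τ, z) (0, v) := by
  have := HasFDerivAt.comp (f := fun x : Vec n => (τ, x)) z hψ.hasFDerivAt
    ((hasFDerivAt_const τ z).prodMk (hasFDerivAt_id z))
  have h2 : HasFDerivAt (fun x => ψ (τ, x)) _ z := this
  simp only [gradient]
  rw [h2.fderiv, real_inner_comm, InnerProductSpace.toDual_symm_apply]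
  simp

/-- The derivative of a test function touching `φ` from below is a subgradient. -/
theorem mem_subdiff_of_touching {τ : ℝ} {z : Vec n} {w : ℝ → Vec n} {ψ : ℝ × Vec n → ℝ}
    (hψ : DifferentiableAt ℝ ψ (τ, z)) {δ : ℝ} (hδ : 0 < δ)
    (hmin : ∀ t x, (t, x) ∈ D.Oplus δ τ z →
      φ τ z w - ψ (τ, z) ≤ φ t x (D.seg (kappa τ z w) t) - ψ (t, x)) :
    (deriv (fun t => ψ (t, z)) τ, gradient (fun x => ψ (τ, x)) z) ∈ D.subdiff φ τ z w := by
  set p₀ := deriv (fun t => ψ (t, z)) τ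
  set p := gradient (fun x => ψ (τ, x)) z
  set F : ℝ → EReal := fun δ => ⨅ q ∈ D.Oplus δ τ z \ {(τ, z)},
    ((D.diffQuot φ (p₀, p) τ z w q : ℝ) : EReal) with hF
  have hanti : Antitone F := by
    intro a b hab
    refine iInf_mono fun q => iInf_mono' fun hq => ⟨⟨⟨⟨hq.1.1.1, ?_⟩, hq.1.2.1, ?_⟩, hq.2⟩, le_rfl⟩
    · linarith [hq.1.1.2]
    · exact hq.1.2.2.trans hab
  have hp0 : p₀ = fderiv ℝ ψ (τ, z) (1, 0) := deriv_fst_eq_fderiv hψ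
  have hp : ∀ v, inner ℝ v p = fderiv ℝ ψ (τ, z) (0, v) := inner_gradient_snd_eq_fderiv hψ
  refine ⟨_, hanti.tendsto_nhdsGT 0, ?_⟩
  refine le_of_forall_lt fun c hc => ?_
  obtain ⟨b, hcb, hb⟩ := EReal.lt_iff_exists_real_btwn.1 hc
  have hb : b < 0 := by exact_mod_cast hb
  refine lt_of_lt_of_le hcb ?_
  have ho := hψ.hasFDerivAt.isLittleO
  have hb2 : 0 < -b / 2 := by linarith
  obtain ⟨r, hr, hball⟩ := Metric.eventually_nhds_iff.1 ((isLittleO_iff.1 ho) hb2)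
  set d := min δ (r / 2)
  have hd : 0 < d := lt_min hδ (by linarith)
  refine le_trans ?_ (le_sSup (mem_image_of_mem F hd))
  refine le_iInf₂ fun q hq => ?_
  obtain ⟨t, x⟩ := q
  obtain ⟨⟨⟨ht1, ht2⟩, ht3, hx⟩, hne⟩ := hq
  simp only at ht1 ht2 ht3 hx
  have hdδ : d ≤ δ := min_le_left _ _
  have hdr : d ≤ r / 2 := min_le_right _ _
  have habs : |t - τ| = t - τ := abs_of_nonneg (by linarith)
  have h1 := hball (y := (t, x)) (by
    rw [Prod.dist_eq, max_lt_iff, Real.dist_eq, dist_eq_norm, habs]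
    exact ⟨by linarith, by linarith⟩)
  have h2 := hmin t x ⟨⟨ht1, by linarith⟩, ht3, hx.trans hdδ⟩
  have hsplit : fderiv ℝ ψ (τ, z) ((t, x) - (τ, z)) = (t - τ) * p₀ + inner ℝ (x - z) p := by
    rw [hp, hp0, ← smul_eq_mul, ← map_smul, ← map_add]
    simp
  rw [hsplit, Real.norm_eq_abs] at h1
  have hnorm : ‖((t, x) : ℝ × Vec n) - (τ, z)‖ ≤ |t - τ| + ‖x - z‖ := by
    rw [Prod.norm_def]
    exact max_le (by simp) (by simp)
  have hpos : 0 < |t - τ| + ‖x - z‖ := by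
    refine lt_of_le_of_ne (by positivity) fun h => hne ?_
    have h3 : |t - τ| = 0 := by linarith [abs_nonneg (t - τ), norm_nonneg (x - z)]
    have h4 : ‖x - z‖ = 0 := by linarith [abs_nonneg (t - τ), norm_nonneg (x - z)]
    rw [mem_singleton_iff, Prod.mk.injEq]
    exact ⟨sub_eq_zero.1 (abs_eq_zero.1 h3), sub_eq_zero.1 (norm_eq_zero.1 h4)⟩
  have h5 := (abs_le.1 h1).1
  have h6 : -b / 2 * ‖((t, x) : ℝ × Vec n) - (τ, z)‖ ≤ -b / 2 * (|t - τ| + ‖x - z‖) := by gcongr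
  have : b ≤ D.diffQuot φ (p₀, p) τ z w (t, x) := by
    rw [diffQuot, le_div_iff₀ hpos]
    simp only
    nlinarith
  exact_mod_cast this

theorem SubdiffIneq.testBelowIneq (h : D.SubdiffIneq φ) : D.TestBelowIneq φ :=
  fun τ z w hG _ hψ _ hδ hmin =>
    h τ z w hG _ _ (mem_subdiff_of_touching ((hψ.differentiable one_ne_zero) _) hδ hmin)

end Problem

end NeutralHJ

/-! ### Approximation of histories by continuously differentiable ones -/

namespace NeutralHJ

variable {n : ℕ}

namespace Problem

variable {D : Problem n}

theorem atZero_eq_of_tendsto {w : ℝ → Vec n} {z : Vec n} (h : Tendsto w (𝓝[<] 0) (𝓝 z)) :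
    atZero w = z :=
  leftLim_eq_of_tendsto h

theorem exists_contDiff_interpolation (B : Finset ℝ) (v : ℝ → Vec n) :
    ∃ V : ℝ → Vec n, ContDiff ℝ 1 V ∧ ∀ a ∈ B, V a = v a := by
  classical
  refine ⟨fun t => ∑ a ∈ B, (Lagrange.basis B id a).eval t • v a, ?_, fun b hb => ?_⟩
  · refine ContDiff.sum fun a _ => ?_
    have h : ContDiff ℝ 1 fun t : ℝ => (Lagrange.basis B id a).eval t := by
      simpa using (Lagrange.basis B id a).contDiff_aeval (𝕜 := ℝ) 1
    exact h.smul contDiff_const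
  · simp only
    rw [Finset.sum_eq_single_of_mem b hb fun a ha hab => ?_]
    · have := Lagrange.eval_basis_self (v := (id : ℝ → ℝ)) (Function.injective_id.injOn) hb
      simp only [id] at this
      simp only [this, one_smul]
    · have := Lagrange.eval_basis_of_ne (s := B) (v := (id : ℝ → ℝ)) hab hb
      simp only [id] at this
      simp only [this, zero_smul]

theorem exists_bound_of_mem_PLip {w : ℝ → Vec n} (hw : w ∈ D.PLip) :
    ∃ C, 0 ≤ C ∧ ∀ ξ, ‖w ξ‖ ≤ C := by
  obtain ⟨C, hC, h⟩ := hw.1.exists_bound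
  refine ⟨C, hC, fun ξ => ?_⟩
  by_cases hξ : ξ ∈ Ico (-D.h) 0
  · exact h ξ hξ
  · simpa [hw.2 ξ hξ] using hC

theorem aestronglyMeasurable_of_mem_PLip {w : ℝ → Vec n} (hw : w ∈ D.PLip) :
    AEStronglyMeasurable w volume := by
  have h1 := hw.1.aestronglyMeasurable
  rw [Measure.restrict_congr_set Ico_ae_eq_Icc.symm] at h1
  have h2 := (aestronglyMeasurable_indicator_iff measurableSet_Ico).2 h1
  have h3 : (Ico (-D.h) 0).indicator w = w := by
    rw [indicator_eq_self]
    intro ξ hξ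
    by_contra h
    exact hξ (hw.2 ξ h)
  rwa [h3] at h2

/-- The restriction to `[-h, 0)` of a `C¹` function on the line belongs to the space `C¹`. -/
theorem indicator_mem_C1 (hh : 0 ≤ D.h) {u : ℝ → Vec n} (hu : ContDiff ℝ 1 u) :
    (Ico (-D.h) 0).indicator u ∈ D.C1 := by
  have heq : EqOn ((Ico (-D.h) 0).indicator u) u (Ico (-D.h) 0) := fun ξ hξ =>
    indicator_of_mem hξ _
  obtain ⟨K, hK⟩ := LocallyLipschitzOn.exists_lipschitzOnWith_of_compact
    (isCompact_Icc (a := -D.h) (b := 0)) ((hu.contDiffOn).locallyLipschitzOn (convex_Icc _ _))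
  have hL : LipschitzOnWith K ((Ico (-D.h) 0).indicator u) (Ico (-D.h) 0) := fun s hs t ht => by
    rw [heq hs, heq ht]
    exact hK (Ico_subset_Icc_self hs) (Ico_subset_Icc_self ht)
  exact ⟨⟨⟨.of_lipschitzOnWith (by linarith) hL, fun ξ hξ => indicator_of_notMem hξ _⟩, K, hL⟩,
    hu.contDiffOn.congr heq⟩

theorem atZero_indicator (hh : 0 < D.h) {u : ℝ → Vec n} (hu : Continuous u) :
    atZero ((Ico (-D.h) 0).indicator u) = u 0 := by
  refine atZero_eq_of_tendsto ((hu.continuousWithinAt.tendsto).congr' ?_)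
  filter_upwards [Ioo_mem_nhdsLT (show -D.h < 0 by linarith)] with ξ hξ
  exact (indicator_of_mem (Ioo_subset_Ico_self hξ) u).symm

/-- Every history is a bounded almost everywhere limit of continuously differentiable histories
with a prescribed left limit at `0` and with the same values at finitely many points: mollify, and
correct the values with bump functions whose supports shrink. -/
theorem exists_C1_approx (hh : 0 < D.h) {w : ℝ → Vec n} (hw : w ∈ D.PLip) (z : Vec n)
    {A : Finset ℝ} (hA : ∀ a ∈ A, a ∈ Ico (-D.h) 0) :
    ∃ (C : ℝ) (W : ℕ → ℝ → Vec n), (∀ k, W k ∈ D.C1) ∧ (∀ k, atZero (W k) = z) ∧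
      (∀ k, ∀ a ∈ A, W k a = w a) ∧ (∀ k ξ, ‖W k ξ‖ ≤ C) ∧
      ∀ᵐ ξ, Tendsto (fun k => W k ξ) atTop (𝓝 (w ξ)) := by
  classical
  obtain ⟨C, hC, hwC⟩ := exists_bound_of_mem_PLip hw
  have hmeas := aestronglyMeasurable_of_mem_PLip hw
  have hloc : LocallyIntegrable w volume :=
    (locallyIntegrable_const C).mono hmeas (Eventually.of_forall fun ξ => by
      rw [Real.norm_of_nonneg hC]; exact hwC ξ)
  have hr : ∀ k : ℕ, 0 < 1 / (2 * ((k : ℝ) + 1)) ∧ 1 / (2 * ((k : ℝ) + 1)) < 1 / ((k : ℝ) + 1) :=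
    fun k => ⟨by positivity, by
      apply one_div_lt_one_div_of_lt <;> [positivity; linarith [k.cast_nonneg (α := ℝ)]]⟩
  have hr0 : Tendsto (fun k : ℕ => 1 / ((k : ℝ) + 1)) atTop (𝓝 0) :=
    tendsto_one_div_add_atTop_nhds_zero_nat
  let bump : ∀ (k : ℕ) (a : ℝ), ContDiffBump a := fun k a => ⟨_, _, (hr k).1, (hr k).2⟩
  let f : ℕ → ℝ → Vec n := fun k =>
    MeasureTheory.convolution ((bump k 0).normed volume) w (ContinuousLinearMap.lsmul ℝ ℝ) volume
  have hf1 : ∀ k, ContDiff ℝ 1 (f k) := fun k =>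
    (bump k 0).hasCompactSupport_normed.contDiff_convolution_left _
      (bump k 0).contDiff_normed hloc
  have hfC : ∀ k ξ, ‖f k ξ‖ ≤ 3 * C := fun k ξ => by
    have h1 := (bump k 0).dist_normed_convolution_le (μ := volume) (x₀ := ξ) (ε := 2 * C) hmeas
      fun y _ => (dist_le_norm_add_norm _ _).trans (by linarith [hwC y, hwC ξ])
    rw [dist_eq_norm] at h1
    have h2 : ‖f k ξ‖ ≤ ‖f k ξ - w ξ‖ + ‖w ξ‖ := by
      simpa using norm_add_le (f k ξ - w ξ) (w ξ)
    linarith [hwC ξ]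
  have hflim : ∀ᵐ ξ, Tendsto (fun k => f k ξ) atTop (𝓝 (w ξ)) := by
    refine ContDiffBump.ae_convolution_tendsto_right_of_locallyIntegrable (K := 2) (φ := fun k =>
      bump k 0) hr0 (Eventually.of_forall fun k => ?_) hloc
    simp only [bump]
    field_simp
    norm_num
  set B : Finset ℝ := insert 0 A with hB
  obtain ⟨V, hV, hVB⟩ := exists_contDiff_interpolation B (fun a => if a = 0 then z else w a)
  obtain ⟨CV, hCV⟩ := (isCompact_Icc (a := -D.h) (b := 0)).exists_bound_of_continuousOn
    hV.continuous.continuousOn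
  let χ : ℕ → ℝ → ℝ := fun k ξ => 1 - ∏ a ∈ B, (1 - bump k a ξ)
  have hχ1 : ∀ k, ContDiff ℝ 1 (χ k) := fun k =>
    contDiff_const.sub (contDiff_prod fun a _ => contDiff_const.sub (bump k a).contDiff)
  have hχ01 : ∀ k ξ, χ k ξ ∈ Icc (0 : ℝ) 1 := fun k ξ => by
    have h0 : ∀ a ∈ B, 0 ≤ 1 - bump k a ξ := fun a _ => by linarith [(bump k a).le_one (x := ξ)]
    have h1 : ∀ a ∈ B, 1 - bump k a ξ ≤ 1 := fun a _ => by linarith [(bump k a).nonneg (x := ξ)]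
    exact ⟨by linarith [Finset.prod_le_one h0 h1], by linarith [Finset.prod_nonneg h0]⟩
  have hχB : ∀ k, ∀ a ∈ B, χ k a = 1 := fun k a ha => by
    simp only [χ]
    rw [Finset.prod_eq_zero ha, sub_zero]
    rw [(bump k a).one_of_mem_closedBall (Metric.mem_closedBall_self (bump k a).rIn_pos.le),
      sub_self]
  have hχlim : ∀ ξ ∉ B, ∀ᶠ k in atTop, χ k ξ = 0 := fun ξ hξ => by
    have : ∀ a ∈ B, ∀ᶠ k in atTop, bump k a ξ = 0 := fun a ha => by
      have hd : 0 < dist ξ a := dist_pos.2 fun h => hξ (h ▸ ha)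
      filter_upwards [hr0.eventually (gt_mem_nhds hd)] with k hk
      exact (bump k a).zero_of_le_dist hk.le
    filter_upwards [(Filter.eventually_all_finset B).2 this] with k hk
    simp only [χ]
    rw [Finset.prod_eq_one fun a ha => by rw [hk a ha, sub_zero], sub_self]
  let u : ℕ → ℝ → Vec n := fun k ξ => f k ξ + χ k ξ • (V ξ - f k ξ)
  have hu : ∀ k, ContDiff ℝ 1 (u k) := fun k =>
    (hf1 k).add ((hχ1 k).smul (hV.sub (hf1 k)))
  have huB : ∀ k, ∀ a ∈ B, u k a = if a = 0 then z else w a := fun k a ha => by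
    simp only [u, hχB k a ha, one_smul]
    rw [hVB a ha]; abel
  refine ⟨3 * C + (CV + 3 * C), fun k => (Ico (-D.h) 0).indicator (u k),
    fun k => indicator_mem_C1 hh.le (hu k), fun k => ?_, fun k a ha => ?_, fun k ξ => ?_, ?_⟩
  · rw [atZero_indicator hh (hu k).continuous, huB k 0 (by simp [hB])]
    simp
  · beta_reduce
    rw [indicator_of_mem (hA a ha), huB k a (by simp [hB, ha]), if_neg (hA a ha).2.ne]
  · beta_reduce
    have h0 : 0 ≤ CV := (norm_nonneg _).trans (hCV 0 ⟨by linarith, le_rfl⟩)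
    by_cases hξ : ξ ∈ Ico (-D.h) 0
    · rw [indicator_of_mem hξ]
      refine (norm_add_le _ _).trans (add_le_add (hfC k ξ) ?_)
      rw [norm_smul, Real.norm_of_nonneg (hχ01 k ξ).1]
      refine (mul_le_of_le_one_left (norm_nonneg _) (hχ01 k ξ).2).trans ?_
      exact (norm_sub_le _ _).trans
        (add_le_add (hCV ξ (Ico_subset_Icc_self hξ)) (hfC k ξ))
    · rw [indicator_of_notMem hξ, norm_zero]
      positivity
  · have hnB : ∀ᵐ ξ : ℝ, ξ ∉ B := by
      have := (B.finite_toSet.measure_zero volume)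
      exact measure_eq_zero_iff_ae_notMem.1 this
    filter_upwards [hflim, hnB] with ξ hξ hξB
    by_cases hmem : ξ ∈ Ico (-D.h) 0
    · simp only [indicator_of_mem hmem]
      refine hξ.congr' ?_
      filter_upwards [hχlim ξ hξB] with k hk
      simp [u, hk]
    · simp only [indicator_of_notMem hmem, hw.2 ξ hmem]
      exact tendsto_const_nhds

end Problem

end NeutralHJ

/-! ### Continuity of the functional along histories -/

namespace NeutralHJ

variable {n : ℕ}

/-- A piecewise Lipschitz function is continuous at all but finitely many points. -/
theorem PiecewiseLip.exists_finset_continuousAt {x : ℝ → Vec n} {a b : ℝ}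
    (hx : PiecewiseLip x a b) : ∃ S : Finset ℝ, ∀ t ∈ Ioo a b, t ∉ S → ContinuousAt x t := by
  classical
  refine hx.induction_on (Q := fun b => ∃ S : Finset ℝ, ∀ t ∈ Ioo a b, t ∉ S → ContinuousAt x t)
    ⟨∅, by simp⟩ ?_
  rintro c d - - - ⟨S, hS⟩ ⟨K, hK⟩
  refine ⟨insert c S, fun t ht htS => ?_⟩
  rw [Finset.mem_insert, not_or] at htS
  rcases lt_or_gt_of_ne htS.1 with h | h
  · exact hS t ⟨ht.1, h⟩ htS.2
  · exact hK.continuousOn.continuousAt (Ico_mem_nhds h ht.2)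

namespace Problem

variable {D : Problem n} {φ : ℝ → Vec n → (ℝ → Vec n) → ℝ}

theorem ceil_div_sub_one {i : ℕ} {t : ℝ} (hh : 0 < D.h) (ht : t ∈ Ioc (i * D.h) ((i + 1) * D.h)) :
    ⌈t / D.h⌉ - 1 = (i : ℤ) := by
  have : ⌈t / D.h⌉ = (i : ℤ) + 1 := by
    rw [Int.ceil_eq_iff]
    push_cast
    rw [lt_div_iff₀ hh, div_le_iff₀ hh]
    exact ⟨by linarith [ht.1], ht.2⟩
  rw [this]; ring

theorem upsilon_eq {i : ℕ} {t : ℝ} (hh : 0 < D.h) (ht : t ∈ Ioc (i * D.h) ((i + 1) * D.h))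
    (z : Vec n) (w : ℝ → Vec n) :
    D.upsilon t z w = ‖z‖ + D.norm1 w + ‖w (-D.h)‖ + ‖w (i * D.h - t)‖ := by
  rw [upsilon, ceil_div_sub_one hh ht, Int.cast_natCast]

/-- The intermediate point at which `υ` evaluates the history lies in `[-h, 0)`. -/
theorem ceil_point_mem (hh : 0 < D.h) (t : ℝ) :
    ((⌈t / D.h⌉ - 1 : ℤ) : ℝ) * D.h - t ∈ Ico (-D.h) 0 := by
  push_cast
  constructor
  · have := (div_le_iff₀ hh).1 (Int.le_ceil (t / D.h))
    linarith
  · have := (lt_div_iff₀ hh).1 (sub_lt_iff_lt_add.2 (Int.ceil_lt_add_one (t / D.h)))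
    linarith

theorem norm1_nonneg (hh : 0 ≤ D.h) (w : ℝ → Vec n) : 0 ≤ D.norm1 w :=
  intervalIntegral.integral_nonneg (by linarith) fun _ _ => norm_nonneg _

theorem upsilon_nonneg (hh : 0 ≤ D.h) (t : ℝ) (z : Vec n) (w : ℝ → Vec n) :
    0 ≤ D.upsilon t z w := by
  have := norm1_nonneg (D := D) hh w
  rw [upsilon]; positivity

theorem norm1_le (hh : 0 ≤ D.h) {w : ℝ → Vec n} {C : ℝ} (hw : ∀ ξ ∈ Ico (-D.h) 0, ‖w ξ‖ ≤ C) :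
    D.norm1 w ≤ D.h * C := by
  have h1 : ∀ᵐ ξ : ℝ, ξ ≠ 0 := by simp [ae_iff, measure_singleton]
  have := intervalIntegral.norm_integral_le_of_norm_le_const_ae (a := -D.h) (b := 0) (C := C)
    (f := fun ξ => ‖w ξ‖) (by
      filter_upwards [h1] with ξ hξ hmem
      rw [uIoc_of_le (by linarith)] at hmem
      rw [norm_norm]
      exact hw ξ ⟨hmem.1.le, lt_of_le_of_ne hmem.2 hξ⟩)
  rw [zero_sub, neg_neg, abs_of_nonneg hh, mul_comm] at this
  exact (le_abs_self _).trans this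

theorem upsilon_le (hh : 0 < D.h) (t : ℝ) {z : Vec n} {w : ℝ → Vec n} {C : ℝ}
    (hz : ‖z‖ ≤ C) (hw : ∀ ξ ∈ Ico (-D.h) 0, ‖w ξ‖ ≤ C) :
    D.upsilon t z w ≤ (3 + D.h) * C := by
  rw [upsilon]
  have h1 := norm1_le hh.le hw
  have h2 := hw (-D.h) ⟨le_rfl, by linarith⟩
  have h3 := hw _ (ceil_point_mem hh t)
  linarith

theorem PLip_sub {w w' : ℝ → Vec n} (hw : w ∈ D.PLip) (hw' : w' ∈ D.PLip) : w - w' ∈ D.PLip :=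
  ⟨hw.1.sub hw'.1, fun ξ hξ => by simp [hw.2 ξ hξ, hw'.2 ξ hξ]⟩

theorem intervalIntegrable_norm {w : ℝ → Vec n} (hw : w ∈ D.PLip) (a b : ℝ)
    (hab : a ≤ b) : IntervalIntegrable (fun ξ => ‖w ξ‖) volume a b := by
  obtain ⟨C, hC, hwC⟩ := exists_bound_of_mem_PLip hw
  exact (intervalIntegrable_of_bound hab (aestronglyMeasurable_of_mem_PLip hw).restrict
    fun t _ => hwC t).norm

theorem norm1_sub_le (hh : 0 ≤ D.h) {u v w : ℝ → Vec n} (hu : u ∈ D.PLip) (hv : v ∈ D.PLip)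
    (hw : w ∈ D.PLip) : D.norm1 (u - w) ≤ D.norm1 (u - v) + D.norm1 (v - w) := by
  have h0 : -D.h ≤ 0 := by linarith
  rw [norm1, norm1, norm1, ← intervalIntegral.integral_add
    (intervalIntegrable_norm (PLip_sub hu hv) _ _ h0)
    (intervalIntegrable_norm (PLip_sub hv hw) _ _ h0)]
  refine intervalIntegral.integral_mono_on h0
    (intervalIntegrable_norm (PLip_sub hu hw) _ _ h0)
    ((intervalIntegrable_norm (PLip_sub hu hv) _ _ h0).add
      (intervalIntegrable_norm (PLip_sub hv hw) _ _ h0)) fun ξ _ => ?_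
  exact norm_sub_le_norm_sub_add_norm_sub _ _ _

/-- Bounded almost everywhere convergence of histories implies convergence in `‖·‖₁`. -/
theorem tendsto_norm1_sub {ι : Type*} {l : Filter ι} [l.IsCountablyGenerated] (hh : 0 ≤ D.h)
    {W : ι → ℝ → Vec n} {w : ℝ → Vec n} (hW : ∀ᶠ i in l, W i ∈ D.PLip) (hw : w ∈ D.PLip) {C : ℝ}
    (hC : ∀ᶠ i in l, ∀ ξ ∈ Ico (-D.h) 0, ‖W i ξ‖ ≤ C)
    (hlim : ∀ᵐ ξ, ξ ∈ Ico (-D.h) 0 → Tendsto (fun i => W i ξ) l (𝓝 (w ξ))) :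
    Tendsto (fun i => D.norm1 (W i - w)) l (𝓝 0) := by
  obtain ⟨C', hC', hwC'⟩ := exists_bound_of_mem_PLip hw
  have h0 : -D.h ≤ 0 := by linarith
  have h1 : ∀ᵐ ξ : ℝ, ξ ≠ 0 := by simp [ae_iff, measure_singleton]
  have hIoc : ∀ ξ ∈ uIoc (-D.h) 0, ξ ≠ 0 → ξ ∈ Ico (-D.h) 0 := fun ξ hξ hne => by
    rw [uIoc_of_le h0] at hξ
    exact ⟨hξ.1.le, lt_of_le_of_ne hξ.2 hne⟩
  have := intervalIntegral.tendsto_integral_filter_of_dominated_convergence (μ := volume)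
    (a := -D.h) (b := 0) (F := fun i ξ => ‖(W i - w) ξ‖) (f := fun _ => (0 : ℝ)) (l := l)
    (fun _ => C + C') ?_ ?_ ?_ ?_
  · simpa [norm1] using this
  · filter_upwards [hW] with i hi
    exact (aestronglyMeasurable_of_mem_PLip (PLip_sub hi hw)).restrict.norm
  · filter_upwards [hC] with i hi
    filter_upwards [h1] with ξ hξ hmem
    rw [norm_norm]
    exact (norm_sub_le _ _).trans (add_le_add (hi ξ (hIoc ξ hmem hξ)) (hwC' ξ))
  · exact intervalIntegrable_const
  · filter_upwards [h1, hlim] with ξ hξ hl hmem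
    have := (hl (hIoc ξ hmem hξ)).sub_const (w ξ)
    simpa using this.norm

theorem Phi2.tendsto_sub (h : D.Phi2 φ) {ι : Type*} {l : Filter ι} {t : ι → ℝ}
    {z z' : ι → Vec n} {w w' : ι → ℝ → Vec n} {C : ℝ} (ht : ∀ᶠ i in l, t i ∈ Icc 0 D.ϑ)
    (h1 : ∀ᶠ i in l, (z i, w i) ∈ D.P C) (h2 : ∀ᶠ i in l, (z' i, w' i) ∈ D.P C)
    (hu : Tendsto (fun i => D.upsilon (t i) (z i - z' i) (w i - w' i)) l (𝓝 0)) :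
    Tendsto (fun i => φ (t i) (z i) (w i) - φ (t i) (z' i) (w' i)) l (𝓝 0) := by
  obtain ⟨lam, hlam, hL⟩ := h (max C 1) (by positivity)
  have hP : ∀ q, q ∈ D.P C → q ∈ D.P (max C 1) := fun q hq =>
    ⟨hq.1, hq.2.1.trans (le_max_left _ _), fun ξ hξ => (hq.2.2 ξ hξ).trans (le_max_left _ _)⟩
  rw [tendsto_zero_iff_norm_tendsto_zero]
  have h3 : Tendsto (fun i => lam * D.upsilon (t i) (z i - z' i) (w i - w' i)) l (𝓝 0) := by
    simpa using hu.const_mul lam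
  refine squeeze_zero' (Eventually.of_forall fun i => norm_nonneg _) ?_ h3
  filter_upwards [ht, h1, h2] with i hi h1i h2i
  exact hL (t i) hi _ _ _ _ (hP _ h1i) (hP _ h2i)

/-- Continuity of `φ` at a fixed time. -/
theorem Phi2.tendsto (h : D.Phi2 φ) (hh : 0 < D.h) {ι : Type*} {l : Filter ι}
    [l.IsCountablyGenerated] [l.NeBot] {t : ℝ} {Z : ι → Vec n}
    {W : ι → ℝ → Vec n} {z : Vec n} {w : ℝ → Vec n} {C : ℝ} (ht : t ∈ Icc 0 D.ϑ)
    (hW : ∀ i, W i ∈ D.PLip) (hw : w ∈ D.PLip)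
    (hC : ∀ i, ∀ ξ ∈ Ico (-D.h) 0, ‖W i ξ‖ ≤ C) (hZ : Tendsto Z l (𝓝 z))
    (hlim : ∀ᵐ ξ, ξ ∈ Ico (-D.h) 0 → Tendsto (fun i => W i ξ) l (𝓝 (w ξ)))
    (hlim1 : Tendsto (fun i => W i (-D.h)) l (𝓝 (w (-D.h))))
    (hlim2 : Tendsto (fun i => W i (((⌈t / D.h⌉ - 1 : ℤ) : ℝ) * D.h - t)) l
      (𝓝 (w (((⌈t / D.h⌉ - 1 : ℤ) : ℝ) * D.h - t)))) :
    Tendsto (fun i => φ t (Z i) (W i)) l (𝓝 (φ t z w)) := by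
  obtain ⟨C', hC', hwC'⟩ := exists_bound_of_mem_PLip hw
  set M := max (‖z‖ + 1) (max C C') with hM
  have hb : ∀ᶠ i in l, ‖Z i‖ < ‖z‖ + 1 := hZ.norm.eventually (gt_mem_nhds (by linarith))
  have := h.tendsto_sub (t := fun _ : ι => t) (z := Z) (z' := fun _ => z) (w := W)
    (w' := fun _ => w) (C := M) (l := l) (Eventually.of_forall fun _ => ht) ?_ ?_ ?_
  · simpa using this.add_const (φ t z w)
  · filter_upwards [hb] with i hi
    exact ⟨hW i, hi.le.trans (le_max_left _ _), fun ξ hξ =>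
      (hC i ξ hξ).trans ((le_max_left _ _).trans (le_max_right _ _))⟩
  · exact Eventually.of_forall fun _ => ⟨hw, (by linarith : ‖z‖ ≤ ‖z‖ + 1).trans (le_max_left _ _),
      fun ξ _ => (hwC' ξ).trans ((le_max_right _ _).trans (le_max_right _ _))⟩
  · have e1 : Tendsto (fun i => ‖Z i - z‖) l (𝓝 0) := by
      simpa using (hZ.sub_const z).norm
    have e2 := tendsto_norm1_sub hh.le (Eventually.of_forall hW) hw (Eventually.of_forall hC) hlim
    have e3 : Tendsto (fun i => ‖(W i - w) (-D.h)‖) l (𝓝 0) := by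
      simpa using (hlim1.sub_const (w (-D.h))).norm
    have e4 : Tendsto (fun i => ‖(W i - w) (((⌈t / D.h⌉ - 1 : ℤ) : ℝ) * D.h - t)‖) l (𝓝 0) := by
      have := (hlim2.sub_const (w (((⌈t / D.h⌉ - 1 : ℤ) : ℝ) * D.h - t))).norm
      rw [sub_self, norm_zero] at this
      exact this
    have := ((e1.add e2).add e3).add e4
    simp only [add_zero] at this
    exact this

/-- Along a Lipschitz continuous function the functional is continuous in time. -/
theorem continuousOn_along_lipschitz (hD : D.Admissible) (h1 : D.Phi1 φ) (h2 : D.Phi2 φ)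
    {x : ℝ → Vec n} {K : ℝ≥0} {τ T : ℝ} (hτ : 0 ≤ τ) (hT : T ≤ D.ϑ)
    (hx : LipschitzOnWith K x (Icc (τ - D.h) T)) :
    ContinuousOn (fun t => φ t (x t) (D.seg x t)) (Icc τ T) := by
  have hh := hD.h_pos
  intro t₀ ht₀
  have hPL : PiecewiseLip x (τ - D.h) T :=
    .of_lipschitzOnWith (by linarith [ht₀.1, ht₀.2]) (hx.mono Ico_subset_Icc_self)
  obtain ⟨C, hC, hxC⟩ := hPL.exists_bound_Icc
  have hseg : ∀ t ∈ Icc τ T, (x t, D.seg x t) ∈ D.P C := fun t ht =>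
    ⟨seg_mem_PLip hh.le hPL (by linarith [ht.1]) ht.2, hxC t ⟨by linarith [ht.1], ht.2⟩,
      fun ξ hξ => by
        change ‖D.seg x t ξ‖ ≤ C
        rw [seg_apply hξ]; exact hxC _ ⟨by linarith [ht.1, hξ.1], by linarith [ht.2, hξ.2]⟩⟩
  have hu : D.seg x t₀ ∈ D.Lip := by
    refine ⟨(hseg t₀ ht₀).1, K, fun s hs t ht => ?_⟩
    rw [seg_apply hs, seg_apply ht]
    have := hx (x := t₀ + s) ⟨by linarith [ht₀.1, hs.1], by linarith [ht₀.2, hs.2]⟩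
      (y := t₀ + t) ⟨by linarith [ht₀.1, ht.1], by linarith [ht₀.2, ht.2]⟩
    simpa [edist_dist, Real.dist_eq] using this
  have hz : atZero (D.seg x t₀) = x t₀ := by
    refine atZero_eq_of_tendsto ?_
    have h3 : Tendsto (fun ξ : ℝ => t₀ + ξ) (𝓝[<] 0) (𝓝[Icc (τ - D.h) T] t₀) := by
      refine tendsto_nhdsWithin_iff.2 ⟨?_, ?_⟩
      · have : Tendsto (fun ξ : ℝ => t₀ + ξ) (𝓝 0) (𝓝 (t₀ + 0)) :=
          (continuous_const.add continuous_id).tendsto 0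
        rw [add_zero] at this
        exact this.mono_left inf_le_left
      · filter_upwards [Ioo_mem_nhdsLT (show -D.h < 0 by linarith)] with ξ hξ
        exact ⟨by linarith [ht₀.1, hξ.1], by linarith [ht₀.2, hξ.2]⟩
    refine ((hx.continuousOn t₀ ⟨by linarith [ht₀.1], ht₀.2⟩).tendsto.comp h3).congr' ?_
    filter_upwards [Ioo_mem_nhdsLT (show -D.h < 0 by linarith)] with ξ hξ
    exact (seg_apply (Ioo_subset_Ico_self hξ)).symm
  have hc := h1 0 ⟨le_rfl, hD.ϑ_pos.le⟩ _ hu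
  rw [hz] at hc
  have hc' : Tendsto (fun t => φ t (x t₀) (D.seg x t₀)) (𝓝[Icc τ T] t₀)
      (𝓝 (φ t₀ (x t₀) (D.seg x t₀))) :=
    (hc t₀ ⟨by linarith [ht₀.1], by linarith [ht₀.2]⟩).mono_left
      (nhdsWithin_mono _ (Icc_subset_Icc hτ hT))
  have hd := h2.tendsto_sub (l := 𝓝[Icc τ T] t₀) (t := fun t => t) (z := x)
    (z' := fun _ => x t₀) (w := fun t => D.seg x t) (w' := fun _ => D.seg x t₀) (C := C) ?_ ?_ ?_ ?_
  · have := hd.add hc'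
    simp only [sub_add_cancel, zero_add] at this
    exact this
  · filter_upwards [self_mem_nhdsWithin] with t ht
    exact ⟨hτ.trans ht.1, ht.2.trans hT⟩
  · filter_upwards [self_mem_nhdsWithin] with t ht using hseg t ht
  · exact Eventually.of_forall fun _ => hseg t₀ ht₀
  · have hlim : Tendsto (fun t => (3 + D.h) * (K * |t - t₀|)) (𝓝[Icc τ T] t₀) (𝓝 0) := by
      have : Continuous fun t : ℝ => (3 + D.h) * (K * |t - t₀|) := by fun_prop
      have := this.tendsto t₀
      simp only [sub_self, abs_zero, mul_zero] at this
      exact this.mono_left inf_le_left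
    refine squeeze_zero' (Eventually.of_forall fun t => upsilon_nonneg hh.le _ _ _) ?_ hlim
    filter_upwards [self_mem_nhdsWithin] with t ht
    refine upsilon_le hh t ?_ fun ξ hξ => ?_
    · exact hx.norm_sub_le ⟨by linarith [ht.1], ht.2⟩ ⟨by linarith [ht₀.1], ht₀.2⟩
    · rw [Pi.sub_apply, seg_apply hξ, seg_apply hξ]
      have := hx.norm_sub_le (x := t + ξ) ⟨by linarith [ht.1, hξ.1], by linarith [ht.2, hξ.2]⟩
        (y := t₀ + ξ) ⟨by linarith [ht₀.1, hξ.1], by linarith [ht₀.2, hξ.2]⟩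
      simpa using this

/-- Segments depend continuously on time in `‖·‖₁`. -/
theorem tendsto_norm1_seg_sub (hD : D.Admissible) {x : ℝ → Vec n} {τ T t₀ : ℝ}
    (hx : PiecewiseLip x (τ - D.h) T) (ht₀ : t₀ ∈ Icc τ T) :
    Tendsto (fun t => D.norm1 (D.seg x t - D.seg x t₀)) (𝓝[Icc τ T] t₀) (𝓝 0) := by
  have hh := hD.h_pos
  obtain ⟨C, hC, hxC⟩ := hx.exists_bound_Icc
  obtain ⟨S, hS⟩ := hx.exists_finset_continuousAt
  refine tendsto_norm1_sub hh.le (C := C) ?_ (seg_mem_PLip hh.le hx (by linarith [ht₀.1]) ht₀.2)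
    ?_ ?_
  · filter_upwards [self_mem_nhdsWithin] with t ht
    exact seg_mem_PLip hh.le hx (by linarith [ht.1]) ht.2
  · filter_upwards [self_mem_nhdsWithin] with t ht ξ hξ
    rw [seg_apply hξ]
    exact hxC _ ⟨by linarith [ht.1, hξ.1], by linarith [ht.2, hξ.2]⟩
  · have h1 : ∀ᵐ ξ : ℝ, ξ ≠ -D.h := by simp [ae_iff, measure_singleton]
    have h2 : ∀ᵐ ξ : ℝ, ξ ∉ (fun s => s - t₀) '' (S : Set ℝ) :=
      measure_eq_zero_iff_ae_notMem.1 ((S.finite_toSet.image _).measure_zero volume)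
    filter_upwards [h1, h2] with ξ hξ1 hξ2 hξ
    have h3 : -D.h < ξ := lt_of_le_of_ne hξ.1 (Ne.symm hξ1)
    have h4 : ContinuousAt x (t₀ + ξ) := by
      refine hS _ ⟨by linarith [ht₀.1], by linarith [ht₀.2, hξ.2]⟩ fun h => hξ2 ⟨_, h, by ring⟩
    simp only [seg_apply hξ]
    have h5 : Tendsto (fun t : ℝ => t + ξ) (𝓝[Icc τ T] t₀) (𝓝 (t₀ + ξ)) :=
      ((continuous_id.add continuous_const).tendsto t₀).mono_left inf_le_left
    exact h4.tendsto.comp h5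

/-- Joint continuity of `(t, x) ↦ φ(t, x, X_t)` on a time interval inside `(i h, (i + 1) h]` on
which the delayed values of `X` are continuous. -/
theorem continuousOn_state_along_history (hD : D.Admissible) (h1 : D.Phi1 φ) (h2 : D.Phi2 φ)
    {X : ℝ → Vec n} {i : ℕ} {a b T : ℝ} (hb : b ≤ T) (hT : T ≤ D.ϑ) (hX : PiecewiseLip X (a - D.h) T)
    (hab : Icc a b ⊆ Ioc (i * D.h) ((i + 1) * D.h))
    (hXc : ContinuousOn (fun t => X (t - D.h)) (Icc a b)) :
    ContinuousOn (fun q : ℝ × Vec n => φ q.1 q.2 (D.seg X q.1)) (Icc a b ×ˢ univ) := by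
  have hh := hD.h_pos
  rintro ⟨t₀, x₀⟩ ⟨ht₀, -⟩
  simp only at ht₀
  have ha : 0 ≤ a := by
    have := (hab ⟨le_rfl, ht₀.1.trans ht₀.2⟩).1
    exact le_trans (by positivity) this.le
  obtain ⟨C, hC, hXC⟩ := hX.exists_bound_Icc
  have hsegP : ∀ t ∈ Icc a b, D.seg X t ∈ D.PLip := fun t ht =>
    seg_mem_PLip hh.le hX (by linarith [ht.1]) (ht.2.trans hb)
  have hsegC : ∀ t ∈ Icc a b, ∀ ξ ∈ Ico (-D.h) 0, ‖D.seg X t ξ‖ ≤ C := fun t ht ξ hξ => by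
    rw [seg_apply hξ]; exact hXC _ ⟨by linarith [ht.1, hξ.1], by linarith [ht.2, hξ.2]⟩
  have hpt : ∀ t ∈ Icc a b, (i : ℝ) * D.h - t ∈ Ico (-D.h) 0 := fun t ht =>
    ⟨by linarith [(hab ht).2], by linarith [(hab ht).1]⟩
  have hhpt : -D.h ∈ Ico (-D.h) 0 := ⟨le_rfl, by linarith⟩
  -- a smooth approximation `W` of the history at time `t₀`
  obtain ⟨CW, W, hW1, hWz, hWA, hWC, hWlim⟩ := exists_C1_approx hh (hsegP t₀ ht₀) x₀
    (A := {-D.h, i * D.h - t₀}) (by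
      intro c hc
      rw [Finset.mem_insert, Finset.mem_singleton] at hc
      rcases hc with rfl | rfl
      exacts [hhpt, hpt t₀ ht₀])
  have hWP : ∀ k, W k ∈ D.PLip := fun k => (hW1 k).1.1
  have hW0 := tendsto_norm1_sub hh.le (l := atTop) (Eventually.of_forall hWP) (hsegP t₀ ht₀)
    (Eventually.of_forall fun k ξ _ => hWC k ξ) (hWlim.mono fun ξ h _ => h)
  set M := max (‖x₀‖ + 1) (max C CW) with hM
  obtain ⟨lam, hlam, hlip⟩ := h2 M (lt_of_lt_of_le (by positivity) (le_max_left _ _))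
  have hWM : ∀ k, (x₀, W k) ∈ D.P M := fun k =>
    ⟨hWP k, (by linarith : ‖x₀‖ ≤ ‖x₀‖ + 1).trans (le_max_left _ _), fun ξ _ =>
      (hWC k ξ).trans ((le_max_right _ _).trans (le_max_right _ _))⟩
  have hsegM : ∀ t ∈ Icc a b, ∀ x, ‖x‖ ≤ ‖x₀‖ + 1 → (x, D.seg X t) ∈ D.P M := fun t ht x hx =>
    ⟨hsegP t ht, hx.trans (le_max_left _ _), fun ξ hξ =>
      (hsegC t ht ξ hξ).trans ((le_max_left _ _).trans (le_max_right _ _))⟩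
  rw [ContinuousWithinAt, Metric.tendsto_nhds]
  intro ε hε
  obtain ⟨k, hk⟩ := (hW0.eventually (gt_mem_nhds (show 0 < ε / (6 * lam) by positivity))).exists
  have hk' : lam * D.norm1 (W k - D.seg X t₀) < ε / 6 := by
    have := mul_lt_mul_of_pos_left hk hlam
    rwa [show lam * (ε / (6 * lam)) = ε / 6 by field_simp] at this
  have hϑ : ∀ t ∈ Icc a b, t ∈ Icc 0 D.ϑ := fun t ht =>
    ⟨ha.trans ht.1, ht.2.trans (hb.trans hT)⟩
  have hsymm : D.norm1 (D.seg X t₀ - W k) = D.norm1 (W k - D.seg X t₀) := by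
    simp only [norm1, Pi.sub_apply]
    exact intervalIntegral.integral_congr fun ξ _ => norm_sub_rev _ _
  have hWh : W k (-D.h) = X (t₀ - D.h) := by
    rw [hWA k (-D.h) (by simp), seg_apply hhpt, ← sub_eq_add_neg]
  have hWi : W k (i * D.h - t₀) = X (i * D.h) := by
    rw [hWA k _ (by simp), seg_apply (hpt t₀ ht₀)]; congr 1; ring
  -- the distance of the values at `(t, x)` and `(t₀, x₀)` is estimated through `(t, x₀, W)` and
  -- `(t₀, x₀, W)`: the outer steps use `(φ₂)`, the middle one uses `(φ₁)`
  have d3 : |φ t₀ x₀ (W k) - φ t₀ x₀ (D.seg X t₀)| < ε / 6 := by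
    refine (hlip t₀ (hϑ t₀ ht₀) _ _ _ _ (hWM k) (hsegM t₀ ht₀ x₀ (by linarith))).trans_lt ?_
    rw [upsilon_eq hh (hab ht₀)]
    simp only [Pi.sub_apply, sub_self, norm_zero, zero_add]
    rw [hWh, hWi, seg_apply hhpt, seg_apply (hpt t₀ ht₀)]
    simp only [← sub_eq_add_neg, add_sub_cancel, sub_self, norm_zero, add_zero]
    exact hk'
  have hfst : Tendsto (fun q : ℝ × Vec n => q.1) (𝓝[Icc a b ×ˢ univ] (t₀, x₀)) (𝓝[Icc a b] t₀) :=
    tendsto_nhdsWithin_iff.2 ⟨(continuous_fst.tendsto _).mono_left inf_le_left, by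
      filter_upwards [self_mem_nhdsWithin] with q hq using hq.1⟩
  have hsnd : Tendsto (fun q : ℝ × Vec n => q.2) (𝓝[Icc a b ×ˢ univ] (t₀, x₀)) (𝓝 x₀) :=
    (continuous_snd.tendsto _).mono_left inf_le_left
  have hc := h1 0 ⟨le_rfl, hD.ϑ_pos.le⟩ _ (hW1 k).1
  rw [hWz] at hc
  have d2 := (((hc t₀ (hϑ t₀ ht₀)).mono_left (nhdsWithin_mono _ hϑ)).comp hfst)
  rw [Metric.tendsto_nhds] at d2
  have hlim : Tendsto (fun q : ℝ × Vec n => lam * (‖q.2 - x₀‖ +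
      (D.norm1 (D.seg X q.1 - D.seg X t₀) + D.norm1 (D.seg X t₀ - W k)) +
      ‖X (q.1 - D.h) - W k (-D.h)‖ + ‖X (i * D.h) - W k (i * D.h - q.1)‖))
      (𝓝[Icc a b ×ˢ univ] (t₀, x₀)) (𝓝 (lam * (0 + (0 + D.norm1 (D.seg X t₀ - W k)) + 0 + 0))) := by
    refine Tendsto.const_mul _ (((Tendsto.add ?_ (Tendsto.add_const _ ?_)).add ?_).add ?_)
    · simpa using (hsnd.sub_const x₀).norm
    · exact ((tendsto_norm1_seg_sub hD hX ⟨ht₀.1, ht₀.2.trans hb⟩).mono_left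
        (nhdsWithin_mono _ (Icc_subset_Icc_right hb))).comp hfst
    · have h3 := (((hXc t₀ ht₀).tendsto.comp hfst).sub_const (X (t₀ - D.h))).norm
      rw [sub_self, norm_zero] at h3
      rw [hWh]
      exact h3
    · obtain ⟨K, hK⟩ := (hW1 k).1.2
      have h3 : Tendsto (fun t : ℝ => (i : ℝ) * D.h - t) (𝓝[Icc a b] t₀)
          (𝓝[Ico (-D.h) 0] (i * D.h - t₀)) :=
        tendsto_nhdsWithin_iff.2
          ⟨((continuous_const.sub continuous_id).tendsto t₀).mono_left inf_le_left, by
            filter_upwards [self_mem_nhdsWithin] with t ht using hpt t ht⟩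
      have h4 := (((hK.continuousOn _ (hpt t₀ ht₀)).tendsto.comp (h3.comp hfst)).const_sub
        (X (i * D.h))).norm
      rwa [hWi, sub_self, norm_zero] at h4
  have hlt : lam * (0 + (0 + D.norm1 (D.seg X t₀ - W k)) + 0 + 0) < ε / 6 := by
    simpa [hsymm] using hk'
  have hbd : ∀ᶠ q : ℝ × Vec n in 𝓝[Icc a b ×ˢ univ] (t₀, x₀), ‖q.2‖ < ‖x₀‖ + 1 :=
    hsnd.norm.eventually (gt_mem_nhds (by linarith))
  filter_upwards [hlim.eventually (gt_mem_nhds hlt), d2 (ε / 6) (by positivity), hbd,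
    self_mem_nhdsWithin] with q hq1 hq2 hq3 hq4
  have ht := hq4.1
  have d1 : |φ q.1 q.2 (D.seg X q.1) - φ q.1 x₀ (W k)| < ε / 6 := by
    refine (hlip q.1 (hϑ _ ht) _ _ _ _ (hsegM _ ht _ hq3.le) (hWM k)).trans_lt
      (lt_of_le_of_lt ?_ hq1)
    rw [upsilon_eq hh (hab ht)]
    have := norm1_sub_le hh.le (hsegP _ ht) (hsegP _ ht₀) (hWP k)
    simp only [Pi.sub_apply]
    rw [seg_apply hhpt, seg_apply (hpt _ ht), ← sub_eq_add_neg, add_sub_cancel]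
    gcongr
  simp only [Function.comp, Real.dist_eq] at hq2 ⊢
  have e : φ q.1 q.2 (D.seg X q.1) - φ t₀ x₀ (D.seg X t₀) =
      (φ q.1 q.2 (D.seg X q.1) - φ q.1 x₀ (W k)) + (φ q.1 x₀ (W k) - φ t₀ x₀ (W k)) +
      (φ t₀ x₀ (W k) - φ t₀ x₀ (D.seg X t₀)) := by ring
  rw [e]
  refine (abs_add_three _ _ _).trans_lt ?_
  linarith

/-- Two trajectories with a common history before `τ`, compared at a time `t > τ` in the same
interval `(i h, (i + 1) h)`: the terms of `υ` at `-h` and at `i h - t` vanish, and the integral term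
is small with `t - τ`. -/
theorem upsilon_seg_sub_le (hD : D.Admissible) {x x' : ℝ → Vec n} {i : ℕ} {τ t T M : ℝ}
    (hx : PiecewiseLip x (τ - D.h) T) (hx' : PiecewiseLip x' (τ - D.h) T)
    (heq : ∀ r ∈ Ico (τ - D.h) τ, x r = x' r) (hi : i * D.h < τ) (hτt : τ ≤ t)
    (hti : t < (i + 1) * D.h) (htT : t ≤ T) (hM : ∀ r ∈ Ico τ t, ‖x r - x' r‖ ≤ M) (v : Vec n) :
    D.upsilon t v (D.seg x t - D.seg x' t) ≤ ‖v‖ + (t - τ) * M := by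
  have hh := hD.h_pos
  rw [upsilon_eq hh ⟨hi.trans_le hτt, hti.le⟩]
  have hp1 : -D.h ∈ Ico (-D.h) 0 := ⟨le_rfl, by linarith⟩
  have hp2 : (i : ℝ) * D.h - t ∈ Ico (-D.h) 0 := ⟨by linarith, by linarith⟩
  have e1 : (D.seg x t - D.seg x' t) (-D.h) = 0 := by
    rw [Pi.sub_apply, seg_apply hp1, seg_apply hp1, sub_eq_zero]
    exact heq _ ⟨by linarith, by linarith⟩
  have e2 : (D.seg x t - D.seg x' t) (i * D.h - t) = 0 := by
    rw [Pi.sub_apply, seg_apply hp2, seg_apply hp2, sub_eq_zero]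
    exact heq _ ⟨by linarith, by linarith⟩
  rw [e1, e2, norm_zero, add_zero, add_zero]
  have hP := PLip_sub (seg_mem_PLip hh.le hx (by linarith) htT)
    (seg_mem_PLip hh.le hx' (by linarith) htT)
  have hsplit := intervalIntegral.integral_add_adjacent_intervals
    (intervalIntegrable_norm hP (-D.h) (τ - t) (by linarith))
    (intervalIntegrable_norm hP (τ - t) 0 (by linarith))
  have hz : ∫ ξ in (-D.h)..(τ - t), ‖(D.seg x t - D.seg x' t) ξ‖ = 0 := by
    have h1 : ∀ᵐ ξ : ℝ, ξ ≠ τ - t := by simp [ae_iff, measure_singleton]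
    rw [← intervalIntegral.integral_zero (a := -D.h) (b := τ - t) (μ := volume) (E := ℝ)]
    refine intervalIntegral.integral_congr_ae ?_
    filter_upwards [h1] with ξ hξ hmem
    rw [uIoc_of_le (by linarith)] at hmem
    have h2 : ξ < τ - t := lt_of_le_of_ne hmem.2 hξ
    have h3 : ξ ∈ Ico (-D.h) 0 := ⟨hmem.1.le, by linarith⟩
    rw [Pi.sub_apply, seg_apply h3, seg_apply h3, heq _ ⟨by linarith [hmem.1], by linarith⟩,
      sub_self, norm_zero]
  have hb : ∫ ξ in (τ - t)..0, ‖(D.seg x t - D.seg x' t) ξ‖ ≤ (t - τ) * M := by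
    have h1 : ∀ᵐ ξ : ℝ, ξ ≠ 0 := by simp [ae_iff, measure_singleton]
    have := intervalIntegral.norm_integral_le_of_norm_le_const_ae (a := τ - t) (b := 0) (C := M)
      (f := fun ξ => ‖(D.seg x t - D.seg x' t) ξ‖) (by
        filter_upwards [h1] with ξ hξ hmem
        rw [uIoc_of_le (by linarith)] at hmem
        have h2 : ξ < 0 := lt_of_le_of_ne hmem.2 hξ
        have h3 : ξ ∈ Ico (-D.h) 0 := ⟨by linarith [hmem.1], h2⟩
        rw [norm_norm, Pi.sub_apply, seg_apply h3, seg_apply h3]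
        exact hM _ ⟨by linarith [hmem.1], by linarith⟩)
    rw [zero_sub, neg_sub, abs_of_nonneg (by linarith), mul_comm] at this
    exact (le_abs_self _).trans this
  rw [norm1, ← hsplit, hz, zero_add]
  linarith

end Problem

end NeutralHJ

/-! ### The delayed term along trajectories -/

namespace NeutralHJ

variable {n : ℕ}

namespace Problem

variable {D : Problem n} {φ : ℝ → Vec n → (ℝ → Vec n) → ℝ}

namespace Admissible

variable (hD : D.Admissible)
include hD

theorem hasFDerivAt_g {t : ℝ} (ht : t ∈ Ioo 0 D.ϑ) (x : Vec n) :
    HasFDerivAt (fun q : ℝ × Vec n => D.g q.1 q.2)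
      (fderiv ℝ (fun q : ℝ × Vec n => D.g q.1 q.2) (t, x)) (t, x) :=
  ((hD.g_contDiff.contDiffAt (prod_mem_nhds (Icc_mem_nhds ht.1 ht.2) univ_mem)).differentiableAt
    (by simp)).hasFDerivAt

theorem dg_eq_fderiv {t : ℝ} (ht : t ∈ Ioo 0 D.ϑ) {v : ℝ → Vec n} {d : Vec n}
    (hv : HasDerivWithinAt v d (Ici (-D.h)) (-D.h)) :
    D.dg t v = fderiv ℝ (fun q : ℝ × Vec n => D.g q.1 q.2) (t, v (-D.h)) (1, d) := by
  have hgf := hD.hasFDerivAt_g ht (v (-D.h))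
  set L := fderiv ℝ (fun q : ℝ × Vec n => D.g q.1 q.2) (t, v (-D.h))
  have hp1 : derivWithin (fun t => D.g t (v (-D.h))) (Icc 0 D.ϑ) t = L (1, 0) := by
    have := HasFDerivAt.comp_hasDerivAt (f := fun t : ℝ => (t, v (-D.h))) t hgf
      ((hasDerivAt_id t).prodMk (hasDerivAt_const t _))
    rw [derivWithin_of_mem_nhds (Icc_mem_nhds ht.1 ht.2)]
    exact this.deriv
  have hp2 : ∀ u, fderiv ℝ (D.g t) (v (-D.h)) u = L (0, u) := by
    intro u
    have := HasFDerivAt.comp (f := fun x : Vec n => (t, x)) (v (-D.h)) hgf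
      ((hasFDerivAt_const t _).prodMk (hasFDerivAt_id (v (-D.h))))
    have h2 : HasFDerivAt (D.g t) _ (v (-D.h)) := this
    rw [h2.fderiv]
    simp
  rw [dg, hp1, hp2, hv.derivWithin (uniqueDiffWithinAt_Ici _), ← map_add]
  simp

/-- Along every extension of a history from `PLip_*` the delayed term has the right derivative
`∂ᶜⁱ g`. -/
theorem hasDerivWithinAt_g_delay {τ : ℝ} {z : Vec n} {w x : ℝ → Vec n}
    (hG : (τ, z, w) ∈ D.GStar) (hx : x ∈ D.Lam τ z w) :
    HasDerivWithinAt (fun t => D.g t (x (t - D.h))) (D.dg τ w) (Ici τ) τ := by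
  have hh := hD.h_pos
  have hτ := hD.mem_Ioo_of_GStar hG
  obtain ⟨-, hw, δ, hδ, hδh, hwδ⟩ := hG
  simp only at hw hwδ
  have hwd : HasDerivWithinAt w (derivWithin w (Ici (-D.h)) (-D.h)) (Ici (-D.h)) (-D.h) := by
    have h1 : DifferentiableWithinAt ℝ w (Icc (-D.h) (-D.h + δ)) (-D.h) :=
      hwδ.differentiableOn (by simp) _ ⟨le_rfl, by linarith⟩
    exact (h1.mono_of_mem_nhdsWithin (Icc_mem_nhdsGE (by linarith))).hasDerivWithinAt
  have hws : HasDerivWithinAt (fun t => x (t - D.h)) (derivWithin w (Ici (-D.h)) (-D.h))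
      (Ici τ) τ := by
    have hs : HasDerivWithinAt (fun t : ℝ => t - D.h - τ) 1 (Ici τ) τ :=
      ((hasDerivAt_id τ).sub_const _ |>.sub_const _).hasDerivWithinAt
    have := HasDerivWithinAt.scomp_of_eq τ hwd hs (fun t ht => by
      simp only [mem_Ici] at ht ⊢; linarith) (by ring)
    rw [one_smul] at this
    refine this.congr_of_eventuallyEq ?_ ?_
    · filter_upwards [Ico_mem_nhdsGE (show τ < τ + D.h by linarith)] with t ht
      exact hx.2.2 _ ⟨by linarith [ht.1], by linarith [ht.2]⟩
    · exact hx.2.2 _ ⟨le_rfl, by linarith⟩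
  rw [hD.dg_eq_fderiv hτ hwd]
  have e : x (τ - D.h) = w (-D.h) := by
    rw [hx.2.2 _ ⟨le_rfl, by linarith⟩]; congr 1; ring
  exact HasFDerivAt.comp_hasDerivWithinAt_of_eq (f := fun t => (t, x (t - D.h))) τ
    (hD.hasFDerivAt_g hτ _) ((hasDerivWithinAt_id τ _).prodMk hws) (by simp [e])

omit hD in
theorem seg_kappa_apply {τ t ξ : ℝ} {z : Vec n} {w : ℝ → Vec n} (hξ : ξ ∈ Ico (-D.h) 0)
    (ht : t + ξ < τ) : D.seg (kappa τ z w) t ξ = w (ξ + (t - τ)) := by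
  rw [seg_apply hξ, kappa, if_pos ht]; congr 1; ring

omit hD in
/-- The history of the constant extension stays in `PLip_*` for a short time. -/
theorem seg_kappa_mem_PLipStar {τ t δ : ℝ} {z : Vec n} {w : ℝ → Vec n} (hτ : τ ≤ D.ϑ)
    (hw : w ∈ D.PLip) (hδ : 0 < δ) (hδh : δ < D.h)
    (hwδ : ContDiffOn ℝ 1 w (Icc (-D.h) (-D.h + δ))) (ht : t ∈ Icc τ (τ + δ / 2)) (htϑ : t ≤ D.ϑ) :
    D.seg (kappa τ z w) t ∈ D.PLipStar := by
  refine ⟨seg_mem_PLip (by linarith) (D.kappa_mem_Lam0 hτ hw).1.1 (by linarith [ht.1]) htϑ,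
    δ / 2, by linarith, by linarith, ?_⟩
  have h1 : ContDiffOn ℝ 1 (fun ξ => w (ξ + (t - τ))) (Icc (-D.h) (-D.h + δ / 2)) :=
    hwδ.comp (f := fun ξ => ξ + (t - τ)) (by fun_prop) fun ξ hξ =>
      ⟨by linarith [hξ.1, ht.1], by linarith [hξ.2, ht.2]⟩
  refine h1.congr fun ξ hξ => ?_
  exact seg_kappa_apply ⟨hξ.1, by linarith [hξ.2]⟩ (by linarith [hξ.2, ht.2])

theorem tendsto_dg_seg_kappa {τ : ℝ} {z : Vec n} {w : ℝ → Vec n} (hG : (τ, z, w) ∈ D.GStar) :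
    Tendsto (fun t => D.dg t (D.seg (kappa τ z w) t)) (𝓝[≥] τ) (𝓝 (D.dg τ w)) := by
  have hh := hD.h_pos
  have hτ := hD.mem_Ioo_of_GStar hG
  obtain ⟨-, hw, δ, hδ, hδh, hwδ⟩ := hG
  simp only at hw hwδ
  set w' := derivWithin w (Icc (-D.h) (-D.h + δ)) with hw'
  have hder : ∀ ξ ∈ Ico (-D.h) (-D.h + δ), HasDerivWithinAt w (w' ξ) (Ici ξ) ξ := fun ξ hξ => by
    have h1 : HasDerivWithinAt w (w' ξ) (Icc (-D.h) (-D.h + δ)) ξ :=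
      (hwδ.differentiableOn (by simp) _ ⟨hξ.1, hξ.2.le⟩).hasDerivWithinAt
    exact h1.mono_of_mem_nhdsWithin (mem_of_superset (Icc_mem_nhdsGE hξ.2)
      (Icc_subset_Icc_left hξ.1))
  have hmem : ∀ t ∈ Ico τ (τ + δ / 2), t - τ - D.h ∈ Ico (-D.h) (-D.h + δ) := fun t ht =>
    ⟨by linarith [ht.1], by linarith [ht.2]⟩
  have hseg : ∀ t ∈ Ico τ (τ + δ / 2), HasDerivWithinAt (D.seg (kappa τ z w) t)
      (w' (t - τ - D.h)) (Ici (-D.h)) (-D.h) := fun t ht => by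
    have hs : HasDerivWithinAt (fun ξ : ℝ => ξ + (t - τ)) 1 (Ici (-D.h)) (-D.h) :=
      ((hasDerivAt_id (-D.h)).add_const _).hasDerivWithinAt
    have := HasDerivWithinAt.scomp_of_eq (-D.h) (hder _ (hmem t ht)) hs (fun ξ hξ => by
      simp only [mem_Ici] at hξ ⊢; linarith) (by ring)
    rw [one_smul] at this
    refine this.congr_of_eventuallyEq ?_ ?_
    · filter_upwards [Ico_mem_nhdsGE (show -D.h < -D.h + δ / 2 by linarith)] with ξ hξ
      exact seg_kappa_apply ⟨hξ.1, by linarith [hξ.2]⟩ (by linarith [hξ.2, ht.2])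
    · exact seg_kappa_apply ⟨le_rfl, by linarith⟩ (by linarith [ht.2])
  have hval : ∀ t ∈ Ico τ (τ + δ / 2), D.seg (kappa τ z w) t (-D.h) = w (t - τ - D.h) :=
    fun t ht => by
      rw [seg_kappa_apply ⟨le_rfl, by linarith⟩ (by linarith [ht.2])]; congr 1; ring
  have hwd : HasDerivWithinAt w (w' (-D.h)) (Ici (-D.h)) (-D.h) :=
    hder _ ⟨le_rfl, by linarith⟩
  rw [hD.dg_eq_fderiv hτ hwd]
  have hev : ∀ᶠ t in 𝓝[≥] τ, t ∈ Ico τ (τ + δ / 2) := Ico_mem_nhdsGE (by linarith)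
  have hev2 : ∀ᶠ t in 𝓝[≥] τ, t < D.ϑ :=
    eventually_nhdsWithin_of_eventually_nhds (gt_mem_nhds hτ.2)
  have hshift : Tendsto (fun t => t - τ - D.h) (𝓝[≥] τ) (𝓝[Icc (-D.h) (-D.h + δ)] (-D.h)) := by
    refine tendsto_nhdsWithin_iff.2 ⟨?_, ?_⟩
    · have : Continuous fun t : ℝ => t - τ - D.h := by fun_prop
      have := this.tendsto τ
      rw [sub_self, zero_sub] at this
      exact this.mono_left inf_le_left
    · filter_upwards [hev] with t ht using Ico_subset_Icc_self (hmem t ht)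
  have hu : UniqueDiffOn ℝ (Icc (-D.h) (-D.h + δ)) := uniqueDiffOn_Icc (by linarith)
  have hmemh : -D.h ∈ Icc (-D.h) (-D.h + δ) := ⟨le_rfl, by linarith⟩
  have hw1 : Tendsto (fun t => w (t - τ - D.h)) (𝓝[≥] τ) (𝓝 (w (-D.h))) :=
    (hwδ.continuousOn _ hmemh).tendsto.comp hshift
  have hw2 : Tendsto (fun t => w' (t - τ - D.h)) (𝓝[≥] τ) (𝓝 (w' (-D.h))) :=
    (hwδ.continuousOn_derivWithin hu le_rfl _ hmemh).tendsto.comp hshift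
  have hop : IsOpen (Ioo 0 D.ϑ ×ˢ (univ : Set (Vec n))) := isOpen_Ioo.prod isOpen_univ
  have hfd := (hD.g_contDiff.mono (prod_mono_left Ioo_subset_Icc_self)).continuousOn_fderiv_of_isOpen
    hop le_rfl
  have hfd1 := (hfd.continuousAt (hop.mem_nhds (⟨hτ, mem_univ (w (-D.h))⟩ :
    (τ, w (-D.h)) ∈ Ioo 0 D.ϑ ×ˢ (univ : Set (Vec n))))).tendsto
  have hid : Tendsto (fun t : ℝ => t) (𝓝[≥] τ) (𝓝 τ) := tendsto_id.mono_left inf_le_left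
  have hlim := (isBoundedBilinearMap_apply (𝕜 := ℝ) (E := ℝ × Vec n)
    (F := Vec n)).continuous.continuousAt.tendsto.comp
    ((hfd1.comp (hid.prodMk_nhds hw1)).prodMk_nhds
      ((tendsto_const_nhds (x := (1 : ℝ))).prodMk_nhds hw2))
  refine hlim.congr' ?_
  filter_upwards [hev, hev2] with t ht htϑ
  rw [hD.dg_eq_fderiv ⟨hτ.1.trans_le ht.1, htϑ⟩ (hseg t ht), hval t ht]
  rfl

end Admissible

/-! ### From test functions to directional derivatives -/

/-- A smooth test function that penalizes leaving the cone `‖x - c(t)‖ ≤ R (t - τ)` around the ray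
`c(t) = z + (t - τ) d`, with slope at most `2 lam`: a smoothed version of
`a (t - τ) + ⟨x - c(t), s⟩ - 2 lam (‖x - c(t)‖ - R (t - τ))₊`. -/
theorem exists_cone_test_function (a R lam ε τ : ℝ) (d s z : Vec n) (hlam : 0 ≤ lam) (hε : 0 < ε) :
    ∃ ψ : ℝ × Vec n → ℝ, ContDiff ℝ 1 ψ ∧
      (∀ t x, ψ (t, x) ≤ a * (t - τ) + inner ℝ (x - z - (t - τ) • d) s -
        2 * lam * max 0 (‖x - z - (t - τ) • d‖ - R * (t - τ))) ∧
      -(3 * lam * ε) ≤ ψ (τ, z) ∧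
      ∀ t x, ∃ (m : ℝ) (e : Vec n), 0 ≤ m ∧ m ≤ 2 * lam ∧ ‖e‖ ≤ 1 ∧
        deriv (fun t => ψ (t, x)) t = a - inner ℝ d s + m * inner ℝ e d + m * R ∧
        gradient (fun x => ψ (t, x)) x = s - m • e := by
  let Y : ℝ × Vec n → Vec n := fun q => q.2 - z - (q.1 - τ) • d
  let Q : ℝ × Vec n → ℝ := fun q => √(‖Y q‖ ^ 2 + ε ^ 2)
  let U : ℝ × Vec n → ℝ := fun q => Q q - R * (q.1 - τ)
  let ψ : ℝ × Vec n → ℝ := fun q =>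
    a * (q.1 - τ) + inner ℝ (Y q) s - lam * (U q + √(U q ^ 2 + ε ^ 2))
  have hY : ContDiff ℝ 1 Y := by fun_prop
  have hQpos : ∀ q, 0 < ‖Y q‖ ^ 2 + ε ^ 2 := fun q => by positivity
  have hUpos : ∀ q, 0 < U q ^ 2 + ε ^ 2 := fun q => by positivity
  have hQ : ContDiff ℝ 1 Q := ((hY.norm_sq ℝ).add contDiff_const).sqrt fun q => (hQpos q).ne'
  have hU : ContDiff ℝ 1 U := hQ.sub (by fun_prop)
  have hψ : ContDiff ℝ 1 ψ :=
    ((contDiff_const.mul (contDiff_fst.sub contDiff_const)).add (hY.inner ℝ contDiff_const)).sub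
      (contDiff_const.mul (hU.add (((hU.pow 2).add contDiff_const).sqrt fun q => (hUpos q).ne')))
  refine ⟨ψ, hψ, fun t x => ?_, ?_, fun t x => ?_⟩
  · have h1 : ‖Y (t, x)‖ ≤ Q (t, x) := Real.le_sqrt_of_sq_le (by nlinarith [hε])
    have h2 : |U (t, x)| ≤ √(U (t, x) ^ 2 + ε ^ 2) := Real.abs_le_sqrt (by nlinarith [hε])
    have h3 : 2 * max 0 (‖Y (t, x)‖ - R * (t - τ)) ≤ U (t, x) + √(U (t, x) ^ 2 + ε ^ 2) := by
      have e : ‖Y (t, x)‖ - R * (t - τ) ≤ U (t, x) := sub_le_sub_right h1 _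
      rcases max_cases 0 (‖Y (t, x)‖ - R * (t - τ)) with h | h
      · rw [h.1]; linarith [neg_abs_le (U (t, x))]
      · rw [h.1]; linarith [le_abs_self (U (t, x))]
    have h4 := mul_le_mul_of_nonneg_left h3 hlam
    simp only [ψ]
    simp only [Y] at h4 ⊢
    linarith
  · have hY0 : Y (τ, z) = 0 := by simp [Y]
    have hQ0 : Q (τ, z) = ε := by simp [Q, hY0, Real.sqrt_sq hε.le]
    have hU0 : U (τ, z) = ε := by simp [U, hQ0]
    have h1 : √(ε ^ 2 + ε ^ 2) ≤ 2 * ε := Real.sqrt_le_iff.2 ⟨by linarith, by nlinarith⟩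
    have h2 := mul_le_mul_of_nonneg_left h1 hlam
    simp only [ψ, hY0, hU0, sub_self, mul_zero, inner_zero_left]
    linarith
  · set q : ℝ × Vec n := (t, x)
    set m := lam * (1 + U q / √(U q ^ 2 + ε ^ 2)) with hm
    set e : Vec n := (Q q)⁻¹ • Y q with he
    have hs : 0 < √(U q ^ 2 + ε ^ 2) := Real.sqrt_pos.2 (hUpos q)
    have hq : 0 < Q q := Real.sqrt_pos.2 (hQpos q)
    have h2 : |U q| ≤ √(U q ^ 2 + ε ^ 2) := Real.abs_le_sqrt (by nlinarith [hε])
    have h3 : |U q / √(U q ^ 2 + ε ^ 2)| ≤ 1 := by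
      rw [abs_div, abs_of_pos hs]; exact (div_le_one hs).2 h2
    have hY1 : ‖Y q‖ ≤ Q q := Real.le_sqrt_of_sq_le (by nlinarith [hε])
    -- `ψ` is differentiated along lines, where only one-variable derivatives occur
    have hline : ∀ (dt : ℝ) (dx : Vec n), fderiv ℝ ψ q (dt, dx) =
        a * dt + inner ℝ (dx - dt • d) s - m * (inner ℝ e (dx - dt • d) - R * dt) := by
      intro dt dx
      have hγ : HasDerivAt (fun r : ℝ => q + r • ((dt, dx) : ℝ × Vec n)) (dt, dx) 0 := by
        simpa using ((hasDerivAt_id (0 : ℝ)).smul_const ((dt, dx) : ℝ × Vec n)).const_add q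
      have hd1 := HasFDerivAt.comp_hasDerivAt_of_eq (0 : ℝ)
        ((hψ.differentiable one_ne_zero q).hasFDerivAt) hγ (by simp)
      have ht : HasDerivAt (fun r : ℝ => (q + r • ((dt, dx) : ℝ × Vec n)).1 - τ) dt 0 := by
        have := ((hasDerivAt_id (0 : ℝ)).mul_const dt).const_add t
        simpa [q] using this.sub_const τ
      have hYd : HasDerivAt (fun r : ℝ => Y (q + r • ((dt, dx) : ℝ × Vec n))) (dx - dt • d) 0 := by
        have h5 : HasDerivAt (fun r : ℝ => (q + r • ((dt, dx) : ℝ × Vec n)).2 - z) dx 0 := by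
          have := ((hasDerivAt_id (0 : ℝ)).smul_const dx).const_add x
          simpa [q] using this.sub_const z
        exact h5.sub (ht.smul_const d)
      have e0 : q + (0 : ℝ) • ((dt, dx) : ℝ × Vec n) = q := by simp
      have hQd := ((hYd.norm_sq).add_const (ε ^ 2)).sqrt (by rw [e0]; exact (hQpos q).ne')
      have hUd := hQd.sub (ht.const_mul R)
      have hSd := ((hUd.pow 2).add_const (ε ^ 2)).sqrt (by
        simp only [Pi.sub_apply, Pi.pow_apply, e0]
        exact (hUpos q).ne')
      have hall := ((ht.const_mul a).add (hYd.inner ℝ (hasDerivAt_const (0 : ℝ) s))).sub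
        ((hUd.add hSd).const_mul lam)
      have := hd1.unique hall
      rw [this]
      simp only [e0]
      have hQq : √(‖Y q‖ ^ 2 + ε ^ 2) = Q q := rfl
      have hUq : (Q q - R * (q.1 - τ)) = U q := rfl
      simp only [Pi.sub_apply, Pi.pow_apply, e0, hQq, hUq, inner_zero_right, zero_add, he,
        inner_smul_left, RCLike.conj_to_real, hm, Nat.cast_ofNat]
      field_simp
      ring
    refine ⟨m, e, ?_, ?_, ?_, ?_, ?_⟩
    · exact mul_nonneg hlam (by linarith [(abs_le.1 h3).1])
    · have := mul_le_mul_of_nonneg_left (show 1 + U q / √(U q ^ 2 + ε ^ 2) ≤ 2 by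
        linarith [(abs_le.1 h3).2]) hlam
      linarith
    · rw [he, norm_smul, norm_inv, Real.norm_of_nonneg hq.le, inv_mul_le_iff₀ hq, mul_one]
      exact hY1
    · rw [deriv_fst_eq_fderiv (hψ.differentiable one_ne_zero _), hline]
      simp only [zero_sub, one_smul, inner_neg_left, inner_neg_right]
      ring
    · refine ext_inner_left ℝ fun v => ?_
      rw [inner_gradient_snd_eq_fderiv (hψ.differentiable one_ne_zero _), hline]
      simp only [zero_smul, sub_zero, mul_zero, zero_add, inner_sub_right, inner_smul_right,
        real_inner_comm v e]

end Problem

end NeutralHJ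

namespace NeutralHJ

variable {n : ℕ}

theorem exists_norm_sub_eq_max {ρ : ℝ} (hρ : 0 ≤ ρ) (y : Vec n) :
    ∃ y' : Vec n, ‖y'‖ ≤ ρ ∧ ‖y - y'‖ = max 0 (‖y‖ - ρ) := by
  by_cases h : ‖y‖ ≤ ρ
  · exact ⟨y, h, by simp [h]⟩
  · push Not at h
    have hy : 0 < ‖y‖ := hρ.trans_lt h
    refine ⟨(ρ / ‖y‖) • y, ?_, ?_⟩
    · rw [norm_smul, Real.norm_of_nonneg (by positivity), div_mul_cancel₀ _ hy.ne']
    · have : y - (ρ / ‖y‖) • y = (1 - ρ / ‖y‖) • y := by rw [sub_smul, one_smul]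
      have h1 : ρ / ‖y‖ ≤ 1 := (div_le_one hy).2 h.le
      rw [this, norm_smul, Real.norm_of_nonneg (by linarith), max_eq_right (by linarith)]
      field_simp

namespace Problem

variable {D : Problem n} {φ : ℝ → Vec n → (ℝ → Vec n) → ℝ}

theorem upsilon_zero_right (t : ℝ) (v : Vec n) : D.upsilon t v 0 = ‖v‖ := by
  simp [upsilon, norm1]

/-- A strict lower bound for the lower directional derivatives on a compact set of directions is
attained by the difference quotients uniformly in the direction. -/
theorem eventually_lt_quot {τ : ℝ} {z : Vec n} {w : ℝ → Vec n} {lam : ℝ} (hτ : τ < D.ϑ)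
    (hlip : ∀ t ∈ Icc τ D.ϑ, ∀ x x' : Vec n, ‖x - z‖ ≤ 1 → ‖x' - z‖ ≤ 1 →
      |φ t x (D.seg (kappa τ z w) t) - φ t x' (D.seg (kappa τ z w) t)| ≤ lam * ‖x - x'‖)
    {K : Set (Vec n)} (hK : IsCompact K) {c : Vec n → ℝ} (hc : Continuous c)
    (hlt : ∀ l ∈ K, ((c l : ℝ) : EReal) < D.lowerDir φ 1 l τ z w) :
    ∀ᶠ δ in 𝓝[>] (0 : ℝ), ∀ l ∈ K, c l < D.quot φ 1 l τ z w δ := by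
  rw [eventually_nhdsWithin_iff]
  have key : ∀ᶠ δ in 𝓝 (0 : ℝ), ∀ l ∈ K, 0 < δ → c l < D.quot φ 1 l τ z w δ := by
    refine hK.eventually_forall_of_forall_eventually fun l₀ hl₀ => ?_
    obtain ⟨c', hc1, hc2⟩ := EReal.lt_iff_exists_real_btwn.1 (hlt l₀ hl₀)
    have hc1 : c l₀ < c' := by exact_mod_cast hc1
    have hA := eventually_nhdsWithin_iff.1 (eventually_lt_of_lt_liminf hc2)
    have hA2 : ∀ᶠ δ in 𝓝 (0 : ℝ), δ * (‖l₀‖ + 1) < 1 := by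
      have : Continuous fun δ : ℝ => δ * (‖l₀‖ + 1) := by fun_prop
      exact this.tendsto' 0 0 (by simp) |>.eventually (gt_mem_nhds one_pos)
    have hA3 : ∀ᶠ δ in 𝓝 (0 : ℝ), δ < D.ϑ - τ := gt_mem_nhds (by linarith)
    have hB : ∀ᶠ l in 𝓝 l₀, c l + lam * ‖l - l₀‖ < c' := by
      have : Continuous fun l : Vec n => c l + lam * ‖l - l₀‖ := by fun_prop
      exact this.tendsto' l₀ (c l₀) (by simp) |>.eventually (gt_mem_nhds hc1)
    have hB2 : ∀ᶠ l in 𝓝 l₀, ‖l‖ < ‖l₀‖ + 1 :=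
      continuous_norm.continuousAt.eventually (gt_mem_nhds (by simp))
    filter_upwards [((hA.and hA2).and hA3).prod_nhds (hB.and hB2)] with p hp hδ
    obtain ⟨⟨⟨h1, h2⟩, h3⟩, h4, h5⟩ := hp
    have h1 : c' < D.quot φ 1 l₀ τ z w p.1 := by exact_mod_cast h1 hδ
    have hball : ∀ l : Vec n, ‖l‖ ≤ ‖l₀‖ + 1 → ‖z + p.1 • l - z‖ ≤ 1 := fun l hl => by
      rw [add_sub_cancel_left, norm_smul, Real.norm_of_nonneg hδ.le]
      exact (mul_le_mul_of_nonneg_left hl hδ.le).trans h2.le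
    have h6 := hlip (τ + 1 * p.1) ⟨by linarith, by linarith⟩ _ _ (hball p.2 h5.le)
      (hball l₀ (by linarith))
    have h7 : ‖z + p.1 • p.2 - (z + p.1 • l₀)‖ = p.1 * ‖p.2 - l₀‖ := by
      rw [add_sub_add_left_eq_sub, ← smul_sub, norm_smul, Real.norm_of_nonneg hδ.le]
    rw [h7] at h6
    have h8 : D.quot φ 1 l₀ τ z w p.1 - D.quot φ 1 p.2 τ z w p.1 ≤ lam * ‖p.2 - l₀‖ := by
      rw [quot, quot, ← sub_div, div_le_iff₀ hδ]
      have := (abs_le.1 h6).1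
      linarith
    linarith
  filter_upwards [key] with δ h hδ l hl using h l hl hδ

/-- If the inequality for lower directional derivatives fails at a point, then `φ` grows so fast in
a cone with vertex at this point that a smoothed cone function touches `φ` from below at a nearby
point, where it contradicts the inequality for test functions. -/
theorem TestBelowIneq.diniUpper (hD : D.Admissible) (h1 : D.Phi1 φ) (h2 : D.Phi2 φ)
    (h : D.TestBelowIneq φ) : D.DiniUpper φ := by
  intro τ z w hG s
  by_contra hcon
  rw [not_le] at hcon
  have hh := hD.h_pos
  have hτ := hD.mem_Ioo_of_GStar hG
  obtain ⟨⟨i, hi, hiτ1, hiτ2⟩, hw, δw, hδw, hδwh, hwC⟩ := id hG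
  simp only at hiτ1 hiτ2 hw hwC
  obtain ⟨r, hr0, hr⟩ := EReal.lt_iff_exists_real_btwn.1 hcon
  have hr0 : 0 < r := by exact_mod_cast hr0
  set κ := kappa τ z w with hκ
  have hκL : κ ∈ D.Lam τ z w := (D.kappa_mem_Lam0 hτ.2.le hw).1
  have hκτ : D.seg κ τ = w := seg_eq_of_mem_Lam hw hκL
  obtain ⟨C, hC, hκC⟩ := hκL.1.exists_bound_Icc
  obtain ⟨lam, hlam, hlip⟩ := h2 (max C (‖z‖ + 1)) (lt_max_of_lt_right (by positivity))
  have hsegP : ∀ t ∈ Icc τ D.ϑ, D.seg κ t ∈ D.PLip := fun t ht =>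
    seg_mem_PLip hh.le hκL.1 (by linarith [ht.1]) ht.2
  have hP : ∀ t ∈ Icc τ D.ϑ, ∀ x : Vec n, ‖x - z‖ ≤ 1 →
      (x, D.seg κ t) ∈ D.P (max C (‖z‖ + 1)) := by
    refine fun t ht x hx => ⟨hsegP t ht, le_max_of_le_right ?_, fun ξ hξ => le_max_of_le_left ?_⟩
    · have := norm_add_le (x - z) z
      rw [sub_add_cancel] at this
      linarith
    · change ‖D.seg κ t ξ‖ ≤ C
      rw [seg_apply hξ]
      exact hκC _ ⟨by linarith [ht.1, hξ.1], by linarith [ht.2, hξ.2]⟩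
  have h0ϑ : ∀ t ∈ Icc τ D.ϑ, t ∈ Icc 0 D.ϑ := fun t ht => ⟨hτ.1.le.trans ht.1, ht.2⟩
  have hstate : ∀ t ∈ Icc τ D.ϑ, ∀ x x' : Vec n, ‖x - z‖ ≤ 1 → ‖x' - z‖ ≤ 1 →
      |φ t x (D.seg κ t) - φ t x' (D.seg κ t)| ≤ lam * ‖x - x'‖ := fun t ht x x' hx hx' => by
    have := hlip t (h0ϑ t ht) _ _ _ _ (hP t ht x hx) (hP t ht x' hx')
    rwa [sub_self, upsilon_zero_right] at this
  set d₀ := D.dg τ w with hd₀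
  set H₀ := D.H τ z (w (-D.h)) s with hH₀
  set R := D.cH * (1 + ‖z‖ + ‖w (-D.h)‖) with hR
  have hRpos : 0 < R := mul_pos hD.cH_pos (by positivity)
  set φ₀ := φ τ z w with hφ₀
  -- uniformity of the difference quotients over the compact set of directions
  have hquot : ∀ᶠ δ in 𝓝[>] (0 : ℝ), ∀ l ∈ Metric.closedBall d₀ R,
      r - (inner ℝ d₀ s + H₀ - inner ℝ l s) < D.quot φ 1 l τ z w δ := by
    refine eventually_lt_quot hτ.2 hstate (isCompact_closedBall _ _) (by fun_prop) fun l hl => ?_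
    have hmem : l ∈ D.dirs τ z w := by
      refine ⟨l - d₀, ?_, sub_add_cancel _ _⟩
      rw [mem_closedBall_iff_norm] at hl
      simpa [F] using hl
    have h3 := hr.trans_le (iInf₂_le l hmem)
    by_contra hle
    rw [not_lt] at hle
    refine absurd h3 (not_lt.2 ?_)
    refine (add_le_add_left hle _).trans ?_
    rw [← EReal.coe_add]
    exact EReal.coe_le_coe_iff.2 (by linarith)
  set P := 2 * (lam + ‖s‖) + ‖s‖ with hPdef
  have hPpos : 0 < P := by positivity
  -- the Hamilton-Jacobi expression near the vertex, with `‖p‖ ≤ P` bounding the gradients of the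
  -- test function below, differs little from its value at the vertex
  have hfst : Tendsto (fun q : ℝ × Vec n => q.1) (𝓝[≥] τ ×ˢ 𝓝 z) (𝓝[≥] τ) := tendsto_fst
  have hsnd : Tendsto (fun q : ℝ × Vec n => q.2) (𝓝[≥] τ ×ˢ 𝓝 z) (𝓝 z) := tendsto_snd
  have hid : Tendsto (fun t : ℝ => t) (𝓝[≥] τ) (𝓝 τ) := tendsto_id.mono_left inf_le_left
  have hE1 : ∀ᶠ t in 𝓝[≥] τ, ‖D.dg t (D.seg κ t) - d₀‖ * P < r / 16 := by
    have h3 := ((hD.tendsto_dg_seg_kappa hG).sub_const d₀).norm.mul_const P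
    rw [sub_self, norm_zero, zero_mul] at h3
    exact h3.eventually (gt_mem_nhds (by positivity))
  have hκdelay : κ (τ - D.h) = w (-D.h) := by
    rw [hκL.2.2 _ ⟨le_rfl, by linarith⟩]; congr 1; ring
  have hE2 : ∀ᶠ q in 𝓝[≥] τ ×ˢ 𝓝 z, ∀ p : Vec n, ‖p‖ ≤ P →
      |D.H q.1 q.2 (κ (q.1 - D.h)) p - D.H τ z (w (-D.h)) p| < r / 16 := by
    have hκc : Tendsto (fun t => κ (t - D.h)) (𝓝[≥] τ) (𝓝 (w (-D.h))) := by
      have h3 := (hκL.1.comp_add_const (-D.h)).continuousWithinAt_Ici (t := τ)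
        ⟨by linarith, by linarith [hτ.2]⟩
      rw [← hκdelay]
      simpa only [ContinuousWithinAt, ← sub_eq_add_neg] using h3
    have h4 : ∀ᶠ b : ℝ × Vec n × Vec n in 𝓝 (τ, z, w (-D.h)), ∀ p ∈ Metric.closedBall (0 : Vec n) P,
        |D.H (projIcc 0 D.ϑ hD.ϑ_pos.le b.1) b.2.1 b.2.2 p -
          D.H (projIcc 0 D.ϑ hD.ϑ_pos.le τ) z (w (-D.h)) p| < r / 16 := by
      refine (isCompact_closedBall _ _).eventually_forall_of_forall_eventually fun p _ => ?_
      have h5 : Continuous fun q : (ℝ × Vec n × Vec n) × Vec n =>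
          |D.H (projIcc 0 D.ϑ hD.ϑ_pos.le q.1.1) q.1.2.1 q.1.2.2 q.2 -
          D.H (projIcc 0 D.ϑ hD.ϑ_pos.le τ) z (w (-D.h)) q.2| := by
        have e1 := hD.continuous_H_projIcc.comp (f := fun q : (ℝ × Vec n × Vec n) × Vec n =>
          (q.1.1, q.1.2.1, q.1.2.2, q.2)) (by fun_prop)
        have e2 := hD.continuous_H_projIcc.comp (f := fun q : (ℝ × Vec n × Vec n) × Vec n =>
          (τ, z, w (-D.h), q.2)) (by fun_prop)
        exact (e1.sub e2).abs
      exact h5.tendsto' ((τ, z, w (-D.h)), p) 0 (by simp) |>.eventually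
        (gt_mem_nhds (by positivity))
    have h6 : ∀ᶠ t in 𝓝[≥] τ, t < D.ϑ := hid.eventually (gt_mem_nhds hτ.2)
    have h7 : ∀ᶠ t in 𝓝[≥] τ, τ ≤ t := self_mem_nhdsWithin
    filter_upwards [((hid.comp hfst).prodMk_nhds (hsnd.prodMk_nhds (hκc.comp hfst))).eventually h4,
      hfst.eventually h6, hfst.eventually h7] with q hq hq6 hq7 p hp
    have := hq p (by simpa using hp)
    simp only [Function.comp] at this
    rwa [Admissible.eqOn_H_projIcc hD.ϑ_pos.le ⟨hτ.1.le.trans hq7, hq6.le⟩,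
      Admissible.eqOn_H_projIcc hD.ϑ_pos.le ⟨hτ.1.le, hτ.2.le⟩] at this
  have hE3 : ∀ᶠ x in 𝓝 z, lam * ‖x - z‖ < r / 16 := by
    have : Continuous fun x : Vec n => lam * ‖x - z‖ := by fun_prop
    exact this.tendsto' z 0 (by simp) |>.eventually (gt_mem_nhds (by positivity))
  obtain ⟨pa, hpa, pb, hpb, hE⟩ := eventually_prod_iff.1
    ((hfst.eventually hE1).and (hE2.and (hsnd.eventually hE3)))
  obtain ⟨u, huτ, hu⟩ := mem_nhdsGE_iff_exists_Icc_subset.1 hpa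
  have huτ : τ < u := huτ
  obtain ⟨d', hd', hd'b⟩ := Metric.nhds_basis_closedBall.mem_iff.1 hpb
  set d := min d' 1 with hd
  have hdpos : 0 < d := lt_min hd' one_pos
  have hd1 : d ≤ 1 := min_le_right _ _
  obtain ⟨δ₁, hδ₁pos, hδ₁⟩ := mem_nhdsGT_iff_exists_Ioc_subset.1 hquot
  have hδ₁pos : 0 < δ₁ := hδ₁pos
  obtain ⟨δ, hδpos, hδu, hδδ₁, hδw2, hδi, hδϑ, hδd⟩ : ∃ δ > 0, τ + δ ≤ u ∧ δ ≤ δ₁ ∧ δ ≤ δw / 2 ∧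
      τ + δ < (i + 1) * D.h ∧ τ + δ < D.ϑ ∧ δ * (‖d₀‖ + R) ≤ d / 2 := by
    have e1 : ∀ᶠ δ in 𝓝[>] (0 : ℝ), δ < u - τ := nhdsWithin_le_nhds (gt_mem_nhds (by linarith))
    have e2 : ∀ᶠ δ in 𝓝[>] (0 : ℝ), δ < δ₁ := nhdsWithin_le_nhds (gt_mem_nhds hδ₁pos)
    have e3 : ∀ᶠ δ in 𝓝[>] (0 : ℝ), δ < δw / 2 := nhdsWithin_le_nhds (gt_mem_nhds (by linarith))
    have e4 : ∀ᶠ δ in 𝓝[>] (0 : ℝ), δ < (i + 1) * D.h - τ := nhdsWithin_le_nhds (gt_mem_nhds (by linarith))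
    have e5 : ∀ᶠ δ in 𝓝[>] (0 : ℝ), δ < D.ϑ - τ := nhdsWithin_le_nhds (gt_mem_nhds (by linarith [hτ.2]))
    have e6 : ∀ᶠ δ in 𝓝[>] (0 : ℝ), δ < d / 2 / (‖d₀‖ + R) := nhdsWithin_le_nhds (gt_mem_nhds (by positivity))
    obtain ⟨δ, ⟨⟨⟨⟨⟨⟨h1, h2⟩, h3⟩, h4⟩, h5⟩, h6⟩, h7⟩⟩ :=
      ((((((e1.and e2).and e3).and e4).and e5).and e6).and self_mem_nhdsWithin).exists
    refine ⟨δ, h7, by linarith, h2.le, h3.le, by linarith, by linarith, ?_⟩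
    exact ((lt_div_iff₀ (by positivity)).1 h6).le
  set lam' := lam + ‖s‖ with hlam'
  have hlam'pos : 0 < lam' := by positivity
  -- `x` is compared with its projection onto the cone, where the quotients are bounded below
  have hgrow : ∀ t ∈ Icc τ (τ + δ), ∀ x : Vec n, ‖x - z‖ ≤ d →
      φ₀ + (r - H₀) * (t - τ) + inner ℝ (x - z - (t - τ) • d₀) s
        - lam' * max 0 (‖x - z - (t - τ) • d₀‖ - R * (t - τ)) ≤ φ t x (D.seg κ t) := by
    intro t ht x hx
    have htτ : 0 ≤ t - τ := by linarith [ht.1]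
    have htϑ : t ∈ Icc τ D.ϑ := ⟨ht.1, by linarith [ht.2]⟩
    set y := x - z - (t - τ) • d₀ with hy
    obtain ⟨y', hy'1, hy'2⟩ := exists_norm_sub_eq_max (mul_nonneg hRpos.le htτ) y
    have hx' : ‖z + (t - τ) • d₀ + y' - z‖ ≤ 1 := by
      have e1 : z + (t - τ) • d₀ + y' - z = (t - τ) • d₀ + y' := by abel
      rw [e1]
      refine (norm_add_le _ _).trans ?_
      rw [norm_smul, Real.norm_of_nonneg htτ]
      have e2 : (t - τ) * (‖d₀‖ + R) ≤ δ * (‖d₀‖ + R) := by gcongr; linarith [ht.2]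
      linarith
    have hbase : φ₀ + (r - H₀) * (t - τ) + inner ℝ y' s ≤
        φ t (z + (t - τ) • d₀ + y') (D.seg κ t) := by
      rcases ht.1.eq_or_lt with he | hlt
      · have e1 : y' = 0 := by
          rw [← he, sub_self, mul_zero] at hy'1
          exact norm_le_zero_iff.1 hy'1
        rw [e1, ← he]
        simp [hκτ, ← hφ₀]
      · have hδt : 0 < t - τ := by linarith
        have hq := hδ₁ ⟨hδt, (by linarith [ht.2] : t - τ ≤ δ₁)⟩ (d₀ + (t - τ)⁻¹ • y') (by
          rw [mem_closedBall_iff_norm, add_sub_cancel_left, norm_smul, norm_inv,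
            Real.norm_of_nonneg htτ, inv_mul_le_iff₀ hδt, mul_comm]
          exact hy'1)
        rw [quot, lt_div_iff₀ hδt, one_mul, add_sub_cancel, smul_add, smul_smul,
          mul_inv_cancel₀ hδt.ne', one_smul, inner_add_left, inner_smul_left, ← add_assoc] at hq
        simp only [RCLike.conj_to_real] at hq
        have e2 : (r - (inner ℝ d₀ s + H₀ - (inner ℝ d₀ s + (t - τ)⁻¹ * inner ℝ y' s))) * (t - τ)
            = (r - H₀) * (t - τ) + inner ℝ y' s := by field_simp; ring
        rw [e2] at hq
        linarith
    have h3 := hstate t htϑ x (z + (t - τ) • d₀ + y') (hx.trans hd1) hx'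
    have e3 : x - (z + (t - τ) • d₀ + y') = y - y' := by rw [hy]; abel
    rw [e3, hy'2] at h3
    have h4 : inner ℝ y s - inner ℝ y' s ≤ max 0 (‖y‖ - R * (t - τ)) * ‖s‖ := by
      rw [← inner_sub_left, ← hy'2]
      exact real_inner_le_norm _ _
    have := (abs_le.1 h3).1
    rw [hlam']
    linarith
  set ε := min (r / 2 * δ) (lam' * (d / 2)) / (6 * lam') with hε
  have hεpos : 0 < ε := by
    refine div_pos (lt_min (by positivity) (by positivity)) (by positivity)
  have h3ε : 3 * lam' * ε < min (r / 2 * δ) (lam' * (d / 2)) := by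
    have e1 : 3 * lam' * ε = min (r / 2 * δ) (lam' * (d / 2)) / 2 := by
      rw [hε]; field_simp; ring
    rw [e1]
    exact half_lt_self (lt_min (by positivity) (by positivity))
  obtain ⟨ψ, hψ, hψle, hψz, hψd⟩ :=
    exists_cone_test_function (r / 2 - H₀) R lam' ε τ d₀ s z hlam'pos.le hεpos
  have hlow : ∀ t ∈ Icc τ (τ + δ), ∀ x : Vec n, ‖x - z‖ ≤ d →
      φ₀ + r / 2 * (t - τ) + lam' * max 0 (‖x - z - (t - τ) • d₀‖ - R * (t - τ)) ≤
        φ t x (D.seg κ t) - ψ (t, x) := fun t ht x hx => by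
    have e1 := hgrow t ht x hx
    have e2 := hψle t x
    linarith
  have hIcc : Icc τ (τ + δ) ⊆ Ioc (i * D.h) ((i + 1) * D.h) := fun t ht =>
    ⟨hiτ1.trans_le ht.1, by linarith [ht.2]⟩
  have hcont : ContinuousOn (fun q : ℝ × Vec n => φ q.1 q.2 (D.seg κ q.1) - ψ q)
      (Icc τ (τ + δ) ×ˢ Metric.closedBall z d) := by
    refine ContinuousOn.sub ?_ hψ.continuous.continuousOn
    refine (continuousOn_state_along_history hD h1 h2 hδϑ.le le_rfl hκL.1 hIcc ?_).mono
      (prod_mono_right (subset_univ _))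
    have e1 : ContinuousOn (fun t => w (t - D.h - τ)) (Icc τ (τ + δ)) :=
      hwC.continuousOn.comp (by fun_prop) fun t ht => ⟨by linarith [ht.1], by linarith [ht.2]⟩
    refine e1.congr fun t ht => ?_
    exact hκL.2.2 _ ⟨by linarith [ht.1], by linarith [ht.2]⟩
  obtain ⟨⟨t₁, x₁⟩, ⟨ht₁, hx₁⟩, hmin⟩ := (isCompact_Icc.prod
    (isCompact_closedBall z d)).exists_isMinOn
    ⟨(τ, z), ⟨⟨le_rfl, by linarith⟩, Metric.mem_closedBall_self hdpos.le⟩⟩ hcont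
  simp only [mem_closedBall_iff_norm] at ht₁ hx₁
  have hmin0 : φ t₁ x₁ (D.seg κ t₁) - ψ (t₁, x₁) ≤ φ₀ + 3 * lam' * ε := by
    have := hmin (⟨⟨le_rfl, by linarith⟩, Metric.mem_closedBall_self hdpos.le⟩ :
      (τ, z) ∈ Icc τ (τ + δ) ×ˢ Metric.closedBall z d)
    simp only [mem_ofPred_eq, hκτ] at this
    linarith
  -- the minimum is not attained at the final time or at the lateral boundary
  have ht₁lt : t₁ < τ + δ := by
    refine lt_of_le_of_ne ht₁.2 fun he => ?_
    have e1 := hlow t₁ ht₁ x₁ hx₁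
    have e2 : 0 ≤ lam' * max 0 (‖x₁ - z - (t₁ - τ) • d₀‖ - R * (t₁ - τ)) :=
      mul_nonneg hlam'pos.le (le_max_left _ _)
    have e3 := h3ε.trans_le (min_le_left _ _)
    have e4 : r / 2 * (t₁ - τ) = r / 2 * δ := by rw [he]; ring
    linarith
  have hx₁lt : ‖x₁ - z‖ < d := by
    refine lt_of_le_of_ne hx₁ fun he => ?_
    have e1 := hlow t₁ ht₁ x₁ hx₁
    have htτ : 0 ≤ t₁ - τ := by linarith [ht₁.1]
    have e2 : d / 2 ≤ ‖x₁ - z - (t₁ - τ) • d₀‖ - R * (t₁ - τ) := by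
      have e3 := norm_sub_norm_le (x₁ - z) ((t₁ - τ) • d₀)
      rw [norm_smul, Real.norm_of_nonneg htτ, he] at e3
      have e4 : (t₁ - τ) * (‖d₀‖ + R) ≤ δ * (‖d₀‖ + R) := by gcongr; linarith
      linarith
    have e5 : lam' * (d / 2) ≤ lam' * max 0 (‖x₁ - z - (t₁ - τ) • d₀‖ - R * (t₁ - τ)) := by
      gcongr; exact le_max_of_le_right e2
    have e6 := h3ε.trans_le (min_le_right _ _)
    have e7 : 0 ≤ r / 2 * (t₁ - τ) := by positivity
    linarith
  have ht₁ϑ : t₁ ∈ Icc τ D.ϑ := ⟨ht₁.1, by linarith⟩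
  have hpa₁ : pa t₁ := hu ⟨ht₁.1, by linarith⟩
  have hpb₁ : pb x₁ := hd'b (by
    rw [mem_closedBall_iff_norm]; exact hx₁.trans (min_le_left _ _))
  obtain ⟨hE1', hE2', hE3'⟩ := hE hpa₁ hpb₁
  simp only at hE1' hE2' hE3'
  set w₁ := D.seg κ t₁ with hw₁
  have hG₁ : (t₁, x₁, w₁) ∈ D.GStar :=
    ⟨⟨i, hi, hiτ1.trans_le ht₁.1, by linarith⟩,
      Admissible.seg_kappa_mem_PLipStar hτ.2.le hw hδw hδwh hwC ⟨ht₁.1, by linarith⟩ ht₁ϑ.2⟩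
  have hw₁P : w₁ ∈ D.PLip := hsegP t₁ ht₁ϑ
  have hκ₁L : kappa t₁ x₁ w₁ ∈ D.Lam t₁ x₁ w₁ := (D.kappa_mem_Lam0 ht₁ϑ.2 hw₁P).1
  have heq : ∀ t ∈ Ico (t₁ - D.h) t₁, kappa t₁ x₁ w₁ t = κ t := fun t ht => by
    rw [hκ₁L.2.2 t ht, hw₁, seg_apply ⟨by linarith [ht.1], by linarith [ht.2]⟩]
    congr 1; ring
  -- the histories `κ(t₁, x₁, ·)` and `κ(τ, z, w)` differ by `‖x₁ - z‖` on `[t₁, t)`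
  have hcmp : ∀ t ∈ Icc t₁ (τ + δ), ∀ x : Vec n, ‖x - z‖ ≤ d →
      φ t x (D.seg κ t) - lam * ‖x₁ - z‖ * (t - t₁) ≤ φ t x (D.seg (kappa t₁ x₁ w₁) t) := by
    intro t ht x hx
    have htϑ : t ∈ Icc τ D.ϑ := ⟨ht₁.1.trans ht.1, by linarith [ht.2]⟩
    have hPx := hP t htϑ x (hx.trans hd1)
    have hPx' : (x, D.seg (kappa t₁ x₁ w₁) t) ∈ D.P (max C (‖z‖ + 1)) := by
      refine ⟨seg_mem_PLip hh.le hκ₁L.1 (by linarith [ht.1]) htϑ.2, hPx.2.1, fun ξ hξ => ?_⟩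
      change ‖D.seg (kappa t₁ x₁ w₁) t ξ‖ ≤ _
      rw [seg_apply hξ]
      by_cases hlt : t + ξ < t₁
      · rw [heq _ ⟨by linarith [ht.1, hξ.1], hlt⟩]
        exact le_max_of_le_left
          (hκC _ ⟨by linarith [ht.1, hξ.1, ht₁.1], by linarith [htϑ.2, hξ.2]⟩)
      · rw [kappa, if_neg hlt]
        exact (hP t₁ ht₁ϑ x₁ (hx₁.trans hd1)).2.1
    have e1 := hlip t (h0ϑ t htϑ) _ _ _ _ hPx hPx'
    have e2 := upsilon_seg_sub_le hD (x := κ) (x' := kappa t₁ x₁ w₁) (i := i) (τ := t₁) (t := t)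
      (T := D.ϑ) (M := ‖x₁ - z‖) (hκL.1.mono (by linarith [ht₁.1]) (by linarith [ht₁ϑ.2]) le_rfl)
      hκ₁L.1 (fun r hr => (heq r hr).symm) (hiτ1.trans_le ht₁.1) ht.1 (by linarith [ht.2]) htϑ.2
      (fun r hr => by
        rw [hκ, kappa, kappa, if_neg (by linarith [hr.1, ht₁.1]), if_neg (by linarith [hr.1]),
          norm_sub_rev]) (x - x)
    rw [sub_self, norm_zero, zero_add] at e2
    rw [sub_self] at e1
    have e3 := (le_abs_self _).trans (e1.trans (mul_le_mul_of_nonneg_left e2 hlam.le))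
    linarith
  set μ := lam * ‖x₁ - z‖ with hμ
  set Ψ : ℝ × Vec n → ℝ := fun q => ψ q - μ * (q.1 - t₁) with hΨ
  have hΨc : ContDiff ℝ 1 Ψ := hψ.sub (by fun_prop)
  have hκ₁t : D.seg (kappa t₁ x₁ w₁) t₁ = w₁ := seg_eq_of_mem_Lam hw₁P hκ₁L
  have hvisc := h t₁ x₁ w₁ hG₁ Ψ hΨc (min (τ + δ - t₁) (d - ‖x₁ - z‖))
    (lt_min (by linarith) (by linarith)) fun t x htx => by
    obtain ⟨⟨ha, hb⟩, -, hc⟩ := htx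
    simp only at ha hb hc
    have ht : t ∈ Icc t₁ (τ + δ) := ⟨ha, by
      have := min_le_left (τ + δ - t₁) (d - ‖x₁ - z‖); linarith⟩
    have hx : ‖x - z‖ ≤ d := by
      have e1 := hc.trans (min_le_right (τ + δ - t₁) (d - ‖x₁ - z‖))
      have e2 := norm_sub_le_norm_sub_add_norm_sub x x₁ z
      linarith
    have e3 := hmin (⟨⟨ht₁.1.trans ha, ht.2⟩, mem_closedBall_iff_norm.2 hx⟩ :
      (t, x) ∈ Icc τ (τ + δ) ×ˢ Metric.closedBall z d)
    simp only [mem_ofPred_eq] at e3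
    have e4 := hcmp t ht x hx
    simp only [hΨ, sub_self, mul_zero]
    linarith
  -- evaluation of the Hamilton-Jacobi expression
  obtain ⟨m, e, hm0, hm2, he1, hdt, hgrad⟩ := hψd t₁ x₁
  have hdt' : deriv (fun t => Ψ (t, x₁)) t₁ = deriv (fun t => ψ (t, x₁)) t₁ - μ := by
    have e1 : DifferentiableAt ℝ (fun t => ψ (t, x₁)) t₁ := by
      have : ContDiff ℝ 1 fun t => ψ (t, x₁) := hψ.comp (by fun_prop)
      exact this.differentiable one_ne_zero _
    have e2 : HasDerivAt (fun t : ℝ => μ * (t - t₁)) μ t₁ := by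
      simpa using ((hasDerivAt_id t₁).sub_const t₁).const_mul μ
    exact (e1.hasDerivAt.sub e2).deriv
  have hgrad' : gradient (fun x => Ψ (t₁, x)) x₁ = s - m • e := by
    rw [← hgrad]; simp [hΨ]
  set p := s - m • e with hp
  rw [hdt', hgrad', hdt, hj] at hvisc
  have hpP : ‖p‖ ≤ P := by
    refine (norm_sub_le _ _).trans ?_
    rw [norm_smul, Real.norm_of_nonneg hm0]
    have : m * ‖e‖ ≤ 2 * lam' * 1 := by gcongr
    rw [hPdef]; linarith
  have hHe := hE2' p hpP
  have hw₁h : w₁ (-D.h) = κ (t₁ - D.h) := by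
    rw [hw₁, seg_apply ⟨le_rfl, by linarith⟩, sub_eq_add_neg]
  rw [← hw₁h] at hHe
  have hHg := hD.H_growth τ ⟨hτ.1.le, hτ.2.le⟩ z (w (-D.h)) p s
  have hps : ‖p - s‖ ≤ m := by
    rw [hp, sub_sub_cancel_left, norm_neg, norm_smul, Real.norm_of_nonneg hm0]
    exact mul_le_of_le_one_right hm0 he1
  have hHg' : |D.H τ z (w (-D.h)) p - H₀| ≤ R * m :=
    hHg.trans (mul_le_mul_of_nonneg_left hps hRpos.le)
  have hdgp : |inner ℝ (D.dg t₁ w₁ - d₀) p| < r / 16 :=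
    (abs_real_inner_le_norm _ _).trans_lt
      (lt_of_le_of_lt (mul_le_mul_of_nonneg_left hpP (norm_nonneg _)) hE1')
  have hd0p : inner ℝ d₀ p = inner ℝ d₀ s - m * inner ℝ e d₀ := by
    rw [hp, inner_sub_right, inner_smul_right, real_inner_comm e d₀]
  rw [inner_sub_left, hd0p] at hdgp
  have f1 := (abs_lt.1 hHe).1
  have f2 := (abs_le.1 hHg').1
  have f3 := (abs_lt.1 hdgp).1
  linarith

end Problem

end NeutralHJ

/-! ### Compactness of the sets of trajectories -/

namespace NeutralHJ

variable {n : ℕ}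

/-- Grönwall's inequality in integral form, with a non-optimal constant: compare with the maximum
of `u(t) exp(-2c(t - a))`. -/
theorem le_of_le_add_mul_integral {u : ℝ → ℝ} {a b B c : ℝ} (hu : ContinuousOn u (Icc a b))
    (hB : 0 ≤ B) (hc : 0 < c) (h : ∀ t ∈ Icc a b, u t ≤ B + c * ∫ ξ in a..t, u ξ) :
    ∀ t ∈ Icc a b, u t ≤ 2 * B * Real.exp (2 * c * (t - a)) := by
  intro t ht
  have hcont : ContinuousOn (fun t => u t * Real.exp (-(2 * c * (t - a)))) (Icc a b) :=
    hu.mul (by fun_prop)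
  obtain ⟨r, hr, hmax⟩ := isCompact_Icc.exists_isMaxOn ⟨t, ht⟩ hcont
  set m := u r * Real.exp (-(2 * c * (r - a))) with hm
  have hle : ∀ ξ ∈ Icc a b, u ξ ≤ m * Real.exp (2 * c * (ξ - a)) := fun ξ hξ => by
    have h1 : u ξ * Real.exp (-(2 * c * (ξ - a))) ≤ m := hmax hξ
    have h2 := mul_le_mul_of_nonneg_right h1 (Real.exp_pos (2 * c * (ξ - a))).le
    rwa [mul_assoc, ← Real.exp_add, neg_add_cancel, Real.exp_zero, mul_one] at h2
  suffices hm2 : m ≤ 2 * B from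
    (hle t ht).trans (mul_le_mul_of_nonneg_right hm2 (Real.exp_pos _).le)
  rcases le_or_gt m 0 with h0 | h0
  · linarith
  have hint : ∫ ξ in a..r, u ξ ≤ ∫ ξ in a..r, m * Real.exp (2 * c * (ξ - a)) := by
    refine intervalIntegral.integral_mono_on hr.1 ?_ ?_ fun ξ hξ => hle ξ ⟨hξ.1, hξ.2.trans hr.2⟩
    · exact (hu.mono (by rw [uIcc_of_le hr.1]; exact Icc_subset_Icc_right hr.2)).intervalIntegrable
    · exact (by fun_prop : Continuous fun ξ => m * Real.exp (2 * c * (ξ - a))).intervalIntegrable _ _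
  have hval : ∫ ξ in a..r, m * Real.exp (2 * c * (ξ - a)) =
      m / (2 * c) * (Real.exp (2 * c * (r - a)) - 1) := by
    have hd : ∀ ξ ∈ uIcc a r, HasDerivAt (fun ξ => m / (2 * c) * Real.exp (2 * c * (ξ - a)))
        (m * Real.exp (2 * c * (ξ - a))) ξ := fun ξ _ => by
      have := ((((hasDerivAt_id ξ).sub_const a).const_mul (2 * c)).exp).const_mul (m / (2 * c))
      refine this.congr_deriv ?_
      simp only [id]
      field_simp
    rw [intervalIntegral.integral_eq_sub_of_hasDerivAt hd
      ((by fun_prop : Continuous fun ξ => m * Real.exp (2 * c * (ξ - a))).intervalIntegrable _ _)]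
    simp
    ring
  have h1 := h r hr
  have h2 : u r = m * Real.exp (2 * c * (r - a)) := by
    rw [hm, mul_assoc, ← Real.exp_add, neg_add_cancel, Real.exp_zero, mul_one]
  set e := Real.exp (2 * c * (r - a)) with he
  have h3 : c * (m / (2 * c) * (e - 1)) = m * (e - 1) / 2 := by field_simp
  have h4 : c * ∫ ξ in a..r, u ξ ≤ m * (e - 1) / 2 := by
    rw [← h3, ← hval]; exact mul_le_mul_of_nonneg_left hint hc.le
  have h5 : 1 ≤ e := Real.one_le_exp (by have := hr.1; have := sub_nonneg.2 hr.1; positivity)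
  have h6 : m ≤ m * e := le_mul_of_one_le_right h0.le h5
  linarith

namespace Problem

variable {D : Problem n}

/-- The trajectories that start in a bounded set are uniformly bounded up to one delay ahead. -/
theorem Admissible.exists_bound_trajectories (hD : D.Admissible) (α : ℝ) :
    ∃ A, ∀ η ∈ Icc (0 : ℝ) 1, ∀ τ T z w x, 0 ≤ τ → T ≤ D.ϑ → T ≤ τ + D.h → ‖z‖ ≤ α →
      (∀ ξ ∈ Ico (-D.h) 0, ‖w ξ‖ ≤ α) → x ∈ D.X η τ z w → ∀ t ∈ Icc (τ - D.h) T, ‖x t‖ ≤ A := by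
  have hh := hD.h_pos
  have hc := hD.cH_pos
  obtain ⟨Cg, hCg⟩ : ∃ C, ∀ t ∈ Icc 0 D.ϑ, ∀ v : Vec n, ‖v‖ ≤ α → ‖D.g t v‖ ≤ C := by
    obtain ⟨C, hC⟩ := (isCompact_Icc.prod (isCompact_closedBall (0 : Vec n) α)).exists_bound_of_continuousOn
      (hD.g_contDiff.continuousOn.mono (prod_mono_right (subset_univ _)))
    exact ⟨C, fun t ht v hv => hC (t, v) ⟨ht, by simpa using hv⟩⟩
  set B := α + Cg + (D.cH * (1 + Cg + α) + 1) * D.ϑ with hB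
  refine ⟨max α (2 * B * Real.exp (2 * D.cH * D.ϑ) + Cg), ?_⟩
  intro η hη τ T z w x hτ hT hTh hz hw hx t ht
  have hα : 0 ≤ α := (norm_nonneg z).trans hz
  rcases lt_or_ge t τ with htτ | htτ
  · rw [hx.1.2.2 t ⟨ht.1, htτ⟩]
    exact (hw _ ⟨by linarith [ht.1], by linarith⟩).trans (le_max_left _ _)
  have hτT : τ ≤ T := htτ.trans ht.2
  have hCg0 : 0 ≤ Cg := (norm_nonneg _).trans (hCg τ ⟨hτ, hτT.trans hT⟩ z hz)
  have hϑ := hD.ϑ_pos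
  have hB0 : 0 ≤ B := by positivity
  -- the delayed values lie in the initial history
  have hdel : ∀ r ∈ Icc τ T, ‖x (r - D.h)‖ ≤ α := fun r hr => by
    rcases lt_or_ge (r - D.h) τ with h | h
    · rw [hx.1.2.2 _ ⟨by linarith [hr.1], h⟩]
      exact hw _ ⟨by linarith [hr.1], by linarith⟩
    · rw [show r - D.h = τ by linarith [hr.2], hx.1.2.1]; exact hz
  have hg : ∀ r ∈ Icc τ T, ‖D.g r (x (r - D.h))‖ ≤ Cg := fun r hr =>
    hCg r ⟨hτ.trans hr.1, hr.2.trans hT⟩ _ (hdel r hr)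
  have hxy : ∀ r ∈ Icc τ T, ‖x r‖ ≤ ‖D.yOf x r‖ + Cg := fun r hr => by
    have : x r = D.yOf x r + D.g r (x (r - D.h)) := by rw [yOf]; abel
    calc ‖x r‖ = ‖D.yOf x r + D.g r (x (r - D.h))‖ := by rw [← this]
      _ ≤ _ := (norm_add_le _ _).trans (by linarith [hg r hr])
  obtain ⟨K, hK⟩ := hx.2.1
  have hyc : ContinuousOn (D.yOf x) (Icc τ T) :=
    hK.continuousOn.mono (Icc_subset_Icc_right hT)
  have hi := ((mem_X_iff hD (hτT.trans hT)).1 hx).2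
  have key := le_of_le_add_mul_integral (u := fun r => ‖D.yOf x r‖) (a := τ) (b := T)
    hyc.norm hB0 hc (fun r hr => ?_) t ⟨htτ, ht.2⟩
  · refine (hxy t ⟨htτ, ht.2⟩).trans (le_trans ?_ (le_max_right _ _))
    have : Real.exp (2 * D.cH * (t - τ)) ≤ Real.exp (2 * D.cH * D.ϑ) :=
      Real.exp_le_exp.2 (mul_le_mul_of_nonneg_left (by linarith [ht.2]) (by positivity))
    have := mul_le_mul_of_nonneg_left this (show 0 ≤ 2 * B by positivity)
    linarith
  · have h1 := hi τ r le_rfl hr.1 (hr.2.trans hT)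
    have hyi : IntervalIntegrable (fun ξ => ‖D.yOf x ξ‖) volume τ r :=
      (hyc.norm.mono (by
        rw [uIcc_of_le hr.1]; exact Icc_subset_Icc_right hr.2)).intervalIntegrable
    have h2 : ∫ ξ in τ..r, D.radius η x ξ ≤
        ∫ ξ in τ..r, ((D.cH * (1 + Cg + α) + 1) + D.cH * ‖D.yOf x ξ‖) := by
      refine intervalIntegral.integral_mono_on hr.1
        (intervalIntegrable_radius hx.1.1 hh.le η le_rfl hr.1 (hr.2.trans hT))
        (intervalIntegrable_const.add (hyi.const_mul _)) fun ξ hξ => ?_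
      have h3 := hxy ξ ⟨hξ.1, hξ.2.trans hr.2⟩
      have h4 := hdel ξ ⟨hξ.1, hξ.2.trans hr.2⟩
      have h5 := mul_le_mul_of_nonneg_left (add_le_add h3 h4) hc.le
      rw [radius]
      linarith [hη.2]
    rw [intervalIntegral.integral_add intervalIntegrable_const (hyi.const_mul _),
      intervalIntegral.integral_const, intervalIntegral.integral_const_mul, smul_eq_mul] at h2
    have h6 : ‖D.yOf x τ‖ ≤ α + Cg := by
      rw [yOf, hx.1.2.1]
      exact (norm_sub_le _ _).trans (add_le_add hz (hg τ ⟨le_rfl, hτT⟩))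
    have h7 := norm_sub_norm_le (D.yOf x r) (D.yOf x τ)
    have h8 : (r - τ) * (D.cH * (1 + Cg + α) + 1) ≤ (D.cH * (1 + Cg + α) + 1) * D.ϑ := by
      rw [mul_comm]
      exact mul_le_mul_of_nonneg_left (by linarith [hr.2]) (by positivity)
    linarith

/-- On an interval on which a trajectory is bounded, `y` is Lipschitz continuous with an explicit
constant. -/
theorem lipschitzOnWith_yOf (hD : D.Admissible) {η τ T A : ℝ} {z : Vec n} {w x : ℝ → Vec n}
    (hη : η ≤ 1) (hτT : τ ≤ T) (hT : T ≤ D.ϑ) (hx : x ∈ D.X η τ z w)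
    (hA : ∀ t ∈ Icc (τ - D.h) T, ‖x t‖ ≤ A) :
    LipschitzOnWith (D.cH * (1 + A + A) + 1).toNNReal (D.yOf x) (Icc τ T) := by
  have hh := hD.h_pos
  have hc := hD.cH_pos
  have hA0 : 0 ≤ A := (norm_nonneg _).trans (hA τ ⟨by linarith, hτT⟩)
  have hi := ((mem_X_iff hD (hτT.trans hT)).1 hx).2
  have key : ∀ c d, τ ≤ c → c ≤ d → d ≤ T →
      ‖D.yOf x d - D.yOf x c‖ ≤ (D.cH * (1 + A + A) + 1) * (d - c) := by
    intro c d hcτ hcd hd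
    refine (hi c d hcτ hcd (hd.trans hT)).trans ?_
    have := intervalIntegral.integral_mono_on hcd
      (intervalIntegrable_radius hx.1.1 hh.le η hcτ hcd (hd.trans hT))
      (intervalIntegrable_const (c := D.cH * (1 + A + A) + 1)) (fun t ht => ?_)
    · rwa [intervalIntegral.integral_const, smul_eq_mul, mul_comm] at this
    · have h1 := hA t ⟨by linarith [ht.1], by linarith [ht.2]⟩
      have h2 := hA (t - D.h) ⟨by linarith [ht.1], by linarith [ht.2]⟩
      rw [radius]
      gcongr
  refine LipschitzOnWith.of_dist_le_mul fun c hc' d hd => ?_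
  rw [dist_eq_norm, Real.dist_eq, Real.coe_toNNReal _ (by positivity)]
  rcases le_total c d with h | h
  · rw [norm_sub_rev, abs_sub_comm, abs_of_nonneg (sub_nonneg.2 h)]
    exact key c d hc'.1 h hd.2
  · rw [abs_of_nonneg (sub_nonneg.2 h)]
    exact key d c hd.1 h hc'.2

/-- The integral form of the inclusion only has to be checked up to a time after which `y` is
constant. -/
theorem mem_X_of_const (hD : D.Admissible) {η τ T : ℝ} {z : Vec n} {w x : ℝ → Vec n} (hη : 0 ≤ η)
    (hτT : τ ≤ T) (hT : T ≤ D.ϑ) (hx : x ∈ D.Lam τ z w)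
    (hinc : ∀ c d, τ ≤ c → c ≤ d → d ≤ T → ‖D.yOf x d - D.yOf x c‖ ≤ ∫ ξ in c..d, D.radius η x ξ)
    (hconst : ∀ t ∈ Icc T D.ϑ, D.yOf x t = D.yOf x T) : x ∈ D.X η τ z w := by
  have hh := hD.h_pos.le
  have hnn : ∀ ξ, 0 ≤ D.radius η x ξ := fun ξ => by
    have := hD.cH_pos
    rw [radius]; positivity
  refine (mem_X_iff hD (hτT.trans hT)).2 ⟨hx, fun c d hc hcd hd => ?_⟩
  rcases le_total d T with hdT | hdT
  · exact hinc c d hc hcd hdT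
  rw [hconst d ⟨hdT, hd⟩]
  rcases le_total c T with hcT | hcT
  · refine (hinc c T hc hcT le_rfl).trans ?_
    rw [← intervalIntegral.integral_add_adjacent_intervals
      (intervalIntegrable_radius hx.1 hh η hc hcT hT)
      (intervalIntegrable_radius hx.1 hh η hτT hdT hd)]
    exact le_add_of_nonneg_right (intervalIntegral.integral_nonneg hdT fun ξ _ => hnn ξ)
  · rw [hconst c ⟨hcT, hcd.trans hd⟩, sub_self, norm_zero]
    exact intervalIntegral.integral_nonneg hcd fun ξ _ => hnn ξ

section Convergence

variable {τ T A : ℝ} {x : ℕ → ℝ → Vec n} {u : ℝ → Vec n}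

theorem ae_tendsto_delay
    (hlim : ∀ᵐ r, r ∈ Icc (τ - D.h) T → Tendsto (fun k => x k r) atTop (𝓝 (u r)))
    (hh : 0 ≤ D.h) :
    ∀ᵐ r, r ∈ Icc τ T → Tendsto (fun k => x k (r - D.h)) atTop (𝓝 (u (r - D.h))) := by
  filter_upwards [(measurePreserving_sub_right volume D.h).quasiMeasurePreserving.ae hlim] with r h hr
  exact h ⟨by linarith [hr.1], by linarith [hr.2]⟩

/-- Bounded almost everywhere convergence passes to the limit in the radius integrals. -/
theorem tendsto_integral_radius (hD : D.Admissible) {η : ℕ → ℝ} {η₀ c d : ℝ}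
    (hη : Tendsto η atTop (𝓝 η₀)) (hη1 : ∀ k, η k ∈ Icc (0 : ℝ) 1)
    (hx : ∀ k, PiecewiseLip (x k) (τ - D.h) T) (hA : ∀ k, ∀ t ∈ Icc (τ - D.h) T, ‖x k t‖ ≤ A)
    (hlim : ∀ᵐ r, r ∈ Icc (τ - D.h) T → Tendsto (fun k => x k r) atTop (𝓝 (u r)))
    (hc : τ ≤ c) (hcd : c ≤ d) (hd : d ≤ T) :
    Tendsto (fun k => ∫ ξ in c..d, D.radius (η k) (x k) ξ) atTop
      (𝓝 (∫ ξ in c..d, D.radius η₀ u ξ)) := by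
  have hh := hD.h_pos
  have hcH := hD.cH_pos
  refine intervalIntegral.tendsto_integral_filter_of_dominated_convergence
    (fun _ => D.cH * (1 + A + A) + 1) ?_ ?_ intervalIntegrable_const ?_
  · exact Eventually.of_forall fun k =>
      (intervalIntegrable_radius (hx k) hh.le (η k) hc hcd hd).def'.aestronglyMeasurable
  · refine Eventually.of_forall fun k => Eventually.of_forall fun t ht => ?_
    rw [uIoc_of_le hcd] at ht
    have h1 := hA k t ⟨by linarith [ht.1], by linarith [ht.2]⟩
    have h2 := hA k (t - D.h) ⟨by linarith [ht.1], by linarith [ht.2]⟩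
    have h3 := hη1 k
    rw [radius, Real.norm_of_nonneg (by have := h3.1; positivity)]
    gcongr
    exact h3.2
  · filter_upwards [hlim, ae_tendsto_delay hlim hh.le] with r h1 h2 hr
    rw [uIoc_of_le hcd] at hr
    have h1 := h1 ⟨by linarith [hr.1], by linarith [hr.2]⟩
    have h2 := h2 ⟨by linarith [hr.1], by linarith [hr.2]⟩
    exact (((h1.norm.const_add 1).add h2.norm).const_mul D.cH).add hη

/-- Convergence of trajectories implies uniform convergence of `ω`. -/
theorem tendsto_omega_sub (hD : D.Admissible) (hτ : 0 ≤ τ) (hT : T ≤ D.ϑ)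
    (hx : ∀ k, PiecewiseLip (x k) (τ - D.h) T) (hu : PiecewiseLip u (τ - D.h) T)
    (hA : ∀ k, ∀ t ∈ Icc (τ - D.h) T, ‖x k t‖ ≤ A)
    (hlim : ∀ᵐ r, r ∈ Icc (τ - D.h) T → Tendsto (fun k => x k r) atTop (𝓝 (u r)))
    (hy : TendstoUniformlyOn (fun k => D.yOf (x k)) (D.yOf u) atTop (Icc τ T)) (s : Vec n)
    {t : ℕ → ℝ} (ht : ∀ k, t k ∈ Icc τ T) :
    Tendsto (fun k => D.omega τ (t k) (x k) s - D.omega τ (t k) u s) atTop (𝓝 0) := by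
  have hh := hD.h_pos
  have hτT : τ ≤ T := (ht 0).1.trans (ht 0).2
  obtain ⟨C, hC⟩ := hD.exists_bound_H (max A ‖s‖)
  set f : ℕ → ℝ → ℝ := fun k ξ =>
    D.H ξ (x k ξ) (x k (ξ - D.h)) s - D.H ξ (u ξ) (u (ξ - D.h)) s with hf
  have hint : ∀ v : ℝ → Vec n, PiecewiseLip v (τ - D.h) T → ∀ a b, τ ≤ a → a ≤ b → b ≤ T →
      IntervalIntegrable (fun ξ => D.H ξ (v ξ) (v (ξ - D.h)) s) volume a b := fun v hv a b h1 h2 h3 =>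
    hD.intervalIntegrable_H hv hτ hT s h1 h2 h3
  have hfi : ∀ k a b, τ ≤ a → a ≤ b → b ≤ T → IntervalIntegrable (f k) volume a b :=
    fun k a b h1 h2 h3 => (hint _ (hx k) a b h1 h2 h3).sub (hint _ hu a b h1 h2 h3)
  have hH : Tendsto (fun k => ∫ ξ in τ..T, ‖f k ξ‖) atTop (𝓝 0) := by
    have := intervalIntegral.tendsto_integral_filter_of_dominated_convergence (μ := volume)
      (a := τ) (b := T) (F := fun k ξ => ‖f k ξ‖) (f := fun _ => (0 : ℝ)) (l := atTop)
      (fun ξ => C + ‖D.H ξ (u ξ) (u (ξ - D.h)) s‖) ?_ ?_ ?_ ?_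
    · simpa using this
    · exact Eventually.of_forall fun k =>
        (hfi k τ T le_rfl hτT le_rfl).norm.def'.aestronglyMeasurable
    · refine Eventually.of_forall fun k => Eventually.of_forall fun ξ hξ => ?_
      rw [uIoc_of_le hτT] at hξ
      rw [norm_norm]
      refine (norm_sub_le _ _).trans (add_le_add_left ?_ _)
      exact hC ξ ⟨by linarith [hξ.1], by linarith [hξ.2]⟩ _ _ _
        ((hA k ξ ⟨by linarith [hξ.1], by linarith [hξ.2]⟩).trans (le_max_left _ _))
        ((hA k (ξ - D.h) ⟨by linarith [hξ.1], by linarith [hξ.2]⟩).trans (le_max_left _ _))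
        (le_max_right _ _)
    · exact intervalIntegrable_const.add (hint _ hu τ T le_rfl hτT le_rfl).norm
    · filter_upwards [hlim, ae_tendsto_delay hlim hh.le] with ξ h1 h2 hξ
      rw [uIoc_of_le hτT] at hξ
      have h1 := h1 ⟨by linarith [hξ.1], by linarith [hξ.2]⟩
      have h2 := h2 ⟨by linarith [hξ.1], by linarith [hξ.2]⟩
      have hξϑ : ξ ∈ Icc 0 D.ϑ := ⟨by linarith [hξ.1], by linarith [hξ.2]⟩
      have := (hD.tendsto_H (tendsto_const_nhds (x := ξ)) h1 h2 (tendsto_const_nhds (x := s))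
        (Eventually.of_forall fun _ => hξϑ) hξϑ).sub_const (D.H ξ (u ξ) (u (ξ - D.h)) s)
      rw [sub_self] at this
      simpa using this.norm
  have hY : ∀ r : ℕ → ℝ, (∀ k, r k ∈ Icc τ T) →
      Tendsto (fun k => ‖D.yOf (x k) (r k) - D.yOf u (r k)‖) atTop (𝓝 0) := fun r hr => by
    rw [Metric.tendsto_nhds]
    intro ε hε
    filter_upwards [Metric.tendstoUniformlyOn_iff.1 hy ε hε] with k hk
    simpa [dist_eq_norm, norm_sub_rev] using hk (r k) (hr k)
  have hlim0 := hH.add (((hY t ht).add (hY (fun _ => τ) fun _ => ⟨le_rfl, hτT⟩)).mul_const ‖s‖)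
  simp only [add_zero, zero_mul] at hlim0
  refine squeeze_zero_norm (fun k => ?_) hlim0
  have e : D.omega τ (t k) (x k) s - D.omega τ (t k) u s = (∫ ξ in τ..t k, f k ξ) -
      inner ℝ ((D.yOf (x k) (t k) - D.yOf u (t k)) - (D.yOf (x k) τ - D.yOf u τ)) s := by
    rw [hf, intervalIntegral.integral_sub (hint _ (hx k) _ _ le_rfl (ht k).1 (ht k).2)
      (hint _ hu _ _ le_rfl (ht k).1 (ht k).2), omega, omega]
    simp only [inner_sub_left]
    ring
  rw [e]
  refine (norm_sub_le _ _).trans (add_le_add ?_ ?_)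
  · refine (intervalIntegral.norm_integral_le_integral_norm (ht k).1).trans ?_
    rw [← intervalIntegral.integral_add_adjacent_intervals
      (hfi k τ (t k) le_rfl (ht k).1 (ht k).2).norm (hfi k (t k) T (ht k).1 (ht k).2 le_rfl).norm]
    exact le_add_of_nonneg_right
      (intervalIntegral.integral_nonneg (ht k).2 fun _ _ => norm_nonneg _)
  · exact (norm_inner_le_norm _ _).trans
      (mul_le_mul_of_nonneg_right (norm_sub_le _ _) (norm_nonneg _))

end Convergence

/-- Where the delayed values converge, convergence of `y` is convergence of `x`. -/
theorem tendsto_of_tendsto_yOf (hD : D.Admissible) {x : ℕ → ℝ → Vec n} {u : ℝ → Vec n} {t : ℝ}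
    (ht : t ∈ Icc 0 D.ϑ) (hy : Tendsto (fun k => D.yOf (x k) t) atTop (𝓝 (D.yOf u t)))
    (hdel : Tendsto (fun k => x k (t - D.h)) atTop (𝓝 (u (t - D.h)))) :
    Tendsto (fun k => x k t) atTop (𝓝 (u t)) := by
  have := hy.add (hD.tendsto_g (tendsto_const_nhds (x := t)) hdel
    (Eventually.of_forall fun _ => ht) ht)
  simpa [yOf] using this

/-- Compactness of trajectories: when the initial histories converge boundedly almost everywhere,
and are equal at `-h`, a subsequence of the trajectories converges, on an interval of length at
most `h`, to a trajectory of the limit inclusion. -/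
theorem exists_limit_trajectory (hD : D.Admissible) {τ T α η₀ : ℝ} {η : ℕ → ℝ} {z : Vec n}
    {w : ℝ → Vec n} {W x : ℕ → ℝ → Vec n} (hτ : 0 ≤ τ) (hτT : τ ≤ T) (hT : T ≤ D.ϑ)
    (hTh : T ≤ τ + D.h) (hη : ∀ k, η k ∈ Icc (0 : ℝ) 1) (hη₀ : Tendsto η atTop (𝓝 η₀))
    (hw : w ∈ D.PLip) (hz : ‖z‖ ≤ α) (hWα : ∀ k, ∀ ξ ∈ Ico (-D.h) 0, ‖W k ξ‖ ≤ α)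
    (hlim : ∀ᵐ ξ, ξ ∈ Ico (-D.h) 0 → Tendsto (fun k => W k ξ) atTop (𝓝 (w ξ)))
    (hWh : ∀ k, W k (-D.h) = w (-D.h)) (hx : ∀ k, x k ∈ D.X (η k) τ z (W k)) :
    ∃ u ∈ D.X η₀ τ z w, ∃ (ns : ℕ → ℕ) (A : ℝ), StrictMono ns ∧
      (∀ k, ∀ t ∈ Icc (τ - D.h) T, ‖x k t‖ ≤ A) ∧
      TendstoUniformlyOn (fun k => D.yOf (x (ns k))) (D.yOf u) atTop (Icc τ T) ∧
      ∀ᵐ r, r ∈ Icc (τ - D.h) T → Tendsto (fun k => x (ns k) r) atTop (𝓝 (u r)) := by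
  have hh := hD.h_pos
  have hτϑ : τ ≤ D.ϑ := hτT.trans hT
  obtain ⟨A, hA'⟩ := hD.exists_bound_trajectories α
  have hA : ∀ k, ∀ t ∈ Icc (τ - D.h) T, ‖x k t‖ ≤ A := fun k =>
    hA' (η k) (hη k) τ T z (W k) (x k) hτ hT hTh hz (hWα k) (hx k)
  set K := (D.cH * (1 + A + A) + 1).toNNReal
  have hL : ∀ k, LipschitzOnWith K (D.yOf (x k)) (Icc τ T) := fun k =>
    lipschitzOnWith_yOf hD (hη k).2 hτT hT (hx k) (hA k)
  have hyτ : ∀ k, D.yOf (x k) τ = z - D.g τ (w (-D.h)) := fun k => by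
    rw [yOf, (hx k).1.2.1, (hx k).1.2.2 _ ⟨le_rfl, by linarith⟩,
      show τ - D.h - τ = -D.h by ring, hWh]
  have hLF : ∀ k, LipschitzWith K fun p : Icc τ T => D.yOf (x k) p := fun k =>
    (lipschitzOnWith_iff_restrict.1 (hL k))
  let F : ℕ → BoundedContinuousFunction (Icc τ T) (Vec n) := fun k =>
    BoundedContinuousFunction.mkOfCompact ⟨fun p => D.yOf (x k) p, (hLF k).continuous⟩
  have hFb : ∀ k p, F k p ∈ Metric.closedBall (D.yOf (x 0) τ) (K * (T - τ)) := fun k p => by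
    rw [Metric.mem_closedBall, hyτ 0, ← hyτ k]
    refine ((hL k).dist_le_mul p p.2 τ ⟨le_rfl, hτT⟩).trans ?_
    rw [Real.dist_eq, abs_of_nonneg (sub_nonneg.2 p.2.1)]
    exact mul_le_mul_of_nonneg_left (by linarith [p.2.2]) K.2
  have hcomp := BoundedContinuousFunction.arzela_ascoli _ (isCompact_closedBall _ _) (range F)
    (by rintro _ p ⟨k, rfl⟩; exact hFb k p)
    (LipschitzWith.uniformEquicontinuous _ K (by rintro ⟨_, k, rfl⟩; exact hLF k)).equicontinuous
  obtain ⟨G, -, ns, hns, hG⟩ := hcomp.tendsto_subseq fun k => subset_closure ⟨k, rfl⟩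
  have hGu := BoundedContinuousFunction.tendsto_iff_tendstoUniformly.1 hG
  set y : ℝ → Vec n := fun t => G (projIcc τ T hτT t) with hy
  have hyG : ∀ t (ht : t ∈ Icc τ T), y t = G ⟨t, ht⟩ := fun t ht => by
    simp only [hy, projIcc_of_mem hτT ht]
  have hyt : ∀ t ∈ Icc τ T, Tendsto (fun k => D.yOf (x (ns k)) t) atTop (𝓝 (y t)) := fun t ht => by
    rw [hyG t ht]
    exact hGu.tendsto_at ⟨t, ht⟩
  have hGL : LipschitzWith K G := LipschitzWith.of_dist_le_mul fun p q =>
    le_of_tendsto' ((hGu.tendsto_at p).dist (hGu.tendsto_at q)) fun k =>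
      (hLF (ns k)).dist_le_mul p q
  have hyL : LipschitzWith K y := by
    have := hGL.comp (LipschitzWith.projIcc hτT)
    rwa [mul_one] at this
  have hy0 : y τ = z - D.g τ (w (-D.h)) :=
    tendsto_nhds_unique (hyt τ ⟨le_rfl, hτT⟩) (by simp only [hyτ]; exact tendsto_const_nhds)
  obtain ⟨u, hu, huy⟩ := exists_mem_Lam_yOf_eq hD ⟨hτ, hτϑ⟩ hw (hyL.lipschitzOnWith) hy0
  have hunif : TendstoUniformlyOn (fun k => D.yOf (x (ns k))) (D.yOf u) atTop (Icc τ T) := by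
    rw [Metric.tendstoUniformlyOn_iff]
    intro ε hε
    filter_upwards [Metric.tendstoUniformly_iff.1 hGu ε hε] with k hk t ht
    rw [huy t ⟨ht.1, ht.2.trans hT⟩, hyG t ht]
    exact hk ⟨t, ht⟩
  -- almost everywhere convergence of the trajectories themselves
  have hae0 : ∀ᵐ r, r ∈ Ico (τ - D.h) τ → Tendsto (fun k => x (ns k) r) atTop (𝓝 (u r)) := by
    filter_upwards [(measurePreserving_sub_right volume τ).quasiMeasurePreserving.ae hlim]
      with r h hr
    rw [hu.2.2 r hr]
    simp only [fun k => (hx (ns k)).1.2.2 r hr]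
    exact (h ⟨by linarith [hr.1], by linarith [hr.2]⟩).comp hns.tendsto_atTop
  have hae : ∀ᵐ r, r ∈ Icc (τ - D.h) T → Tendsto (fun k => x (ns k) r) atTop (𝓝 (u r)) := by
    have hne : ∀ᵐ r : ℝ, r ≠ T := by simp [ae_iff, measure_singleton]
    filter_upwards [hae0, (measurePreserving_sub_right volume D.h).quasiMeasurePreserving.ae hae0,
      hne] with r h1 h2 h3 hr
    rcases lt_or_ge r τ with h | h
    · exact h1 ⟨hr.1, h⟩
    · have hrT : r < T := lt_of_le_of_ne hr.2 h3
      refine tendsto_of_tendsto_yOf hD ⟨hτ.trans h, hr.2.trans hT⟩ ?_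
        (h2 ⟨by linarith, by linarith⟩)
      rw [huy r ⟨h, hr.2.trans hT⟩]
      exact hyt r ⟨h, hr.2⟩
  have hη₀0 : 0 ≤ η₀ := ge_of_tendsto' hη₀ fun k => (hη k).1
  have hinc : ∀ c d, τ ≤ c → c ≤ d → d ≤ T → ‖y d - y c‖ ≤ ∫ ξ in c..d, D.radius η₀ u ξ := by
    intro c d hc hcd hd
    refine le_of_tendsto_of_tendsto' ((hyt d ⟨hc.trans hcd, hd⟩).sub (hyt c ⟨hc, hcd.trans hd⟩)).norm
      (tendsto_integral_radius hD (hη₀.comp hns.tendsto_atTop) (fun k => hη _)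
        (fun k => (hx (ns k)).1.1.mono le_rfl (by linarith) hT)
        (fun k => hA (ns k)) hae hc hcd hd) fun k => ?_
    exact ((mem_X_iff hD hτϑ).1 (hx (ns k))).2 c d hc hcd (hd.trans hT)
  refine ⟨u, mem_X_of_const hD hη₀0 hτT hT hu (fun c d hc hcd hd => ?_) fun t ht => ?_, ns, A, hns,
    hA, hunif, hae⟩
  · rw [huy d ⟨hc.trans hcd, hd.trans hT⟩, huy c ⟨hc, (hcd.trans hd).trans hT⟩]
    exact hinc c d hc hcd hd
  · rw [huy t ⟨hτT.trans ht.1, ht.2⟩, huy T ⟨hτT, hT⟩]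
    simp only [hy, projIcc_of_right_le hτT ht.1, projIcc_right]

end Problem

end NeutralHJ

/-! ### From smooth histories to all histories -/

namespace NeutralHJ

variable {n : ℕ}

namespace Problem

variable {D : Problem n} {φ : ℝ → Vec n → (ℝ → Vec n) → ℝ}

theorem upperIneq_iff {η τ t : ℝ} {z s : Vec n} {w : ℝ → Vec n} :
    D.UpperIneq φ η τ z w t s ↔ ∀ ε > 0, ∃ x ∈ D.X η τ z w,
      φ t (x t) (D.seg x t) + D.omega τ t x s < φ τ z w + ε := by
  constructor
  · intro h ε hε
    have h1 : (⨅ x ∈ D.X η τ z w, ((φ t (x t) (D.seg x t) + D.omega τ t x s : ℝ) : EReal))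
        < ((φ τ z w + ε : ℝ) : EReal) :=
      lt_of_le_of_lt h (EReal.coe_lt_coe_iff.2 (by linarith))
    obtain ⟨x, hx⟩ := iInf_lt_iff.1 h1
    obtain ⟨hxX, hx⟩ := iInf_lt_iff.1 hx
    exact ⟨x, hxX, EReal.coe_lt_coe_iff.1 hx⟩
  · intro h
    refine EReal.le_of_forall_lt_iff_le.1 fun c hc => ?_
    rw [EReal.coe_lt_coe_iff] at hc
    obtain ⟨x, hxX, hx⟩ := h (c - φ τ z w) (by linarith)
    refine (iInf₂_le x hxX).trans (EReal.coe_le_coe_iff.2 ?_)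
    linarith

/-- By `(φ₂)` both sides of the terminal condition are continuous under the approximation of
histories by continuously differentiable ones. -/
theorem terminal_of_C1 (hD : D.Admissible) (h2 : D.Phi2 φ)
    (h : ∀ w ∈ D.C1, φ D.ϑ (atZero w) w = D.σ (atZero w) w) : D.Terminal φ := by
  classical
  have hh := hD.h_pos
  intro z w hw
  obtain ⟨C, W, hW1, hWz, hWA, hWC, hWlim⟩ := exists_C1_approx hh hw z
    (A := {-D.h, ((⌈D.ϑ / D.h⌉ - 1 : ℤ) : ℝ) * D.h - D.ϑ}) (by
      intro c hc
      rw [Finset.mem_insert, Finset.mem_singleton] at hc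
      rcases hc with rfl | rfl
      exacts [⟨le_rfl, by linarith⟩, ceil_point_mem hh _])
  have hWP : ∀ k, W k ∈ D.PLip := fun k => (hW1 k).1.1
  have e1 : Tendsto (fun k => φ D.ϑ z (W k)) atTop (𝓝 (φ D.ϑ z w)) :=
    h2.tendsto hh (Z := fun _ => z) ⟨hD.ϑ_pos.le, le_rfl⟩ hWP hw (fun k ξ _ => hWC k ξ)
      tendsto_const_nhds (hWlim.mono fun ξ h _ => h)
      (tendsto_const_nhds.congr fun k => (hWA k _ (by simp)).symm)
      (tendsto_const_nhds.congr fun k => (hWA k _ (by simp)).symm)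
  have e2 : Tendsto (fun k => D.σ z (W k)) atTop (𝓝 (D.σ z w)) := by
    obtain ⟨C', hC', hwC'⟩ := exists_bound_of_mem_PLip hw
    set M := max 1 (max ‖z‖ (max C C'))
    obtain ⟨lam, hlam, hL⟩ := hD.σ_lip M (lt_of_lt_of_le one_pos (le_max_left _ _))
    have hzM : ‖z‖ ≤ M := (le_max_left _ _).trans (le_max_right _ _)
    have hCM : max C C' ≤ M := (le_max_right _ _).trans (le_max_right _ _)
    have h3 := (tendsto_norm1_sub hh.le (l := atTop) (Eventually.of_forall hWP) hw
      (Eventually.of_forall fun k ξ _ => hWC k ξ) (hWlim.mono fun ξ h _ => h)).const_mul lam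
    rw [mul_zero] at h3
    refine tendsto_sub_nhds_zero_iff.1 (squeeze_zero_norm (fun k => ?_) h3)
    have := hL z (W k) z w ⟨hWP k, hzM, fun ξ _ => (hWC k ξ).trans ((le_max_left _ _).trans hCM)⟩
      ⟨hw, hzM, fun ξ _ => (hwC' ξ).trans ((le_max_right _ _).trans hCM)⟩
    simpa using this
  refine tendsto_nhds_unique e1 (e2.congr fun k => ?_)
  have := h (W k) (hW1 k)
  rw [hWz] at this
  exact this.symm

/-- The `C¹`-minimax inequality extends to all histories, with `η = 0` and with the infimum
attained: approximate the history, and use the compactness of the trajectories. -/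
theorem C1MinimaxUpper.exists_trajectory (hD : D.Admissible) (h2 : D.Phi2 φ)
    (h : D.C1MinimaxUpper φ) {i : ℕ} (hi : i < D.I) {τ t : ℝ}
    (hτ : τ ∈ Ico (i * D.h) ((i + 1) * D.h)) (ht : t ∈ Ioc τ ((i + 1) * D.h)) (z : Vec n)
    {w : ℝ → Vec n} (hw : w ∈ D.PLip) (s : Vec n) :
    ∃ x ∈ D.X 0 τ z w, φ t (x t) (D.seg x t) + D.omega τ t x s ≤ φ τ z w := by
  classical
  have hh := hD.h_pos
  have hτ0 : 0 ≤ τ := le_trans (by positivity) hτ.1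
  have htϑ : t ≤ D.ϑ := ht.2.trans (hD.succ_mul_le hi)
  have hth : t ≤ τ + D.h := by linarith [ht.2, hτ.1]
  have hti : t ∈ Ioc (i * D.h) ((i + 1) * D.h) := ⟨hτ.1.trans_lt ht.1, ht.2⟩
  obtain ⟨C, W, hW1, hWz, hWA, hWC, hWlim⟩ := exists_C1_approx hh hw z
    (A := ({-D.h, ((⌈τ / D.h⌉ - 1 : ℤ) : ℝ) * D.h - τ, t - D.h - τ, i * D.h - τ} :
      Finset ℝ).filter (· ∈ Ico (-D.h) 0)) (fun a ha => (Finset.mem_filter.1 ha).2)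
  have hWP : ∀ k, W k ∈ D.PLip := fun k => (hW1 k).1.1
  have hη : ∀ k : ℕ, 1 / ((k : ℝ) + 1) ∈ Ioc (0 : ℝ) 1 := fun k =>
    ⟨by positivity, by rw [div_le_one (by positivity)]; linarith [k.cast_nonneg (α := ℝ)]⟩
  have hη0 : Tendsto (fun k : ℕ => 1 / ((k : ℝ) + 1)) atTop (𝓝 0) :=
    tendsto_one_div_add_atTop_nhds_zero_nat
  have hex : ∀ k : ℕ, ∃ x ∈ D.X (1 / ((k : ℝ) + 1)) τ z (W k),
      φ t (x t) (D.seg x t) + D.omega τ t x s < φ τ z (W k) + 1 / ((k : ℝ) + 1) := fun k => by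
    have := h i hi τ hτ (W k) (hW1 k) t ht s _ (hη k)
    rw [hWz] at this
    exact upperIneq_iff.1 this _ (hη k).1
  choose x hxX hxle using hex
  have hmemh : -D.h ∈ Ico (-D.h) 0 := ⟨le_rfl, by linarith⟩
  obtain ⟨u, hu, ns, A, hns, hA, hunif, hae⟩ := exists_limit_trajectory hD hτ0 ht.1.le htϑ hth
    (fun k => Ioc_subset_Icc_self (hη k)) hη0 hw (le_max_right C ‖z‖)
    (fun k ξ _ => (hWC k ξ).trans (le_max_left _ _)) (hWlim.mono fun ξ h _ => h)
    (fun k => hWA k _ (by simp [hh])) hxX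
  have hPL : ∀ k, PiecewiseLip (x (ns k)) (τ - D.h) t := fun k =>
    (hxX (ns k)).1.1.mono le_rfl (by linarith [ht.1]) htϑ
  -- the trajectories take fixed values at the times before `τ` that enter `υ` at time `t`
  have hval : ∀ r, r ∈ Icc (τ - D.h) τ → (r = t - D.h ∨ r = i * D.h) → ∀ k, x (ns k) r = u r := by
    intro r hr hr' k
    rcases hr.2.eq_or_lt with rfl | hlt
    · rw [(hxX (ns k)).1.2.1, hu.1.2.1]
    · have hmem : r - τ ∈ Ico (-D.h) 0 := ⟨by linarith [hr.1], by linarith⟩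
      rw [(hxX (ns k)).1.2.2 _ ⟨hr.1, hlt⟩, hu.1.2.2 _ ⟨hr.1, hlt⟩]
      refine hWA _ _ (Finset.mem_filter.2 ⟨?_, hmem⟩)
      rcases hr' with rfl | rfl <;> simp
  have hval1 := hval (t - D.h) ⟨by linarith [ht.1], by linarith⟩ (Or.inl rfl)
  have hval2 := hval (i * D.h) ⟨by linarith [hτ.2], hτ.1⟩ (Or.inr rfl)
  have hZ : Tendsto (fun k => x (ns k) t) atTop (𝓝 (u t)) := by
    refine tendsto_of_tendsto_yOf hD ⟨hτ0.trans ht.1.le, htϑ⟩ (hunif.tendsto_at ⟨ht.1.le, le_rfl⟩) ?_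
    simp only [hval1]
    exact tendsto_const_nhds
  have hcp : ((⌈t / D.h⌉ - 1 : ℤ) : ℝ) * D.h - t = i * D.h - t := by
    rw [ceil_div_sub_one hh hti, Int.cast_natCast]
  have hcm : (i : ℝ) * D.h - t ∈ Ico (-D.h) 0 := hcp ▸ ceil_point_mem hh t
  have hφt : Tendsto (fun k => φ t (x (ns k) t) (D.seg (x (ns k)) t)) atTop
      (𝓝 (φ t (u t) (D.seg u t))) := by
    refine h2.tendsto hh (C := A) ⟨hτ0.trans ht.1.le, htϑ⟩
      (fun k => seg_mem_PLip hh.le (hPL k) (by linarith [ht.1]) le_rfl)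
      (seg_mem_PLip hh.le hu.1.1 (by linarith [ht.1]) htϑ) (fun k ξ hξ => ?_) hZ ?_ ?_ ?_
    · rw [seg_apply hξ]
      exact hA _ _ ⟨by linarith [hξ.1, ht.1], by linarith [hξ.2]⟩
    · filter_upwards [(measurePreserving_add_left volume t).quasiMeasurePreserving.ae hae]
        with ξ h3 hξ
      simp only [seg_apply hξ]
      exact h3 ⟨by linarith [hξ.1, ht.1], by linarith [hξ.2]⟩
    · simp only [seg_apply hmemh, ← sub_eq_add_neg, hval1]
      exact tendsto_const_nhds
    · rw [hcp]
      simp only [seg_apply hcm, add_sub_cancel, hval2]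
      exact tendsto_const_nhds
  have hω : Tendsto (fun k => D.omega τ t (x (ns k)) s) atTop (𝓝 (D.omega τ t u s)) :=
    tendsto_sub_nhds_zero_iff.1 (tendsto_omega_sub hD hτ0 htϑ hPL
      (hu.1.1.mono le_rfl (by linarith [ht.1]) htϑ) (fun k => hA _) hae hunif s
      (t := fun _ => t) fun _ => ⟨ht.1.le, le_rfl⟩)
  have hφτ : Tendsto (fun k => φ τ z (W k)) atTop (𝓝 (φ τ z w)) :=
    h2.tendsto hh (Z := fun _ => z) ⟨hτ0, ht.1.le.trans htϑ⟩ hWP hw (fun k ξ _ => hWC k ξ)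
      tendsto_const_nhds (hWlim.mono fun ξ h _ => h)
      (tendsto_const_nhds.congr fun k => (hWA k _ (by simp [hh])).symm)
      (tendsto_const_nhds.congr fun k => (hWA k _
        (Finset.mem_filter.2 ⟨by simp, ceil_point_mem hh τ⟩)).symm)
  refine ⟨u, hu, le_of_tendsto_of_tendsto' (hφt.add hω) ?_ fun k => (hxle (ns k)).le⟩
  have := (hφτ.add hη0).comp hns.tendsto_atTop
  rwa [add_zero] at this

/-- Optimal trajectories on the successive intervals `[i h, (i + 1) h]` are glued together. -/
theorem C1MinimaxUpper.minimaxUpper (hD : D.Admissible) (h2 : D.Phi2 φ)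
    (h : D.C1MinimaxUpper φ) : D.MinimaxUpper φ := by
  have hh := hD.h_pos
  intro τ z w hG hτϑ t₀ ht₀ s
  obtain ⟨⟨hτ0, -⟩, hw⟩ := hG
  simp only at hτ0 hw
  obtain ⟨i, hi, hτi⟩ := hD.exists_index hτ0 hτϑ
  have key : ∀ j : ℕ, ∀ t ∈ Ioc τ D.ϑ, t ≤ (i + 1 + j : ℕ) * D.h →
      ∃ x ∈ D.X 0 τ z w, φ t (x t) (D.seg x t) + D.omega τ t x s ≤ φ τ z w := by
    intro j
    induction j with
    | zero =>
      intro t ht htj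
      exact h.exists_trajectory hD h2 hi hτi ⟨ht.1, by simpa using htj⟩ z hw s
    | succ j ih =>
      intro t ht htj
      set r : ℝ := (i + 1 + j : ℕ) * D.h with hr
      rcases le_or_gt t r with htr | htr
      · exact ih t ht htr
      have hτr : τ < r := by
        refine hτi.2.trans_le (mul_le_mul_of_nonneg_right ?_ hh.le)
        push_cast; linarith [j.cast_nonneg (α := ℝ)]
      have hrϑ : r ∈ Icc τ D.ϑ := ⟨hτr.le, htr.le.trans ht.2⟩
      have hjI : i + 1 + j < D.I := by
        have : r < D.I * D.h := htr.trans_le ht.2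
        exact_mod_cast lt_of_mul_lt_mul_right this hh.le
      obtain ⟨x₁, hx₁, hle₁⟩ := ih r ⟨hτr, hrϑ.2⟩ le_rfl
      obtain ⟨x₂, hx₂, hle₂⟩ := h.exists_trajectory hD h2 hjI (τ := r) (t := t)
        ⟨le_rfl, by linarith⟩ ⟨htr, by push_cast at htj ⊢; linarith⟩ (x₁ r)
        (seg_mem_PLip hh.le hx₁.1.1 (by linarith) hrϑ.2) s
      refine ⟨glue r x₁ x₂, glue_mem_X hD hx₁ hrϑ hx₂, ?_⟩
      rw [omega_glue hD hx₁.1 hτ0 hrϑ hx₂.1 ⟨htr.le, ht.2⟩, seg_glue hx₂.1 htr.le,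
        glue_of_ge hx₂.1 (by linarith)]
      linarith
  refine upperIneq_iff.2 fun ε hε => ?_
  obtain ⟨x, hx, hle⟩ := key D.I t₀ ht₀ (by
    refine ht₀.2.trans (mul_le_mul_of_nonneg_right ?_ hh.le)
    push_cast; linarith [i.cast_nonneg (α := ℝ)])
  exact ⟨x, hx, by linarith⟩

end Problem

end NeutralHJ

/-! ### Short-time asymptotics of trajectories -/

namespace NeutralHJ

variable {n : ℕ}

/-- Averages over shrinking intervals converge to `c` when all samples from these intervals do:
an average lies between two values of the function. -/
theorem tendsto_integral_div {f : ℕ → ℝ → ℝ} {a c : ℝ} {δ : ℕ → ℝ} (hδ : ∀ k, 0 < δ k)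
    (hf : ∀ k, IntervalIntegrable (f k) volume a (a + δ k))
    (h : ∀ ξ : ℕ → ℝ, (∀ k, ξ k ∈ Icc a (a + δ k)) →
      Tendsto (fun k => f k (ξ k)) atTop (𝓝 c)) :
    Tendsto (fun k => (∫ ξ in a..(a + δ k), f k ξ) / δ k) atTop (𝓝 c) := by
  have hle : ∀ k, a ≤ a + δ k := fun k => by linarith [hδ k]
  have hint : ∀ k, IntegrableOn (f k) (uIoc a (a + δ k)) := fun k => (hf k).def'
  have hv : ∀ k, volume (uIoc a (a + δ k)) ≠ 0 ∧ volume (uIoc a (a + δ k)) ≠ ⊤ := fun k => by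
    rw [uIoc_of_le (hle k), Real.volume_Ioc]
    simp [hδ k]
  have havg : ∀ k, (⨍ ξ in a..(a + δ k), f k ξ) = (∫ ξ in a..(a + δ k), f k ξ) / δ k := fun k => by
    rw [interval_average_eq_div, add_sub_cancel_left]
  choose ξ hξ h1 using fun k => exists_le_setAverage (hv k).1 (hv k).2 (hint k)
  choose ζ hζ h2 using fun k => exists_setAverage_le (hv k).1 (hv k).2 (hint k)
  simp only [havg] at h1 h2
  have hsub : ∀ k, uIoc a (a + δ k) ⊆ Icc a (a + δ k) := fun k => by
    rw [uIoc_of_le (hle k)]; exact Ioc_subset_Icc_self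
  exact tendsto_of_tendsto_of_tendsto_of_le_of_le (h ξ fun k => hsub k (hξ k))
    (h ζ fun k => hsub k (hζ k)) h1 h2

namespace Problem

variable {D : Problem n} {φ : ℝ → Vec n → (ℝ → Vec n) → ℝ}

section ShortTime

variable {τ : ℝ} {z : Vec n} {w : ℝ → Vec n}

theorem eq_kappa_of_mem_Lam {z' : Vec n} {x : ℝ → Vec n} (hx : x ∈ D.Lam τ z w) {t : ℝ}
    (ht : t ∈ Ico (τ - D.h) τ) : x t = kappa τ z' w t := by
  rw [hx.2.2 t ht, kappa, if_pos ht.2]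

/-- The delayed term of a trajectory shortly after `τ` depends only on the history. -/
theorem sub_eq_yOf_sub_add {x : ℝ → Vec n} (hx : x ∈ D.Lam τ z w) {t : ℝ}
    (ht : t ∈ Ico τ (τ + D.h)) :
    x t - z = (D.yOf x t - D.yOf x τ) + (D.g t (kappa τ z w (t - D.h)) -
      D.g τ (kappa τ z w (τ - D.h))) := by
  have h1 : x (t - D.h) = kappa τ z w (t - D.h) :=
    eq_kappa_of_mem_Lam hx ⟨by linarith [ht.1], by linarith [ht.2]⟩
  have h2 : x (τ - D.h) = kappa τ z w (τ - D.h) :=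
    eq_kappa_of_mem_Lam hx ⟨le_rfl, by linarith [ht.1, ht.2]⟩
  rw [yOf, yOf, hx.2.1, h1, h2]
  abel

/-- Shortly after `τ` a trajectory moves with bounded speed when `y` does. -/
theorem Admissible.exists_norm_sub_le (hD : D.Admissible) (hG : (τ, z, w) ∈ D.GStar) :
    ∃ ρ > 0, ∀ x ∈ D.Lam τ z w, ∀ r ∈ Icc τ (τ + ρ),
      ‖x r - z‖ ≤ ‖D.yOf x r - D.yOf x τ‖ + (‖D.dg τ w‖ + 1) * (r - τ) := by
  have hh := hD.h_pos
  have hτ := hD.mem_Ioo_of_GStar hG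
  have hd := hD.hasDerivWithinAt_g_delay hG (D.kappa_mem_Lam0 (z := z) hτ.2.le hG.2.1).1
  have hb := (hasDerivWithinAt_iff_isLittleO.1 hd).def one_pos
  obtain ⟨u, hu, hsub⟩ := mem_nhdsGE_iff_exists_Icc_subset.1 hb
  have hu : τ < u := hu
  refine ⟨min (u - τ) (D.h / 2), lt_min (by linarith) (by linarith), fun x hx r hr => ?_⟩
  have hru : r ≤ u := by linarith [hr.2, min_le_left (u - τ) (D.h / 2)]
  have hrh : r < τ + D.h := by linarith [hr.2, min_le_right (u - τ) (D.h / 2)]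
  have h1 := hsub ⟨hr.1, hru⟩
  simp only [mem_ofPred_eq, one_mul, Real.norm_eq_abs] at h1
  rw [abs_of_nonneg (sub_nonneg.2 hr.1)] at h1
  rw [sub_eq_yOf_sub_add hx ⟨hr.1, hrh⟩]
  refine (norm_add_le _ _).trans (add_le_add_right ?_ _)
  refine (norm_le_norm_sub_add _ ((r - τ) • D.dg τ w)).trans ?_
  rw [norm_smul, Real.norm_of_nonneg (sub_nonneg.2 hr.1)]
  linarith

variable {x : ℕ → ℝ → Vec n} {δ : ℕ → ℝ} {M : ℝ}

theorem tendsto_state_of_le (hδ0 : Tendsto δ atTop (𝓝 0))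
    (hM : ∀ k, ∀ r ∈ Icc τ (τ + δ k), ‖x k r - z‖ ≤ M * (r - τ)) {ξ : ℕ → ℝ}
    (hξ : ∀ k, ξ k ∈ Icc τ (τ + δ k)) : Tendsto (fun k => x k (ξ k)) atTop (𝓝 z) := by
  refine tendsto_sub_nhds_zero_iff.1 (squeeze_zero_norm (a := fun k => |M| * δ k) (fun k => ?_) ?_)
  · have h1 := hξ k
    refine (hM k _ h1).trans ?_
    exact mul_le_mul (le_abs_self _) (by linarith [h1.2]) (by linarith [h1.1]) (abs_nonneg _)
  · simpa using hδ0.const_mul |M|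

theorem tendsto_time (hδ0 : Tendsto δ atTop (𝓝 0)) {ξ : ℕ → ℝ}
    (hξ : ∀ k, ξ k ∈ Icc τ (τ + δ k)) : Tendsto ξ atTop (𝓝[≥] τ) := by
  refine tendsto_nhdsWithin_iff.2 ⟨?_, Eventually.of_forall fun k => (hξ k).1⟩
  have := hδ0.const_add τ
  rw [add_zero] at this
  exact tendsto_of_tendsto_of_tendsto_of_le_of_le tendsto_const_nhds this (fun k => (hξ k).1)
    fun k => (hξ k).2

theorem tendsto_delay_of_mem_Lam (hh : 0 < D.h) (hτ : τ ≤ D.ϑ) (hw : w ∈ D.PLip)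
    (hx : ∀ k, x k ∈ D.Lam τ z w) (hδ0 : Tendsto δ atTop (𝓝 0)) {ξ : ℕ → ℝ}
    (hξ : ∀ k, ξ k ∈ Icc τ (τ + δ k)) :
    Tendsto (fun k => x k (ξ k - D.h)) atTop (𝓝 (w (-D.h))) := by
  have hκ := (D.kappa_mem_Lam0 (z := z) hτ hw).1
  have h1 := hκ.1.continuousWithinAt_Ici (t := τ - D.h) ⟨le_rfl, by linarith⟩
  have h2 := tendsto_time hδ0 hξ
  have h3 : Tendsto (fun k => ξ k - D.h) atTop (𝓝[≥] (τ - D.h)) :=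
    tendsto_nhdsWithin_iff.2 ⟨(h2.mono_right inf_le_left).sub_const _,
      Eventually.of_forall fun k => by
        have := (hξ k).1
        simp only [mem_Ici]; linarith⟩
  have h4 := h1.tendsto.comp h3
  rw [hκ.2.2 _ ⟨le_rfl, by linarith⟩, show τ - D.h - τ = -D.h by ring] at h4
  refine h4.congr' ?_
  have h5 : ∀ᶠ k in atTop, ξ k < τ + D.h :=
    (h2.mono_right inf_le_left).eventually (gt_mem_nhds (by linarith))
  filter_upwards [h5] with k hk
  exact (eq_kappa_of_mem_Lam (hx k) ⟨by linarith [(hξ k).1], by linarith⟩).symm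

theorem tendsto_radius_average (hD : D.Admissible) (hτ : τ < D.ϑ) (hw : w ∈ D.PLip)
    (hx : ∀ k, x k ∈ D.Lam τ z w) (hδ : ∀ k, 0 < δ k) (hδ0 : Tendsto δ atTop (𝓝 0))
    (hδϑ : ∀ k, τ + δ k ≤ D.ϑ)
    (hM : ∀ k, ∀ r ∈ Icc τ (τ + δ k), ‖x k r - z‖ ≤ M * (r - τ)) (η : ℝ) :
    Tendsto (fun k => (∫ ξ in τ..(τ + δ k), D.radius η (x k) ξ) / δ k) atTop
      (𝓝 (D.cH * (1 + ‖z‖ + ‖w (-D.h)‖) + η)) := by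
  refine tendsto_integral_div hδ (fun k => intervalIntegrable_radius (hx k).1 hD.h_pos.le η le_rfl
    (by linarith [hδ k]) (hδϑ k)) fun ξ hξ => ?_
  have h1 := tendsto_state_of_le hδ0 hM hξ
  have h2 := tendsto_delay_of_mem_Lam hD.h_pos hτ.le hw hx hδ0 hξ
  exact (((h1.norm.const_add 1).add h2.norm).const_mul D.cH).add_const η

theorem tendsto_H_average (hD : D.Admissible) (hτ : τ ∈ Ico 0 D.ϑ) (hw : w ∈ D.PLip)
    (hx : ∀ k, x k ∈ D.Lam τ z w) (hδ : ∀ k, 0 < δ k) (hδ0 : Tendsto δ atTop (𝓝 0))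
    (hδϑ : ∀ k, τ + δ k ≤ D.ϑ)
    (hM : ∀ k, ∀ r ∈ Icc τ (τ + δ k), ‖x k r - z‖ ≤ M * (r - τ)) (s : Vec n) :
    Tendsto (fun k => (∫ ξ in τ..(τ + δ k), D.H ξ (x k ξ) (x k (ξ - D.h)) s) / δ k) atTop
      (𝓝 (D.H τ z (w (-D.h)) s)) := by
  refine tendsto_integral_div hδ (fun k => hD.intervalIntegrable_H (hx k).1 hτ.1 le_rfl s le_rfl
    (by linarith [hδ k]) (hδϑ k)) fun ξ hξ => ?_
  exact hD.tendsto_H ((tendsto_time hδ0 hξ).mono_right inf_le_left)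
    (tendsto_state_of_le hδ0 hM hξ) (tendsto_delay_of_mem_Lam hD.h_pos hτ.2.le hw hx hδ0 hξ)
    tendsto_const_nhds (Eventually.of_forall fun k =>
      ⟨hτ.1.trans (hξ k).1, (hξ k).2.trans (hδϑ k)⟩) ⟨hτ.1, hτ.2.le⟩

/-- The difference quotients of `x` and of `y` differ asymptotically by `∂ᶜⁱ g`. -/
theorem tendsto_slope_state (hD : D.Admissible) (hG : (τ, z, w) ∈ D.GStar)
    (hx : ∀ k, x k ∈ D.Lam τ z w) (hδ : ∀ k, 0 < δ k) (hδ0 : Tendsto δ atTop (𝓝 0)) {f : Vec n}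
    (hf : Tendsto (fun k => (δ k)⁻¹ • (D.yOf (x k) (τ + δ k) - D.yOf (x k) τ)) atTop (𝓝 f)) :
    Tendsto (fun k => (δ k)⁻¹ • (x k (τ + δ k) - z)) atTop (𝓝 (f + D.dg τ w)) := by
  have hh := hD.h_pos
  have hτ := hD.mem_Ioo_of_GStar hG
  have hd := hD.hasDerivWithinAt_g_delay hG (D.kappa_mem_Lam0 (z := z) hτ.2.le hG.2.1).1
  have hd' := hasDerivWithinAt_iff_tendsto_slope.1 hd
  have ht : Tendsto (fun k => τ + δ k) atTop (𝓝[Ici τ \ {τ}] τ) := by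
    refine tendsto_nhdsWithin_iff.2 ⟨by simpa using hδ0.const_add τ, Eventually.of_forall fun k => ?_⟩
    have := hδ k
    exact ⟨by simp only [mem_Ici]; linarith, by simp only [mem_singleton_iff]; linarith⟩
  refine (hf.add (hd'.comp ht)).congr' ?_
  have h5 : ∀ᶠ k in atTop, δ k < D.h := hδ0.eventually (gt_mem_nhds hh)
  filter_upwards [h5] with k hk
  rw [sub_eq_yOf_sub_add (hx k) ⟨by linarith [hδ k], by linarith⟩, smul_add]
  simp [slope_def_module]

/-- Along trajectories that leave `z` in the direction `l`, the functional has the same first-order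
increments as along the constant extension `κ`. -/
theorem tendsto_increment_sub (hD : D.Admissible) (h2 : D.Phi2 φ) {i : ℕ} (hi : i < D.I)
    (hτ : τ ∈ Ioo (i * D.h) ((i + 1) * D.h)) (hw : w ∈ D.PLip)
    (hx : ∀ k, x k ∈ D.Lam τ z w) (hδ : ∀ k, 0 < δ k) (hδ0 : Tendsto δ atTop (𝓝 0))
    (hδT : ∀ k, τ + δ k < (i + 1) * D.h) (hM0 : 0 ≤ M)
    (hM : ∀ k, ∀ r ∈ Icc τ (τ + δ k), ‖x k r - z‖ ≤ M * (r - τ)) {l : Vec n}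
    (hl : Tendsto (fun k => (δ k)⁻¹ • (x k (τ + δ k) - z)) atTop (𝓝 l)) :
    Tendsto (fun k => (φ (τ + δ k) (x k (τ + δ k)) (D.seg (x k) (τ + δ k)) -
      φ (τ + δ k) (z + δ k • l) (D.seg (kappa τ z w) (τ + δ k))) / δ k) atTop (𝓝 0) := by
  have hh := hD.h_pos
  have hTϑ := hD.succ_mul_le hi
  have hτ0 : 0 < τ := lt_of_le_of_lt (by positivity) hτ.1
  have hτϑ : τ < D.ϑ := hτ.2.trans_le hTϑ
  have hδϑ : ∀ k, τ + δ k ≤ D.ϑ := fun k => (hδT k).le.trans hTϑ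
  have hκ := D.kappa_mem_Lam0 (z := z) hτϑ.le hw
  obtain ⟨C, hC, hwC⟩ := exists_bound_of_mem_PLip hw
  have hhδ : ∀ k, δ k < D.h := fun k => by linarith [hδT k, hτ.1]
  set B := C + ‖z‖ + M * D.h + D.h * ‖l‖ + 1 with hB
  have hB0 : 0 < B := by positivity
  obtain ⟨lam, hlam, hL⟩ := h2 B hB0
  have hbd : ∀ k, ∀ t ∈ Icc (τ - D.h) (τ + δ k), ‖x k t‖ ≤ B := fun k t ht => by
    rcases lt_or_ge t τ with h | h
    · rw [(hx k).2.2 t ⟨ht.1, h⟩]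
      refine (hwC _).trans ?_
      have : 0 ≤ ‖z‖ + M * D.h + D.h * ‖l‖ + 1 := by positivity
      linarith
    · have h3 := hM k t ⟨h, ht.2⟩
      have h4 : M * (t - τ) ≤ M * D.h :=
        mul_le_mul_of_nonneg_left (by linarith [ht.2, hhδ k]) hM0
      have h5 := norm_sub_norm_le (x k t) z
      have : 0 ≤ D.h * ‖l‖ := by positivity
      linarith
  have hbκ : ∀ t, ‖kappa τ z w t‖ ≤ B := fun t => by
    have : 0 ≤ M * D.h + D.h * ‖l‖ + 1 := by positivity
    rw [kappa]
    split_ifs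
    · linarith [hwC (t - τ), norm_nonneg z]
    · linarith
  have hzl : ∀ k, ‖z + δ k • l‖ ≤ B := fun k => by
    refine (norm_add_le _ _).trans ?_
    rw [norm_smul, Real.norm_of_nonneg (hδ k).le]
    have := mul_le_mul_of_nonneg_right (hhδ k).le (norm_nonneg l)
    have : 0 ≤ M * D.h := by positivity
    linarith
  have hlim : Tendsto (fun k => lam * (‖(δ k)⁻¹ • (x k (τ + δ k) - z) - l‖ + M * δ k)) atTop
      (𝓝 0) := by
    have := (((hl.sub_const l).norm).add (hδ0.const_mul M)).const_mul lam
    simpa using this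
  refine squeeze_zero_norm (fun k => ?_) hlim
  have hk := hδ k
  have h3 := hL (τ + δ k) ⟨by linarith, hδϑ k⟩ (x k (τ + δ k)) (D.seg (x k) (τ + δ k))
    (z + δ k • l) (D.seg (kappa τ z w) (τ + δ k))
    ⟨seg_mem_PLip hh.le (hx k).1 (by linarith) (hδϑ k), hbd k _ ⟨by linarith, le_rfl⟩,
      fun ξ hξ => by
        simp only [seg_apply hξ]
        exact hbd k _ ⟨by linarith [hξ.1], by linarith [hξ.2]⟩⟩
    ⟨seg_mem_PLip hh.le hκ.1.1 (by linarith) (hδϑ k), hzl k, fun ξ hξ => by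
      simp only [seg_apply hξ]; exact hbκ _⟩
  have h4 := upsilon_seg_sub_le hD (M := M * δ k) (hx k).1 hκ.1.1
    (fun r hr => eq_kappa_of_mem_Lam (hx k) hr) hτ.1 (by linarith : τ ≤ τ + δ k) (hδT k) (hδϑ k)
    (fun r hr => by
      rw [hκ.2 r ⟨hr.1, by linarith [hr.2, hδϑ k]⟩]
      exact (hM k r ⟨hr.1, hr.2.le⟩).trans
        (mul_le_mul_of_nonneg_left (by linarith [hr.2]) hM0))
    (x k (τ + δ k) - (z + δ k • l))
  have e1 : ‖x k (τ + δ k) - (z + δ k • l)‖ = δ k * ‖(δ k)⁻¹ • (x k (τ + δ k) - z) - l‖ := by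
    rw [← Real.norm_of_nonneg hk.le, ← norm_smul, Real.norm_of_nonneg hk.le, smul_sub, smul_smul,
      mul_inv_cancel₀ hk.ne', one_smul, sub_sub]
  rw [Real.norm_eq_abs, abs_div, abs_of_pos hk, div_le_iff₀ hk]
  refine h3.trans ((mul_le_mul_of_nonneg_left h4 hlam.le).trans (le_of_eq ?_))
  rw [e1]
  ring

end ShortTime

/-! ### From the minimax inequalities to directional derivatives -/

/-- Divide the minimax inequality by the length of a shrinking time interval. The increments of `y`
have a limit direction along a subsequence, and it belongs to the ball `F⁰`. -/
theorem MinimaxUpper.diniUpper (hD : D.Admissible) (h2 : D.Phi2 φ) (h : D.MinimaxUpper φ) :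
    D.DiniUpper φ := by
  intro τ z w hG s
  have hh := hD.h_pos
  have hτ := hD.mem_Ioo_of_GStar hG
  obtain ⟨⟨i, hi, hiτ⟩, hwS⟩ := id hG
  simp only at hiτ hwS
  have hw : w ∈ D.PLip := hwS.1
  have hTϑ := hD.succ_mul_le hi
  obtain ⟨C, hC, hwC⟩ := exists_bound_of_mem_PLip hw
  obtain ⟨A, hA⟩ := hD.exists_bound_trajectories (max C ‖z‖)
  obtain ⟨ρ, hρ, hρx⟩ := hD.exists_norm_sub_le hG
  set d := min ρ (((i + 1) * D.h - τ) / 2) with hd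
  have hd0 : 0 < d := lt_min hρ (by linarith [hiτ.2])
  have hdT : τ + d < (i + 1) * D.h := by
    linarith [min_le_right ρ (((i + 1) * D.h - τ) / 2), hiτ.2]
  set δ : ℕ → ℝ := fun k => d * (1 / ((k : ℝ) + 1)) with hδdef
  have hδ : ∀ k, 0 < δ k := fun k => by positivity
  have hδd : ∀ k, δ k ≤ d := fun k => by
    refine mul_le_of_le_one_right hd0.le ?_
    rw [div_le_one (by positivity)]; linarith [k.cast_nonneg (α := ℝ)]
  have hδ0 : Tendsto δ atTop (𝓝 0) := by
    have := (tendsto_one_div_add_atTop_nhds_zero_nat (𝕜 := ℝ)).const_mul d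
    rwa [mul_zero] at this
  have hdρ : d ≤ ρ := min_le_left _ _
  have hδT : ∀ k, τ + δ k < (i + 1) * D.h := fun k => by linarith [hδd k]
  have hδϑ : ∀ k, τ + δ k ≤ D.ϑ := fun k => (hδT k).le.trans hTϑ
  have hex : ∀ k, ∃ x ∈ D.X 0 τ z w, φ (τ + δ k) (x (τ + δ k)) (D.seg x (τ + δ k)) +
      D.omega τ (τ + δ k) x s < φ τ z w + δ k ^ 2 := fun k =>
    upperIneq_iff.1 (h τ z w ⟨⟨hτ.1.le, hτ.2.le⟩, hw⟩ hτ.2 (τ + δ k)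
      ⟨by linarith [hδ k], hδϑ k⟩ s) _ (by have := hδ k; positivity)
  choose x hxX hxle using hex
  have hxA : ∀ k, ∀ t ∈ Icc (τ - D.h) (τ + δ k), ‖x k t‖ ≤ A := fun k =>
    hA 0 ⟨le_rfl, zero_le_one⟩ τ _ z w (x k) hτ.1.le (hδϑ k) (by linarith [hδT k, hiτ.1])
      (le_max_right _ _) (fun ξ _ => (hwC ξ).trans (le_max_left _ _)) (hxX k)
  set K := (D.cH * (1 + A + A) + 1).toNNReal
  have hyK : ∀ k, ∀ r ∈ Icc τ (τ + δ k), ‖D.yOf (x k) r - D.yOf (x k) τ‖ ≤ K * (r - τ) :=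
    fun k r hr => by
      have := (lipschitzOnWith_yOf hD zero_le_one (by linarith [hδ k]) (hδϑ k) (hxX k)
        (hxA k)).norm_sub_le hr (⟨le_rfl, by linarith [hδ k]⟩ : τ ∈ Icc τ (τ + δ k))
      rwa [Real.norm_of_nonneg (sub_nonneg.2 hr.1)] at this
  set M := K + (‖D.dg τ w‖ + 1) with hMdef
  have hM0 : 0 ≤ M := by positivity
  have hM : ∀ k, ∀ r ∈ Icc τ (τ + δ k), ‖x k r - z‖ ≤ M * (r - τ) := fun k r hr => by
    have h3 := hρx (x k) (hxX k).1 r ⟨hr.1, by linarith [hr.2, hδd k]⟩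
    have h4 := hyK k r hr
    rw [hMdef, add_mul]
    linarith
  have hfK : ∀ k, (δ k)⁻¹ • (D.yOf (x k) (τ + δ k) - D.yOf (x k) τ) ∈
      Metric.closedBall (0 : Vec n) K := fun k => by
    have h3 := hyK k (τ + δ k) ⟨by linarith [hδ k], le_rfl⟩
    rw [mem_closedBall_zero_iff, norm_smul, norm_inv, Real.norm_of_nonneg (hδ k).le,
      inv_mul_le_iff₀ (hδ k)]
    rw [add_sub_cancel_left] at h3
    linarith
  obtain ⟨f, -, ns, hns, hf⟩ := (isCompact_closedBall (0 : Vec n) (K : ℝ)).tendsto_subseq hfK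
  have hns' := hns.tendsto_atTop
  have hδns : Tendsto (fun k => δ (ns k)) atTop (𝓝 0) := hδ0.comp hns'
  have hfF : f ∈ D.F 0 z (w (-D.h)) := by
    refine le_of_tendsto_of_tendsto' hf.norm (tendsto_radius_average hD hτ.2 hw
      (fun k => (hxX (ns k)).1) (fun k => hδ (ns k)) hδns (fun k => hδϑ _) (fun k => hM _) 0)
      fun k => ?_
    simp only [Function.comp]
    rw [norm_smul, norm_inv, Real.norm_of_nonneg (hδ _).le, inv_mul_eq_div]
    exact div_le_div_of_nonneg_right (((mem_X_iff hD hτ.2.le).1 (hxX (ns k))).2 _ _ le_rfl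
      (by linarith [hδ (ns k)]) (hδϑ _)) (hδ _).le
  have hl := tendsto_slope_state hD hG (fun k => (hxX (ns k)).1) (fun k => hδ (ns k)) hδns hf
  have hinc := tendsto_increment_sub hD h2 hi hiτ hw (fun k => (hxX (ns k)).1)
    (fun k => hδ (ns k)) hδns (fun k => hδT _) hM0 (fun k => hM _) hl
  have hH := tendsto_H_average hD ⟨hτ.1.le, hτ.2⟩ hw (fun k => (hxX (ns k)).1)
    (fun k => hδ (ns k)) hδns (fun k => hδϑ _) (fun k => hM _) s
  set H₀ := D.H τ z (w (-D.h)) s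
  -- an upper bound for the difference quotients in the limit direction
  have hquot : ∀ k, D.quot φ 1 (f + D.dg τ w) τ z w (δ (ns k)) ≤ δ (ns k) -
      ((∫ ξ in τ..(τ + δ (ns k)), D.H ξ (x (ns k) ξ) (x (ns k) (ξ - D.h)) s) / δ (ns k)) +
      inner ℝ ((δ (ns k))⁻¹ • (D.yOf (x (ns k)) (τ + δ (ns k)) - D.yOf (x (ns k)) τ)) s -
      (φ (τ + δ (ns k)) (x (ns k) (τ + δ (ns k))) (D.seg (x (ns k)) (τ + δ (ns k))) -
        φ (τ + δ (ns k)) (z + δ (ns k) • (f + D.dg τ w))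
          (D.seg (kappa τ z w) (τ + δ (ns k)))) / δ (ns k) := fun k => by
    have h3 := hxle (ns k)
    have hk := hδ (ns k)
    rw [omega] at h3
    rw [quot, real_inner_smul_left]
    simp only [one_mul]
    rw [div_le_iff₀ hk]
    field_simp
    linarith
  have hlimU := ((hδns.sub hH).add (hf.inner (tendsto_const_nhds (x := s)))).sub hinc
  simp only [zero_sub, sub_zero] at hlimU
  refine (iInf₂_le (f + D.dg τ w) ⟨f, hfF, rfl⟩).trans ?_
  have hlow : D.lowerDir φ 1 (f + D.dg τ w) τ z w ≤ ((-H₀ + inner ℝ f s : ℝ) : EReal) := by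
    by_contra hcon
    rw [not_le] at hcon
    obtain ⟨b, hb1, hb2⟩ := EReal.lt_iff_exists_real_btwn.1 hcon
    have hb1 : -H₀ + inner ℝ f s < b := by exact_mod_cast hb1
    have h3 := eventually_lt_of_lt_liminf hb2
    have h4 : Tendsto (fun k => δ (ns k)) atTop (𝓝[>] 0) :=
      tendsto_nhdsWithin_iff.2 ⟨hδns, Eventually.of_forall fun k => hδ (ns k)⟩
    obtain ⟨k, hk1, hk2⟩ := ((h4.eventually h3).and (hlimU.eventually (gt_mem_nhds hb1))).exists
    have hk1 : b < D.quot φ 1 (f + D.dg τ w) τ z w (δ (ns k)) := by exact_mod_cast hk1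
    have := hquot k
    simp only [Function.comp] at hk2
    linarith
  refine (add_le_add_left hlow _).trans ?_
  rw [← EReal.coe_add, inner_add_left]
  exact_mod_cast (by linarith : -H₀ + inner ℝ f s + (inner ℝ (D.dg τ w) s + H₀ -
    (inner ℝ f s + inner ℝ (D.dg τ w) s)) ≤ 0)

end Problem

end NeutralHJ

/-! ### From directional derivatives to the minimax inequalities -/

namespace NeutralHJ

variable {n : ℕ}

theorem _root_.LipschitzOnWith.union_Icc {E : Type*} [PseudoMetricSpace E] {f : ℝ → E} {a b c : ℝ}
    {K K' : ℝ≥0} (h : LipschitzOnWith K f (Icc a b)) (h' : LipschitzOnWith K' f (Icc b c)) :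
    LipschitzOnWith (max K K') f (Icc a c) := by
  have h1 : LipschitzOnWith (max K K') f (Icc a b) := h.weaken (le_max_left _ _)
  have h2 : LipschitzOnWith (max K K') f (Icc b c) := h'.weaken (le_max_right _ _)
  have key : ∀ s ∈ Icc a c, ∀ t ∈ Icc a c, s ≤ t → dist (f s) (f t) ≤ (max K K' : ℝ≥0) * dist s t := by
    intro s hs t ht hst
    rcases le_total t b with htb | htb
    · exact h1.dist_le_mul s ⟨hs.1, hst.trans htb⟩ t ⟨ht.1, htb⟩
    rcases le_total b s with hbs | hbs
    · exact h2.dist_le_mul s ⟨hbs, hs.2⟩ t ⟨htb, ht.2⟩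
    refine (dist_triangle _ (f b) _).trans ((add_le_add
      (h1.dist_le_mul s ⟨hs.1, hbs⟩ b ⟨hs.1.trans hbs, le_rfl⟩)
      (h2.dist_le_mul b ⟨le_rfl, htb.trans ht.2⟩ t ⟨htb, ht.2⟩)).trans (le_of_eq ?_))
    rw [Real.dist_eq, Real.dist_eq, Real.dist_eq, abs_sub_comm s b, abs_sub_comm b t,
      abs_sub_comm s t, abs_of_nonneg (sub_nonneg.2 hbs), abs_of_nonneg (sub_nonneg.2 htb),
      abs_of_nonneg (sub_nonneg.2 hst)]
    ring
  refine LipschitzOnWith.of_dist_le_mul fun s hs t ht => ?_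
  rcases le_total s t with hst | hst
  · exact key s hs t ht hst
  · rw [dist_comm (f s), dist_comm s]
    exact key t ht s hs hst

namespace Problem

variable {D : Problem n} {φ : ℝ → Vec n → (ℝ → Vec n) → ℝ}

/-- A direction in which the lower derivative is small yields, for arbitrarily small time steps, a
trajectory of the relaxed inclusion along which `φ + ω` grows at most at the rate `ε`. -/
theorem DiniUpper.exists_step (hD : D.Admissible) (h2 : D.Phi2 φ) (h : D.DiniUpper φ) {i : ℕ}
    (hi : i < D.I) {τ : ℝ} (hτ : τ ∈ Ioo (i * D.h) ((i + 1) * D.h)) (z : Vec n) {w : ℝ → Vec n}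
    (hwS : w ∈ D.PLipStar) (s : Vec n) {η ε ρ : ℝ} (hη : 0 < η) (hε : 0 < ε) (hρ : 0 < ρ) :
    ∃ δ ∈ Ioo 0 ρ, τ + δ ≤ D.ϑ ∧ ∃ x ∈ D.X η τ z w,
      φ (τ + δ) (x (τ + δ)) (D.seg x (τ + δ)) + D.omega τ (τ + δ) x s ≤ φ τ z w + ε * δ := by
  have hh := hD.h_pos
  have hG : (τ, z, w) ∈ D.GStar := ⟨⟨i, hi, hτ⟩, hwS⟩
  have hτI := hD.mem_Ioo_of_GStar hG
  have hw : w ∈ D.PLip := hwS.1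
  have hTϑ := hD.succ_mul_le hi
  set H₀ := D.H τ z (w (-D.h)) s with hH₀
  have h0 : (⨅ l ∈ D.dirs τ z w, (D.lowerDir φ 1 l τ z w +
      ((inner ℝ (D.dg τ w) s + D.H τ z (w (-D.h)) s - inner ℝ l s : ℝ) : EReal)))
      < ((ε / 2 : ℝ) : EReal) := lt_of_le_of_lt (h τ z w hG s) (by exact_mod_cast half_pos hε)
  obtain ⟨l, hl⟩ := iInf_lt_iff.1 h0
  obtain ⟨⟨f, hf, rfl⟩, hl⟩ := iInf_lt_iff.1 hl
  simp only at hl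
  have hlow : D.lowerDir φ 1 (f + D.dg τ w) τ z w < ((ε / 2 - (H₀ - inner ℝ f s) : ℝ) : EReal) := by
    by_contra hcon
    rw [not_lt] at hcon
    refine absurd hl (not_lt.2 (le_trans (le_of_eq ?_) (add_le_add_left hcon _)))
    rw [← EReal.coe_add, inner_add_left, EReal.coe_eq_coe_iff]
    ring
  have hfreq : ∃ᶠ δ in 𝓝[>] (0 : ℝ),
      D.quot φ 1 (f + D.dg τ w) τ z w δ < ε / 2 - (H₀ - inner ℝ f s) := by
    refine (frequently_lt_of_liminf_lt (h := hlow)).mono fun δ hδ => ?_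
    exact_mod_cast hδ
  obtain ⟨ρ', hρ', hρx⟩ := hD.exists_norm_sub_le hG
  set d := min ρ (min ρ' ((i + 1) * D.h - τ)) with hd
  have hd0 : 0 < d := lt_min hρ (lt_min hρ' (by linarith [hτ.2]))
  have hd1 : d ≤ ρ := min_le_left _ _
  have hd2 : d ≤ ρ' := (min_le_right _ _).trans (min_le_left _ _)
  have hd3 : d ≤ (i + 1) * D.h - τ := (min_le_right _ _).trans (min_le_right _ _)
  obtain ⟨δ, hδl, hδp⟩ := exists_seq_forall_of_frequently
    (hfreq.and_eventually (Ioo_mem_nhdsGT hd0))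
  have hδ0 : Tendsto δ atTop (𝓝 0) := hδl.mono_right inf_le_left
  have hδ : ∀ k, 0 < δ k := fun k => (hδp k).2.1
  have hδd : ∀ k, δ k < d := fun k => (hδp k).2.2
  have hδT : ∀ k, τ + δ k < (i + 1) * D.h := fun k => by linarith [hδd k]
  have hδϑ : ∀ k, τ + δ k ≤ D.ϑ := fun k => (hδT k).le.trans hTϑ
  -- trajectories moving in this direction up to the time `τ + δ k`
  have hex : ∀ k, ∃ x ∈ D.Lam τ z w, ∀ t ∈ Icc τ D.ϑ,
      D.yOf x t = z - D.g τ (w (-D.h)) + (min t (τ + δ k) - τ) • f := fun k => by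
    refine exists_mem_Lam_yOf_eq hD (K := ‖f‖₊) ⟨hτI.1.le, hτI.2.le⟩ hw ?_ ?_
    · refine LipschitzOnWith.of_dist_le_mul fun a _ b _ => ?_
      rw [dist_add_left, dist_eq_norm, ← sub_smul, norm_smul, mul_comm, coe_nnnorm, Real.dist_eq,
        Real.norm_eq_abs, sub_sub_sub_cancel_right]
      refine mul_le_mul_of_nonneg_left ?_ (norm_nonneg _)
      exact abs_min_sub_min_le_max _ _ _ _ |>.trans (by simp)
    · rw [min_eq_left (by linarith [hδ k]), sub_self, zero_smul, add_zero]
  choose x hxL hxy using hex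
  have hyinc : ∀ k, ∀ c ∈ Icc τ (τ + δ k), ∀ d ∈ Icc τ (τ + δ k),
      D.yOf (x k) d - D.yOf (x k) c = (d - c) • f := fun k c hc d hd => by
    rw [hxy k d ⟨hd.1, hd.2.trans (hδϑ k)⟩, hxy k c ⟨hc.1, hc.2.trans (hδϑ k)⟩, min_eq_left hd.2,
      min_eq_left hc.2, add_sub_add_left_eq_sub, ← sub_smul, sub_sub_sub_cancel_right]
  have hmemτ : ∀ k, τ ∈ Icc τ (τ + δ k) := fun k => ⟨le_rfl, by linarith [hδ k]⟩
  have hmemδ : ∀ k, τ + δ k ∈ Icc τ (τ + δ k) := fun k => ⟨by linarith [hδ k], le_rfl⟩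
  set M := ‖f‖ + (‖D.dg τ w‖ + 1) with hMdef
  have hM0 : 0 ≤ M := by positivity
  have hM : ∀ k, ∀ r ∈ Icc τ (τ + δ k), ‖x k r - z‖ ≤ M * (r - τ) := fun k r hr => by
    have h3 := hρx (x k) (hxL k) r ⟨hr.1, by linarith [hr.2, hδd k]⟩
    rw [hyinc k τ (hmemτ k) r hr, norm_smul, Real.norm_of_nonneg (sub_nonneg.2 hr.1)] at h3
    rw [hMdef, add_mul]
    linarith
  -- `‖f‖` is at most the radius of `F⁰` at the vertex, and `η > 0` absorbs the change of the radius
  have hrad : ∀ᶠ k in atTop, ∀ ξ ∈ Icc τ (τ + δ k), ‖f‖ ≤ D.radius η (x k) ξ := by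
    by_contra hcon
    have hbad : ∀ k, ∃ ξ ∈ Icc τ (τ + δ k),
        (∃ ξ ∈ Icc τ (τ + δ k), D.radius η (x k) ξ < ‖f‖) → D.radius η (x k) ξ < ‖f‖ := fun k => by
      by_cases hk : ∃ ξ ∈ Icc τ (τ + δ k), D.radius η (x k) ξ < ‖f‖
      · obtain ⟨ξ, hξ, hlt⟩ := hk
        exact ⟨ξ, hξ, fun _ => hlt⟩
      · exact ⟨τ, hmemτ k, fun hk' => absurd hk' hk⟩
    choose ξ hξ hξbad using hbad
    have h4 := tendsto_state_of_le hδ0 hM hξ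
    have h5 := tendsto_delay_of_mem_Lam hh hτI.2.le hw hxL hδ0 hξ
    have h6 : Tendsto (fun k => D.radius η (x k) (ξ k)) atTop
        (𝓝 (D.cH * (1 + ‖z‖ + ‖w (-D.h)‖) + η)) :=
      (((h4.norm.const_add 1).add h5.norm).const_mul D.cH).add_const η
    have h7 : ‖f‖ < D.cH * (1 + ‖z‖ + ‖w (-D.h)‖) + η := by
      have : ‖f‖ ≤ D.cH * (1 + ‖z‖ + ‖w (-D.h)‖) + 0 := hf
      linarith
    refine hcon ((h6.eventually (lt_mem_nhds h7)).mono fun k hk ζ hζ => ?_)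
    by_contra hlt
    exact absurd (hξbad k ⟨ζ, hζ, not_le.1 hlt⟩) (not_lt.2 hk.le)
  have hslope := tendsto_slope_state hD hG hxL hδ hδ0 (f := f)
    (tendsto_const_nhds.congr fun k => by
      rw [hyinc k τ (hmemτ k) _ (hmemδ k), add_sub_cancel_left, smul_smul,
        inv_mul_cancel₀ (hδ k).ne', one_smul])
  have hinc := tendsto_increment_sub hD h2 hi hτ hw hxL hδ hδ0 hδT hM0 hM hslope
  have hH := tendsto_H_average hD ⟨hτI.1.le, hτI.2⟩ hw hxL hδ hδ0 hδϑ hM s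
  have hsum := hinc.add hH
  rw [zero_add, ← hH₀] at hsum
  obtain ⟨k, hk1, hk2⟩ := (hrad.and (hsum.eventually
    (gt_mem_nhds (show H₀ < H₀ + ε / 2 by linarith)))).exists
  have hδk := hδ k
  refine ⟨δ k, ⟨hδk, by linarith [hδd k]⟩, hδϑ k, x k, ?_, ?_⟩
  · refine mem_X_of_const hD hη.le (T := τ + δ k) (by linarith) (hδϑ k) (hxL k)
      (fun c d hc hcd hd => ?_) fun t ht => ?_
    · rw [hyinc k c ⟨hc, hcd.trans hd⟩ d ⟨hc.trans hcd, hd⟩, norm_smul,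
        Real.norm_of_nonneg (sub_nonneg.2 hcd)]
      have := intervalIntegral.integral_mono_on hcd (intervalIntegrable_const (c := ‖f‖))
        (intervalIntegrable_radius (hxL k).1 hh.le η hc hcd (hd.trans (hδϑ k)))
        fun ξ hξ => hk1 ξ ⟨hc.trans hξ.1, hξ.2.trans hd⟩
      rwa [intervalIntegral.integral_const, smul_eq_mul] at this
    · rw [hxy k t ⟨by linarith [ht.1], ht.2⟩, hxy k _ ⟨by linarith, hδϑ k⟩, min_eq_right ht.1,
        min_self]
  · have hq := (hδp k).1
    rw [quot, div_lt_iff₀ hδk] at hq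
    simp only [one_mul] at hq
    rw [← add_div, div_lt_iff₀ hδk] at hk2
    rw [omega, hyinc k τ (hmemτ k) _ (hmemδ k), add_sub_cancel_left, real_inner_smul_left]
    nlinarith

/-- Trajectories that start from a smooth history with matching end value are Lipschitz
continuous. -/
theorem exists_lipschitzOnWith_trajectory (hD : D.Admissible) {τ T η : ℝ} {w x : ℝ → Vec n}
    (hτ : 0 ≤ τ) (hτT : τ ≤ T) (hT : T ≤ D.ϑ) (hTh : T ≤ τ + D.h) (hw : w ∈ D.Lip)
    (hx : x ∈ D.X η τ (atZero w) w) : ∃ K, LipschitzOnWith K x (Icc (τ - D.h) T) := by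
  have hh := hD.h_pos
  obtain ⟨K, hK⟩ := hw.2
  obtain ⟨v, hv, hwv⟩ := hK.extend_finite_dimension
  have hz : atZero w = v 0 := by
    refine atZero_eq_of_tendsto ((hv.continuous.continuousWithinAt.tendsto).congr' ?_)
    filter_upwards [Ioo_mem_nhdsLT (show -D.h < 0 by linarith)] with ξ hξ
    exact (hwv (Ioo_subset_Ico_self hξ)).symm
  have hxv : ∀ t ∈ Icc (τ - D.h) τ, x t = v (t - τ) := fun t ht => by
    rcases ht.2.eq_or_lt with rfl | hlt
    · rw [hx.1.2.1, hz, sub_self]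
    · rw [hx.1.2.2 t ⟨ht.1, hlt⟩, hwv ⟨by linarith [ht.1], by linarith⟩]
  have hLv : ∀ c : ℝ, LipschitzWith (lipschitzExtensionConstant (Vec n) * K)
      fun t => v (t - c) := fun c a b => by
    simpa only [edist_sub_right] using hv (a - c) (b - c)
  have hL1 : LipschitzOnWith (lipschitzExtensionConstant (Vec n) * K) x (Icc (τ - D.h) τ) :=
    fun a ha b hb => by
      rw [hxv a ha, hxv b hb]
      exact hLv τ a b
  obtain ⟨R, hR⟩ := (isCompact_Icc (a := τ) (b := T)).exists_bound_of_continuousOn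
    ((hLv (D.h + τ)).continuous.continuousOn)
  obtain ⟨Kg, hKg⟩ := hD.exists_lipschitzOnWith_g R
  obtain ⟨Ky, hKy⟩ := hx.2.1
  have hg := LipschitzOnWith.comp hKg
    ((LipschitzWith.id.lipschitzOnWith (s := Icc τ T)).prodMk (hLv (D.h + τ)).lipschitzOnWith)
    (fun t ht => ⟨⟨hτ.trans ht.1, ht.2.trans hT⟩, by simpa using hR t ht⟩)
  have hxg : ∀ t ∈ Icc τ T, x t = D.yOf x t + D.g t (v (t - (D.h + τ))) := fun t ht => by
    rw [yOf, hxv (t - D.h) ⟨by linarith [ht.1], by linarith [ht.2]⟩, sub_sub]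
    abel
  have hL2 : LipschitzOnWith (Ky + Kg * max 1 (lipschitzExtensionConstant (Vec n) * K)) x
      (Icc τ T) := fun a ha b hb => by
    rw [hxg a ha, hxg b hb]
    exact (hKy.mono (Icc_subset_Icc_right hT)).add hg ha hb
  exact ⟨_, hL1.union_Icc hL2⟩

theorem continuousOn_omega (hD : D.Admissible) {τ η : ℝ} {z s : Vec n} {w x : ℝ → Vec n}
    (hτ : 0 ≤ τ) (hτϑ : τ ≤ D.ϑ) (hx : x ∈ D.X η τ z w) :
    ContinuousOn (fun t => D.omega τ t x s) (Icc τ D.ϑ) := by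
  obtain ⟨K, hK⟩ := hx.2.1
  have h1 := intervalIntegral.continuousOn_primitive_interval'
    (hD.intervalIntegrable_H hx.1.1 hτ le_rfl s le_rfl hτϑ le_rfl) left_mem_uIcc
  rw [uIcc_of_le hτϑ] at h1
  exact h1.sub ((hK.continuousOn.sub continuousOn_const).inner continuousOn_const)

/-- From the same initial data, uniform convergence of `y` is uniform convergence of `x` on an
interval of length at most `h`. -/
theorem tendstoUniformlyOn_of_yOf {τ T : ℝ} {z : Vec n} {w u : ℝ → Vec n}
    {x : ℕ → ℝ → Vec n} (hTh : T ≤ τ + D.h) (hx : ∀ k, x k ∈ D.Lam τ z w) (hu : u ∈ D.Lam τ z w)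
    (hy : TendstoUniformlyOn (fun k => D.yOf (x k)) (D.yOf u) atTop (Icc τ T)) :
    TendstoUniformlyOn x u atTop (Icc (τ - D.h) T) := by
  rw [Metric.tendstoUniformlyOn_iff] at hy ⊢
  intro ε hε
  have heq : ∀ k, ∀ t ∈ Icc (τ - D.h) τ, x k t = u t := fun k t ht => by
    rcases ht.2.eq_or_lt with rfl | hlt
    · rw [(hx k).2.1, hu.2.1]
    · rw [(hx k).2.2 t ⟨ht.1, hlt⟩, hu.2.2 t ⟨ht.1, hlt⟩]
  filter_upwards [hy ε hε] with k hk t ht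
  rcases le_total t τ with h | h
  · rwa [heq k t ⟨ht.1, h⟩, dist_self]
  · have := hk t ⟨h, ht.2⟩
    rwa [yOf, yOf, heq k (t - D.h) ⟨by linarith, by linarith [ht.2]⟩, dist_sub_right] at this

/-- The trajectories of the relaxed inclusion reach every time `t` with `φ + ω` growing at most at
the rate `ε`: the set of times for which this is possible is closed by compactness, and it can be
continued to the right by a short step. -/
theorem DiniUpper.c1MinimaxUpper (hD : D.Admissible) (h1 : D.Phi1 φ) (h2 : D.Phi2 φ)
    (h : D.DiniUpper φ) : D.C1MinimaxUpper φ := by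
  intro i hi τ hτ w hwC1 t ht s η hη
  have hh := hD.h_pos
  have hTϑ := hD.succ_mul_le hi
  have hw : w ∈ D.PLip := hwC1.1.1
  have hτ0 : 0 ≤ τ := le_trans (by positivity) hτ.1
  have htϑ : t ≤ D.ϑ := ht.2.trans hTϑ
  have hτϑ : τ < D.ϑ := ht.1.trans_le htϑ
  have hth : t ≤ τ + D.h := by linarith [ht.2, hτ.1]
  set z := atZero w with hz
  refine upperIneq_iff.2 fun ε hε => ?_
  have hcont : ∀ x ∈ D.X η τ z w,
      ContinuousOn (fun r => φ r (x r) (D.seg x r) + D.omega τ r x s) (Icc τ t) := fun x hx => by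
    obtain ⟨K, hK⟩ := exists_lipschitzOnWith_trajectory hD hτ0 ht.1.le htϑ hth hwC1.1 hx
    exact (continuousOn_along_lipschitz hD h1 h2 hτ0 htϑ hK).add
      ((continuousOn_omega hD hτ0 hτϑ.le hx).mono (Icc_subset_Icc_right htϑ))
  -- move away from `τ`, which may be a multiple of `h`, along the trajectory with constant `y`
  obtain ⟨x₀, hx₀L, hx₀y⟩ := exists_mem_Lam_yOf_eq hD (K := 0)
    (y := fun _ => z - D.g τ (w (-D.h))) (z := z) ⟨hτ0, hτϑ.le⟩ hw
    (LipschitzWith.const _).lipschitzOnWith rfl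
  have hx₀ : x₀ ∈ D.X η τ z w := by
    refine mem_X_of_const hD hη.1.le (T := τ) le_rfl hτϑ.le hx₀L (fun c d hc hcd hd => ?_)
      fun r hr => ?_
    · rw [le_antisymm (hcd.trans hd) hc, le_antisymm hd (hc.trans hcd)]
      simp
    · rw [hx₀y r hr, hx₀y τ ⟨le_rfl, hτϑ.le⟩]
  obtain ⟨τ₀, hτ₀, hle₀⟩ : ∃ τ₀ ∈ Ioo τ t,
      φ τ₀ (x₀ τ₀) (D.seg x₀ τ₀) + D.omega τ τ₀ x₀ s < φ τ z w + ε / 2 := by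
    have h3 := (hcont x₀ hx₀ τ ⟨le_rfl, ht.1.le⟩).tendsto
    rw [omega_self, add_zero, hx₀L.2.1, seg_eq_of_mem_Lam hw hx₀L] at h3
    have h4 : Tendsto (fun r : ℝ => r) (𝓝[>] τ) (𝓝[Icc τ t] τ) :=
      tendsto_nhdsWithin_iff.2 ⟨tendsto_id.mono_left inf_le_left, by
        filter_upwards [Ioo_mem_nhdsGT ht.1] with r hr using Ioo_subset_Icc_self hr⟩
    obtain ⟨r, hr1, hr2⟩ := ((eventually_mem_set.2 (Ioo_mem_nhdsGT ht.1)).and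
      ((h3.comp h4).eventually (gt_mem_nhds (show φ τ z w < φ τ z w + ε / 2 by linarith)))).exists
    exact ⟨r, hr1, hr2⟩
  set ε₁ := ε / (4 * D.h) with hε₁
  have hε₁0 : 0 < ε₁ := by positivity
  set S : Set ℝ := {r | ∃ x ∈ D.X η τ z w, φ r (x r) (D.seg x r) + D.omega τ r x s ≤
    φ τ z w + ε / 2 + ε₁ * (r - τ)} with hS
  suffices hsub : Icc τ₀ t ⊆ S by
    obtain ⟨x, hx, hle⟩ := hsub ⟨hτ₀.2.le, le_rfl⟩
    refine ⟨x, hx, hle.trans_lt ?_⟩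
    have h3 : ε₁ * (t - τ) ≤ ε₁ * D.h := mul_le_mul_of_nonneg_left (by linarith) hε₁0.le
    have h4 : ε₁ * D.h = ε / 4 := by rw [hε₁]; field_simp
    linarith
  refine IsClosed.Icc_subset_of_forall_exists_gt ?_ ?_ ?_
  · refine isClosed_of_closure_subset fun r hr => ?_
    obtain ⟨rs, hrs, hrlim⟩ := mem_closure_iff_seq_limit.1 hr
    have hrt : r ∈ Icc τ₀ t := isClosed_Icc.mem_of_tendsto hrlim
      (Eventually.of_forall fun k => (hrs k).2)
    have hsubτ : Icc τ₀ t ⊆ Icc τ t := Icc_subset_Icc_left hτ₀.1.le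
    refine ⟨?_, hrt⟩
    choose x hxX hxle using fun k => (hrs k).1
    obtain ⟨u, hu, ns, A, hns, hA, hunif, hae⟩ := exists_limit_trajectory hD hτ0 ht.1.le htϑ hth
      (η := fun _ => η) (W := fun _ => w) (fun _ => Ioc_subset_Icc_self hη) tendsto_const_nhds hw
      (le_max_right (exists_bound_of_mem_PLip hw).choose ‖z‖)
      (fun k ξ _ => ((exists_bound_of_mem_PLip hw).choose_spec.2 ξ).trans (le_max_left _ _))
      (Eventually.of_forall fun ξ _ => tendsto_const_nhds) (fun _ => rfl) hxX
    have hPL : ∀ k, PiecewiseLip (x k) (τ - D.h) t := fun k =>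
      (hxX k).1.1.mono le_rfl (by linarith [ht.1]) htϑ
    have hPLu : PiecewiseLip u (τ - D.h) t := hu.1.1.mono le_rfl (by linarith [ht.1]) htϑ
    obtain ⟨A', -, hA'⟩ := hPLu.exists_bound_Icc
    set rk : ℕ → ℝ := fun k => rs (ns k)
    have hrk : ∀ k, rk k ∈ Icc τ t := fun k => hsubτ (hrs (ns k)).2
    have hrklim : Tendsto rk atTop (𝓝 r) := hrlim.comp hns.tendsto_atTop
    have hω := tendsto_omega_sub hD hτ0 htϑ (fun k => hPL (ns k)) hPLu (fun k => hA (ns k)) hae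
      hunif s hrk
    have hxu := tendstoUniformlyOn_of_yOf hth (fun k => (hxX (ns k)).1) hu.1 hunif
    have hφ := h2.tendsto_sub (l := atTop) (t := rk) (z := fun k => x (ns k) (rk k))
      (z' := fun k => u (rk k)) (w := fun k => D.seg (x (ns k)) (rk k))
      (w' := fun k => D.seg u (rk k)) (C := max A A')
      (Eventually.of_forall fun k => ⟨hτ0.trans (hrk k).1, (hrk k).2.trans htϑ⟩)
      (Eventually.of_forall fun k => ⟨seg_mem_PLip hh.le (hPL _) (by linarith [(hrk k).1])
        (hrk k).2, (hA _ _ ⟨by linarith [(hrk k).1], (hrk k).2⟩).trans (le_max_left _ _),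
        fun ξ hξ => by
          simp only [seg_apply hξ]
          exact (hA _ _ ⟨by linarith [(hrk k).1, hξ.1], by linarith [(hrk k).2, hξ.2]⟩).trans
            (le_max_left _ _)⟩)
      (Eventually.of_forall fun k => ⟨seg_mem_PLip hh.le hPLu (by linarith [(hrk k).1])
        (hrk k).2, (hA' _ ⟨by linarith [(hrk k).1], (hrk k).2⟩).trans (le_max_right _ _),
        fun ξ hξ => by
          simp only [seg_apply hξ]
          exact (hA' _ ⟨by linarith [(hrk k).1, hξ.1], by linarith [(hrk k).2, hξ.2]⟩).trans
            (le_max_right _ _)⟩) (by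
        rw [Metric.tendsto_nhds]
        intro e he
        have he' : 0 < e / (2 * (3 + D.h)) := by positivity
        filter_upwards [Metric.tendstoUniformlyOn_iff.1 hxu _ he'] with k hk
        rw [Real.dist_eq, sub_zero, abs_of_nonneg (upsilon_nonneg hh.le _ _ _)]
        have hk' : ∀ v ∈ Icc (τ - D.h) t, ‖x (ns k) v - u v‖ ≤ e / (2 * (3 + D.h)) :=
          fun v hv => by
            rw [← dist_eq_norm, dist_comm]
            exact (hk v hv).le
        refine (upsilon_le hh _ (hk' _ ⟨by linarith [(hrk k).1], (hrk k).2⟩) fun ξ hξ => ?_).trans_lt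
          (b := (3 + D.h) * (e / (2 * (3 + D.h)))) ?_
        · simp only [Pi.sub_apply, seg_apply hξ]
          exact hk' _ ⟨by linarith [(hrk k).1, hξ.1], by linarith [(hrk k).2, hξ.2]⟩
        · rw [show (3 + D.h) * (e / (2 * (3 + D.h))) = e / 2 by field_simp]
          linarith)
    have hFu := (hcont u hu r (hsubτ hrt)).tendsto.comp
      (tendsto_nhdsWithin_iff.2 ⟨hrklim, Eventually.of_forall hrk⟩)
    have hlim := (hφ.add hω).add hFu
    simp only [zero_add] at hlim
    refine ⟨u, hu, le_of_tendsto_of_tendsto' hlim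
      ((((hrklim.sub_const τ).const_mul ε₁)).const_add (φ τ z w + ε / 2)) fun k => ?_⟩
    have := hxle (ns k)
    simp only [Function.comp, rk]
    linarith
  · exact ⟨x₀, hx₀, hle₀.le.trans (le_add_of_nonneg_right
      (mul_nonneg hε₁0.le (by linarith [hτ₀.1])))⟩
  · rintro r ⟨⟨x, hx, hle⟩, hr⟩ r' hr'
    have hτr : τ < r := hτ₀.1.trans_le hr.1
    have hrϑ : r ∈ Icc τ D.ϑ := ⟨hτr.le, hr.2.le.trans htϑ⟩
    have hsegS : D.seg x r ∈ D.PLipStar := by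
      refine ⟨seg_mem_PLip hh.le hx.1.1 (by linarith) hrϑ.2, (τ + D.h - r) / 2,
        by linarith [hr.2], by linarith, ?_⟩
      have h3 : ContDiffOn ℝ 1 (fun ξ => w (ξ + (r - τ)))
          (Icc (-D.h) (-D.h + (τ + D.h - r) / 2)) :=
        hwC1.2.comp (f := fun ξ => ξ + (r - τ)) (by fun_prop) fun ξ hξ =>
          ⟨by linarith [hξ.1], by linarith [hξ.2, hr.2]⟩
      refine h3.congr fun ξ hξ => ?_
      rw [seg_apply ⟨hξ.1, by linarith [hξ.2, hr.2]⟩,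
        hx.1.2.2 _ ⟨by linarith [hξ.1], by linarith [hξ.2, hr.2]⟩]
      congr 1
      ring
    obtain ⟨δ, hδ, hδϑ, x₂, hx₂, hle₂⟩ := h.exists_step hD h2 hi
      (τ := r) ⟨hτ.1.trans_lt hτr, hr.2.trans_le ht.2⟩ (x r) hsegS s hη.1 hε₁0
      (sub_pos.2 (show r < r' from hr'))
    refine ⟨r + δ, ⟨glue r x x₂, glue_mem_X hD hx hrϑ hx₂, ?_⟩, by linarith [hδ.1],
      by linarith [hδ.2]⟩
    rw [omega_glue hD hx.1 hτ0 hrϑ hx₂.1 ⟨by linarith [hδ.1], hδϑ⟩,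
      seg_glue hx₂.1 (by linarith [hδ.1]), glue_of_ge hx₂.1 (by linarith [hδ.1])]
    have : ε₁ * (r + δ - τ) = ε₁ * (r - τ) + ε₁ * δ := by ring
    linarith

end Problem

end NeutralHJ

theorem theorem4 {n : ℕ} (D : NeutralHJ.Problem n) (hD : D.Admissible)
    (φ : ℝ → NeutralHJ.Vec n → (ℝ → NeutralHJ.Vec n) → ℝ) :
    List.TFAE [
      D.IsMinimax φ,
      D.IsC1Minimax φ,
      D.IsDini φ,
      D.IsDiffViscosity φ,
      D.IsViscosity φ] := by
  rw [NeutralHJ.Problem.isMinimax_iff_dual, NeutralHJ.Problem.isC1Minimax_iff_dual,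
    NeutralHJ.Problem.isDini_iff_dual, NeutralHJ.Problem.isDiffViscosity_iff_dual,
    NeutralHJ.Problem.isViscosity_iff_dual]
  have hD' := hD.dual
  tfae_have 1 → 3 := fun ⟨h1, h2, hT, h, h'⟩ =>
    ⟨h1, h2, hT, h.diniUpper hD h2, h'.diniUpper hD' h2.neg⟩
  tfae_have 3 → 4 := fun ⟨h1, h2, hT, h, h'⟩ =>
    ⟨h1, h2, hT, h.subdiffIneq hD, h'.subdiffIneq hD'⟩
  tfae_have 4 → 5 := fun ⟨h1, h2, hT, h, h'⟩ =>
    ⟨h1, h2, hT, h.testBelowIneq, h'.testBelowIneq⟩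
  tfae_have 5 → 3 := fun ⟨h1, h2, hT, h, h'⟩ =>
    ⟨h1, h2, hT, h.diniUpper hD h1 h2, h'.diniUpper hD' h1.neg h2.neg⟩
  tfae_have 3 → 2 := fun ⟨h1, h2, hT, h, h'⟩ =>
    ⟨h1, h2, fun w hw => hT (NeutralHJ.Problem.atZero w) w hw.1.1, h.c1MinimaxUpper hD h1 h2,
      h'.c1MinimaxUpper hD' h1.neg h2.neg⟩
  tfae_have 2 → 1 := fun ⟨h1, h2, hT, h, h'⟩ =>
    ⟨h1, h2, NeutralHJ.Problem.terminal_of_C1 hD h2 hT, h.minimaxUpper hD h2,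
      h'.minimaxUpper hD' h2.neg⟩
  tfae_finish
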